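/- \textbf{Curtain model.} Let $X$ be a CAT(0) space. For a geodesic $\alpha:I\to X$ ($I\subseteq\mathbb R$ a closed interval) with closest point projection $\pi_\alpha$ and a number $r$ with $[r-\frac12,r+\frac12]\subset \operatorname{int} I$, the curtain dual to $\alpha$ at $r$ is $h=\pi_\alpha^{-1}(\alpha[r-\frac12,r+\frac12])$; its halfspaces are $h^-=\pi_\alpha^{-1}(\alpha(I\cap(-\infty,r-\frac12)))$ and $h^+=\pi_\alpha^{-1}(\alpha(I\cap(r+\frac12,\infty)))$, and $h$ separates $A,B\subseteq X$ if one of them lies in $h^-$ and the other in $h^+$. A chain is a sequence of pairwise disjoint curtains $h_i$ such that $h_i$ separates $h_{i-1}$ and $h_{i+1}$ for all $i$. Disjoint curtains $h,h'$ are $L$-separated if every chain all of whose members meet both $h$ and $h'$ has cardinality at most $L$; an $L$-chain is a chain whose members are pairwise $L$-separated. Put $d_L(x,x)=0$ and, for $x\ne y$, $d_L(x,y)=1+\max\{|c| : c \text{ an } L\text{-chain each of whose members separates } x \text{ from } y\}$. Given numbers $\lambda_L\in(0,1)$, $L\ge1$, with $\sum_L L^2\lambda_L<\infty$, the curtain model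 $\widehat X$ is the set $X$ with the distance $\hat d=\sum_{L\ge1}\lambda_L d_L$. \textbf{The spaces.} Let $P$ be the universal cover of $\mathbb R^2$ minus the open unit disc, with its length metric, and with polar coordinates $(\theta,r)\in\mathbb R\times[1,\infty)$; let $\alpha^+(t)=(t,1)$, $t\ge0$. Let $W$ be obtained from $P$ by gluing, for each $i\in\mathbb N=\{0,1,2,\dots\}$, a geodesic ray $\gamma_i$ with its origin at the point $(i,2^i)$, and let $Z$ be obtained from $P$ by gluing, for each $i\in\mathbb N$, a geodesic ray with its origin at the point $(0,2^i)$. \textbf{Statement.} $W$ and $Z$ are quasi-isometric CAT(0) spaces. For every choice of the weights $(\lambda_L)$, the curtain models $\widehat W$ and $\widehat Z$ are Gromov hyperbolic metric spaces, and their Gromov boundaries $\partial\widehat W$ and $\partial\widehat Z$ are not homeomorphic. Moreover, the rays $\gamma_i$ and $\alpha^+$ have endpoints $[\gamma_i]$ and $[\alpha^+]$ in $\partial\widehat W$, these are pairwise distinct, and $[\gamma_i]\to[\alpha^+]$ in $\partial\widehat W$ as $i\to\infty$; whereas in $\partial\widehat Z$ there is no sequence $(\xi_i)$ converging to a point $\xi$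 with $\xi_i\neq\xi$ for all $i$. -/

import Mathlib

open Set Filter Topology

noncomputable section

/-! ### Metric geometry: CAT(0) spaces, quasi-isometries -/

/-- `α` restricted to `I` is a geodesic (an isometric embedding of `I`). -/
def IsGeodesicOn {X : Type*} [MetricSpace X] (α : ℝ → X) (I : Set ℝ) : Prop :=
  ∀ s ∈ I, ∀ t ∈ I, dist (α s) (α t) = |s - t|

/-- Any two points are joined by a geodesic. -/
def IsGeodesicSpace (X : Type*) [MetricSpace X] : Prop :=
  ∀ x y : X, ∃ α : ℝ → X, α 0 = x ∧ α (dist x y) = y ∧ IsGeodesicOn α (Icc 0 (dist x y))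

/-- `p` lies on a geodesic segment from `x` to `y` (in a geodesic space). -/
def LiesBetween {X : Type*} [MetricSpace X] (x p y : X) : Prop :=
  dist x p + dist p y = dist x y

/-- A CAT(0) space: a geodesic space all of whose geodesic triangles are at least as thin as
their comparison triangles in the Euclidean plane. Here `x, y, z` are the vertices, `p` and `q`
are points on the sides `[x, y]` and `[x, z]`, and the primed points are the comparison points.
(For two points on the same geodesic side the comparison is an equality.) -/
def IsCAT0 (X : Type*) [MetricSpace X] : Prop :=
  IsGeodesicSpace X ∧
    ∀ (x y z p q : X) (x' y' z' p' q' : EuclideanSpace ℝ (Fin 2)),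
      dist x' y' = dist x y → dist y' z' = dist y z → dist x' z' = dist x z →
      LiesBetween x p y → LiesBetween x q z →
      dist x' p' = dist x p → dist p' y' = dist p y →
      dist x' q' = dist x q → dist q' z' = dist q z →
      dist p q ≤ dist p' q'

/-- Two metric spaces are quasi-isometric. -/
def QuasiIsometric (X Y : Type*) [MetricSpace X] [MetricSpace Y] : Prop :=
  ∃ (f : X → Y) (K C : ℝ), 1 ≤ K ∧ 0 ≤ C ∧
    (∀ x x' : X, K⁻¹ * dist x x' - C ≤ dist (f x) (f x') ∧
      dist (f x) (f x') ≤ K * dist x x' + C) ∧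
    ∀ y : Y, ∃ x : X, dist (f x) y ≤ C

/-! ### Curtains and the curtain model -/

/-- The points of `X` having a closest point of `α(I)` in `α(J)`, i.e. the preimage of `α(J)`
under the closest point projection to the geodesic `α : I → X`. -/
def projPreimage {X : Type*} [MetricSpace X] (α : ℝ → X) (I J : Set ℝ) : Set X :=
  {x | ∃ s ∈ I ∩ J, ∀ t ∈ I, dist x (α s) ≤ dist x (α t)}

/-- A curtain is given by a geodesic `α : I → X`, where `I` is a closed interval (bounded or not),
and a number `r` such that `[r - 1/2, r + 1/2]` is in the interior of `I`. -/
structure Curtain (X : Type*) [MetricSpace X] where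
  α : ℝ → X
  I : Set ℝ
  isClosed : IsClosed I
  ordConnected : I.OrdConnected
  isGeodesic : IsGeodesicOn α I
  r : ℝ
  pole_subset : Icc (r - 1 / 2) (r + 1 / 2) ⊆ interior I

namespace Curtain

variable {X : Type*} [MetricSpace X]

/-- The curtain as a set of points. -/
def carrier (h : Curtain X) : Set X := projPreimage h.α h.I (Icc (h.r - 1 / 2) (h.r + 1 / 2))

/-- The halfspace `h⁻`. -/
def neg (h : Curtain X) : Set X := projPreimage h.α h.I (Iio (h.r - 1 / 2))

/-- The halfspace `h⁺`. -/
def pos (h : Curtain X) : Set X := projPreimage h.α h.I (Ioi (h.r + 1 / 2))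

/-- The curtain `h` separates `A` and `B`: they are in different halfspaces of `h`. -/
def Separates (h : Curtain X) (A B : Set X) : Prop :=
  (A ⊆ h.neg ∧ B ⊆ h.pos) ∨ (A ⊆ h.pos ∧ B ⊆ h.neg)

/-- A finite chain of curtains of cardinality `n`. -/
def IsChain {n : ℕ} (c : Fin n → Curtain X) : Prop :=
  (∀ i j, i ≠ j → Disjoint (c i).carrier (c j).carrier) ∧
    ∀ i j k : Fin n, (i : ℕ) + 1 = j → (j : ℕ) + 1 = k →
      (c j).Separates (c i).carrier (c k).carrier

/-- Disjoint curtains are `L`-separated if every chain, all of whose members meet both of them,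
has cardinality at most `L`. -/
def LSeparated (L : ℕ) (h h' : Curtain X) : Prop :=
  Disjoint h.carrier h'.carrier ∧
    ∀ (n : ℕ) (c : Fin n → Curtain X), IsChain c →
      (∀ i, ((c i).carrier ∩ h.carrier).Nonempty ∧ ((c i).carrier ∩ h'.carrier).Nonempty) →
      n ≤ L

/-- An `L`-chain: a chain whose members are pairwise `L`-separated. -/
def IsLChain (L : ℕ) {n : ℕ} (c : Fin n → Curtain X) : Prop :=
  IsChain c ∧ ∀ i j, i ≠ j → LSeparated L (c i) (c j)

end Curtain

open Classical in
/-- The metric `d_L`: one plus the maximal cardinality of an `L`-chain separating the two points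
(and `0` on the diagonal). -/
def curtainDistL {X : Type*} [MetricSpace X] (L : ℕ) (x y : X) : ℝ :=
  if x = y then 0 else
    1 + ((sSup {n : ℕ | ∃ c : Fin n → Curtain X, Curtain.IsLChain L c ∧
      ∀ i, (c i).Separates {x} {y}} : ℕ) : ℝ)

/-- Admissible weights `(λ_L)_{L ≥ 1}`: numbers in `(0, 1)` with `∑ L² λ_L < ∞`. The inequalities
`∑ λ_L < ∑ L λ_L < ∑ L² λ_L` are automatic. The value of `lam` at `0` is not used. -/
def IsCurtainWeight (lam : ℕ → ℝ) : Prop :=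
  (∀ L, 1 ≤ L → 0 < lam L ∧ lam L < 1) ∧ Summable fun L : ℕ => (L : ℝ) ^ 2 * lam L

/-- The distance `∑_{L ≥ 1} λ_L d_L` of the curtain model of `X`, whose points are those of `X`. -/
def curtainDist (X : Type*) [MetricSpace X] (lam : ℕ → ℝ) (x y : X) : ℝ :=
  ∑' L : ℕ, lam (L + 1) * curtainDistL (L + 1) x y

/-! ### Gromov hyperbolicity and the Gromov boundary -/

/-- The function `d` is a metric on `X`. -/
def IsMetric {X : Type*} (d : X → X → ℝ) : Prop :=
  (∀ x y, d x y = 0 ↔ x = y) ∧ (∀ x y, d x y = d y x) ∧ ∀ x y z, d x z ≤ d x y + d y z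

/-- The Gromov product `(x|y)_o`. -/
def gromovProduct {X : Type*} (d : X → X → ℝ) (o x y : X) : ℝ := (d o x + d o y - d x y) / 2

/-- Gromov hyperbolicity (four point condition). -/
def IsGromovHyperbolic {X : Type*} (d : X → X → ℝ) : Prop :=
  ∃ δ : ℝ, ∀ o x y z : X,
    min (gromovProduct d o x y) (gromovProduct d o y z) - δ ≤ gromovProduct d o x z

/-- `(x_i|y_j) → ∞` as `i, j → ∞`. -/
def GromovEquiv {X : Type*} (d : X → X → ℝ) (u v : ℕ → X) : Prop :=
  ∀ o : X, Tendsto (fun p : ℕ × ℕ => gromovProduct d o (u p.1) (v p.2)) atTop atTop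

/-- Sequences converging at infinity: `(x_i|x_j) → ∞` as `i, j → ∞`. -/
def GromovSeq {X : Type*} (d : X → X → ℝ) : Type _ := {u : ℕ → X // GromovEquiv d u u}

/-- The Gromov boundary: equivalence classes of sequences converging at infinity, two of them
being equivalent if `(x_i|y_j) → ∞`. (This is an equivalence relation when `d` is a
Gromov hyperbolic metric.) -/
def GromovBoundary {X : Type*} (d : X → X → ℝ) : Type _ :=
  Quot fun u v : GromovSeq d => GromovEquiv d u.1 v.1

namespace GromovBoundary

variable {X : Type*} {d : X → X → ℝ}

/-- The Gromov product of two boundary points: the supremum over all representatives of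
`liminf (x_i|y_j)`. -/
def product (o : X) (ξ η : GromovBoundary d) : EReal :=
  sSup {c | ∃ u v : GromovSeq d, Quot.mk _ u = ξ ∧ Quot.mk _ v = η ∧
    c = liminf (fun p : ℕ × ℕ => ((gromovProduct d o (u.1 p.1) (v.1 p.2) : ℝ) : EReal)) atTop}

/-- The topology of the Gromov boundary: the sets `{η | (ξ|η)_o ≥ R}` form a neighbourhood basis
of `ξ` (in a hyperbolic space, for any choice of the base point `o`). -/
instance : TopologicalSpace (GromovBoundary d) where
  IsOpen U := ∀ ξ ∈ U, ∀ o : X, ∃ R : ℝ, ∀ η, (R : EReal) ≤ product o ξ η → η ∈ U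
  isOpen_univ := fun _ _ _ => ⟨0, fun _ _ => trivial⟩
  isOpen_inter := by
    intro U V hU hV ξ hξ o
    obtain ⟨R, hR⟩ := hU ξ hξ.1 o
    obtain ⟨S, hS⟩ := hV ξ hξ.2 o
    refine ⟨max R S, fun η hη => ⟨hR η (le_trans ?_ hη), hS η (le_trans ?_ hη)⟩⟩
    · exact_mod_cast le_max_left R S
    · exact_mod_cast le_max_right R S
  isOpen_sUnion := by
    intro s hs ξ hξ o
    obtain ⟨U, hU, hξU⟩ := hξ
    obtain ⟨R, hR⟩ := hs U hU ξ hξU o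
    exact ⟨R, fun η hη => ⟨U, hU, hR η hη⟩⟩

/-- `ξ` is the endpoint at infinity of the path `γ : [0, ∞) → X`: for all `t_n → ∞` the sequence
`γ(t_n)` converges at infinity and represents `ξ`. -/
def IsEndpoint (γ : ℝ → X) (ξ : GromovBoundary d) : Prop :=
  ∀ t : ℕ → ℝ, Tendsto t atTop atTop →
    ∃ h : GromovEquiv d (fun n => γ (t n)) (fun n => γ (t n)),
      (Quot.mk _ (⟨fun n => γ (t n), h⟩ : GromovSeq d) : GromovBoundary d) = ξ

end GromovBoundary

/-! ### The infinite parking lot -/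

/-- The infinite parking lot: the universal cover of the plane minus the open unit disc, in its
polar coordinates `(θ, r) ∈ ℝ × [1, ∞)`. -/
@[ext] structure ParkingLot where
  angle : ℝ
  radius : ℝ
  one_le_radius : 1 ≤ radius

namespace ParkingLot

/-- The coordinate space `ℝ × [1, ∞)` with its usual topology. -/
abbrev Coord : Type := ℝ × Ici (1 : ℝ)

def coord (p : ParkingLot) : Coord := (p.angle, ⟨p.radius, p.one_le_radius⟩)

/-- The covering map `(θ, r) ↦ r e^{iθ}` onto the plane minus the open unit disc. -/
def cover (c : Coord) : ℂ := (c.2 : ℝ) * Complex.exp (c.1 * Complex.I)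

/-- The length of a path in the parking lot, which is the length (total variation) of its
projection to the plane. -/
def pathLength {p q : Coord} (γ : Path p q) : ENNReal :=
  eVariationOn (fun t => cover (γ t)) univ

/-- The infimum of the lengths of the paths joining two points. -/
def lengthDist (p q : Coord) : ENNReal := ⨅ γ : Path p q, pathLength γ

theorem lengthDist_self (p : Coord) : lengthDist p p = 0 := by
  refine le_antisymm ((iInf_le _ (Path.refl p)).trans (le_of_eq ?_)) bot_le
  apply eVariationOn.constant_on
  rintro _ ⟨s, -, rfl⟩ _ ⟨t, -, rfl⟩
  simp

theorem lengthDist_comm_le (p q : Coord) : lengthDist p q ≤ lengthDist q p := by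
  refine le_iInf fun γ => (iInf_le _ γ.symm).trans ?_
  exact eVariationOn.comp_le_of_antitoneOn (fun t => cover (γ t)) unitInterval.symm
    (fun a _ b _ hab => unitInterval.symm_le_symm.2 hab) (mapsTo_univ _ _)

theorem lengthDist_triangle (p q r : Coord) :
    lengthDist p r ≤ lengthDist p q + lengthDist q r := by
  refine ENNReal.le_of_forall_pos_le_add fun ε hε hfin => ?_
  have h1 : lengthDist p q ≠ ⊤ := fun h => by simp [h] at hfin
  have h2 : lengthDist q r ≠ ⊤ := fun h => by simp [h] at hfin
  have hε' : (0 : ENNReal) < ε / 2 := by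
    simpa using hε.ne'
  obtain ⟨γ, hγ⟩ := iInf_lt_iff.1 (ENNReal.lt_add_right h1 hε'.ne')
  obtain ⟨γ', hγ'⟩ := iInf_lt_iff.1 (ENNReal.lt_add_right h2 hε'.ne')
  have key : pathLength (γ.trans γ') ≤ pathLength γ + pathLength γ' := by
    have hhalf : (1 / 2 : ℝ) ∈ unitInterval := by constructor <;> norm_num
    set m : unitInterval := ⟨1 / 2, hhalf⟩ with hm
    have hs := eVariationOn.Icc_add_Icc (fun t => cover ((γ.trans γ') t)) (s := univ)
      (a := (0 : unitInterval)) (b := m) (c := 1) unitInterval.nonneg'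
      unitInterval.le_one' (mem_univ _)
    have hu : (univ : Set unitInterval) ∩ Icc 0 1 = univ := by
      ext t; simp [unitInterval.le_one']
    unfold pathLength
    rw [hu] at hs
    rw [← hs]
    gcongr
    · refine le_trans (le_of_eq ?_) (eVariationOn.comp_le_of_monotoneOn
        (fun t => cover (γ t)) (s := univ) (t := univ ∩ Icc 0 m)
        (fun t => projIcc 0 1 zero_le_one (2 * (t : ℝ))) ?_ (mapsTo_univ _ _))
      · apply eVariationOn.congr
        rintro t ⟨-, -, ht⟩
        have ht' : (t : ℝ) ≤ 1 / 2 := ht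
        simp only [Path.trans, Path.coe_mk_mk, Function.comp_apply, if_pos ht', Path.extend, IccExtend]
        rfl
      · intro a _ b _ hab
        apply monotone_projIcc
        have : (a : ℝ) ≤ b := hab
        linarith
    · refine le_trans (le_of_eq ?_) (eVariationOn.comp_le_of_monotoneOn
        (fun t => cover (γ' t)) (s := univ) (t := univ ∩ Icc m 1)
        (fun t => projIcc 0 1 zero_le_one (2 * (t : ℝ) - 1)) ?_ (mapsTo_univ _ _))
      · apply eVariationOn.congr
        rintro t ⟨-, ht, -⟩
        have ht' : 1 / 2 ≤ (t : ℝ) := ht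
        rcases ht'.eq_or_lt with h | h
        · have h3 : (2 * (t : ℝ)) = 1 := by linarith
          simp [Path.trans, ← h, Path.extend, IccExtend]
        · simp only [Path.trans, Path.coe_mk_mk, Function.comp_apply, if_neg (not_le.2 h),
            Path.extend, IccExtend]
          rfl
      · intro a _ b _ hab
        apply monotone_projIcc
        have : (a : ℝ) ≤ b := hab
        linarith
  calc lengthDist p r ≤ pathLength (γ.trans γ') := iInf_le _ _
    _ ≤ pathLength γ + pathLength γ' := key
    _ ≤ (lengthDist p q + ε / 2) + (lengthDist q r + ε / 2) := add_le_add hγ.le hγ'.le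
    _ = lengthDist p q + lengthDist q r + ε := by
      rw [add_add_add_comm, ENNReal.add_halves]

theorem cover_dist_le (θ θ' r r' : ℝ) :
    ‖(r : ℂ) * Complex.exp (θ * Complex.I) - r' * Complex.exp (θ' * Complex.I)‖ ≤
      |r - r'| + |r'| * |θ - θ'| := by
  have h : (r : ℂ) * Complex.exp (θ * Complex.I) - r' * Complex.exp (θ' * Complex.I) =
      ((r - r' : ℝ) : ℂ) * Complex.exp (θ * Complex.I) +
        r' * (Complex.exp (θ' * Complex.I) * (Complex.exp (Complex.I * (θ - θ' : ℝ)) - 1)) := by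
    rw [mul_sub, ← Complex.exp_add]
    have : (θ' : ℂ) * Complex.I + Complex.I * (θ - θ' : ℝ) = θ * Complex.I := by
      push_cast; ring
    rw [this]; push_cast; ring
  rw [h]
  refine (norm_add_le _ _).trans ?_
  rw [norm_mul, norm_mul, norm_mul, Complex.norm_exp_ofReal_mul_I, Complex.norm_exp_ofReal_mul_I,
    Complex.norm_real, Complex.norm_real, mul_one, one_mul, Real.norm_eq_abs, Real.norm_eq_abs]
  gcongr
  simpa using Real.norm_exp_I_mul_ofReal_sub_one_le (x := θ - θ')

theorem lengthDist_ne_top (p q : Coord) : lengthDist p q ≠ ⊤ := by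
  obtain ⟨θ, r, hr⟩ := p
  obtain ⟨θ', r', hr'⟩ := q
  have hr1 : 1 ≤ r := hr
  have hr1' : 1 ≤ r' := hr'
  let γ : Path (((θ, ⟨r, hr⟩) : Coord)) ((θ', ⟨r', hr'⟩) : Coord) :=
    { toFun := fun t => (θ + t * (θ' - θ), ⟨r + t * (r' - r), by
        have h0 := t.2.1
        have h1 := t.2.2
        have : 1 ≤ r + (t : ℝ) * (r' - r) := by nlinarith
        exact this⟩)
      continuous_toFun := by fun_prop
      source' := by simp
      target' := by simp }
  refine ne_top_of_le_ne_top ?_ (iInf_le _ γ)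
  set K : ℝ := |r' - r| + (r + |r' - r|) * |θ' - θ| with hK
  have hlip : LipschitzOnWith (Real.toNNReal K) (fun t : unitInterval => cover (γ t)) univ := by
    refine LipschitzOnWith.of_dist_le_mul fun s _ t _ => ?_
    rw [Real.coe_toNNReal K (by positivity), dist_eq_norm]
    refine (cover_dist_le (θ + s * (θ' - θ)) (θ + t * (θ' - θ)) (r + s * (r' - r))
      (r + t * (r' - r))).trans ?_
    have e1 : |r + (s : ℝ) * (r' - r) - (r + t * (r' - r))| = |r' - r| * dist s t := by
      rw [Subtype.dist_eq, Real.dist_eq, ← abs_mul]; congr 1; ring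
    have e2 : |θ + (s : ℝ) * (θ' - θ) - (θ + t * (θ' - θ))| = |θ' - θ| * dist s t := by
      rw [Subtype.dist_eq, Real.dist_eq, ← abs_mul]; congr 1; ring
    have e3 : |r + (t : ℝ) * (r' - r)| ≤ r + |r' - r| := by
      refine (abs_add_le _ _).trans ?_
      rw [abs_of_nonneg (by linarith : (0 : ℝ) ≤ r), abs_mul, abs_of_nonneg t.2.1]
      have := mul_le_mul_of_nonneg_right t.2.2 (abs_nonneg (r' - r))
      linarith
    rw [e1, e2]
    calc |r' - r| * dist s t + |r + (t : ℝ) * (r' - r)| * (|θ' - θ| * dist s t)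
        ≤ |r' - r| * dist s t + (r + |r' - r|) * (|θ' - θ| * dist s t) := by gcongr
      _ = K * dist s t := by rw [hK]; ring
  have hid : eVariationOn (fun t : unitInterval => (t : ℝ)) univ ≠ ⊤ := by
    have hm : MonotoneOn (fun t : unitInterval => (t : ℝ)) univ := fun a _ b _ hab => hab
    have h := (hm.eVariationOn_eq (mem_univ 0) (mem_univ 1)).le
    have hu : (univ : Set unitInterval) ∩ Icc 0 1 = univ := by
      ext t; simp [unitInterval.le_one']
    rw [hu] at h
    exact ne_top_of_le_ne_top ENNReal.ofReal_ne_top h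
  exact hlip.comp_boundedVariationOn (g := id) (mapsTo_univ _ _) hid

theorem eq_of_lengthDist_eq_zero (p q : Coord) (h : lengthDist p q = 0) : p = q := by
  have hnorm : ∀ c : Coord, ‖cover c‖ = c.2 := fun c => by
    have h1 : (1 : ℝ) ≤ c.2 := c.2.2
    rw [cover, norm_mul, Complex.norm_exp_ofReal_mul_I, Complex.norm_real, mul_one,
      Real.norm_eq_abs, abs_of_nonneg (by linarith)]
  have hcover : cover p = cover q := by
    rw [← edist_eq_zero, ← nonpos_iff_eq_zero, ← h]
    refine le_iInf fun γ => ?_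
    have h1 := eVariationOn.edist_le (fun t => cover (γ t)) (mem_univ 0) (mem_univ 1)
    rwa [γ.source, γ.target] at h1
  obtain ⟨γ, hγ⟩ := iInf_lt_iff.1 (show lengthDist p q < 1 by rw [h]; exact one_pos)
  have hr : p.2 = q.2 := by
    have := congrArg norm hcover
    rw [hnorm, hnorm] at this
    exact Subtype.ext this
  have hpr : (1 : ℝ) ≤ p.2 := p.2.2
  have hcos : ∀ t, 0 < Real.cos ((γ t).1 - p.1) := by
    intro t
    by_contra hneg
    rw [not_lt] at hneg
    have hd : dist (cover (γ t)) (cover p) < 1 := by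
      have := (eVariationOn.edist_le (fun t => cover (γ t)) (mem_univ t) (mem_univ 0)).trans_lt hγ
      rw [edist_dist, ENNReal.ofReal_lt_one] at this
      simpa using this
    have hg : (1 : ℝ) ≤ (γ t).2 := (γ t).2.2
    have hsq : ‖cover (γ t) - cover p‖ ^ 2 = ((γ t).2 : ℝ) ^ 2 + (p.2 : ℝ) ^ 2 -
        2 * (γ t).2 * p.2 * Real.cos ((γ t).1 - p.1) := by
      rw [Complex.sq_norm, Complex.normSq_apply]
      simp only [cover, Complex.sub_re, Complex.sub_im, Complex.re_ofReal_mul,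
        Complex.im_ofReal_mul, Complex.exp_ofReal_mul_I_re, Complex.exp_ofReal_mul_I_im]
      rw [Real.cos_sub]
      have e1 := Real.sin_sq_add_cos_sq (γ t).1
      have e2 := Real.sin_sq_add_cos_sq p.1
      linear_combination ((γ t).2 : ℝ) ^ 2 * e1 + (p.2 : ℝ) ^ 2 * e2
    rw [dist_eq_norm] at hd
    have h0 := norm_nonneg (cover (γ t) - cover p)
    have h1 : ((γ t).2 : ℝ) * p.2 * Real.cos ((γ t).1 - p.1) ≤ 0 :=
      mul_nonpos_of_nonneg_of_nonpos (by positivity) hneg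
    nlinarith
  have hlt : ∀ t, |(γ t).1 - p.1| < Real.pi / 2 := by
    intro t
    by_contra hneg
    rw [not_lt] at hneg
    have hc : Continuous fun s : unitInterval => |(γ s).1 - p.1| := by fun_prop
    have hmem : Real.pi / 2 ∈ Icc (|(γ 0).1 - p.1|) (|(γ t).1 - p.1|) :=
      ⟨by simp; positivity, hneg⟩
    obtain ⟨s, hs⟩ := mem_range_of_exists_le_of_exists_ge hc ⟨0, hmem.1⟩ ⟨t, hmem.2⟩
    have := hcos s
    rw [← Real.cos_abs] at this
    simp only at hs
    rw [hs, Real.cos_pi_div_two] at this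
    exact lt_irrefl _ this
  have h1 := hlt 1
  rw [γ.target] at h1
  have hexp : Complex.exp (p.1 * Complex.I) = Complex.exp (q.1 * Complex.I) := by
    have hne : ((p.2 : ℝ) : ℂ) ≠ 0 := by
      exact_mod_cast (by linarith : (p.2 : ℝ) ≠ 0)
    have := hcover
    rw [cover, cover, ← hr] at this
    exact mul_left_cancel₀ hne this
  have hang : q.1 - p.1 = 0 := by
    have hc : Real.cos (q.1 - p.1) = 1 := by
      have hre := congrArg Complex.re hexp
      have him := congrArg Complex.im hexp
      simp only [Complex.exp_ofReal_mul_I_re, Complex.exp_ofReal_mul_I_im] at hre him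
      rw [Real.cos_sub, hre, him]
      have := Real.sin_sq_add_cos_sq q.1
      linarith
    rw [abs_lt] at h1
    exact (Real.cos_eq_one_iff_of_lt_of_lt (by linarith [Real.pi_pos])
      (by linarith [Real.pi_pos])).1 hc
  exact Prod.ext (by linarith) hr

/-- The length metric of the parking lot. -/
instance : MetricSpace ParkingLot where
  dist p q := (lengthDist p.coord q.coord).toReal
  dist_self p := by simp [lengthDist_self]
  dist_comm p q := by
    rw [le_antisymm (lengthDist_comm_le p.coord q.coord) (lengthDist_comm_le q.coord p.coord)]
  dist_triangle p q r := by
    rw [← ENNReal.toReal_add (lengthDist_ne_top _ _) (lengthDist_ne_top _ _)]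
    exact ENNReal.toReal_mono
      (ENNReal.add_ne_top.2 ⟨lengthDist_ne_top _ _, lengthDist_ne_top _ _⟩)
      (lengthDist_triangle _ _ _)
  eq_of_dist_eq_zero {p q} h := by
    have h0 : lengthDist p.coord q.coord = 0 :=
      ((ENNReal.toReal_eq_zero_iff _).1 h).resolve_right (lengthDist_ne_top _ _)
    have h1 := eq_of_lengthDist_eq_zero _ _ h0
    exact ParkingLot.ext (congrArg Prod.fst h1) (congrArg (fun c : Coord => (c.2 : ℝ)) h1)

/-- The spiral `ℝ × {1}`, parametrized by arc length with origin at `(0, 1)`. -/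
def spiral (t : ℝ) : ParkingLot := ⟨t, 1, le_rfl⟩

end ParkingLot

/-! ### Gluing rays to a metric space -/

/-- The space obtained from `X` by gluing, for every `i : ℕ`, a ray `[0, ∞)` to `X` by identifying
its origin with the point `p i`. The points of the rays other than their origins are listed
separately. -/
inductive RayGluing {X : Type*} (p : ℕ → X) where
  | base (x : X) : RayGluing p
  | ray (i : ℕ) (s : ℝ) (hs : 0 < s) : RayGluing p

namespace RayGluing

variable {X : Type*} [MetricSpace X] {p : ℕ → X}

/-- The gluing (path) metric. -/
def gluingDist : RayGluing p → RayGluing p → ℝ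
  | base x, base y => dist x y
  | base x, ray j t _ => dist x (p j) + t
  | ray i s _, base y => s + dist (p i) y
  | ray i s _, ray j t _ => if i = j then |s - t| else s + dist (p i) (p j) + t

instance : MetricSpace (RayGluing p) where
  dist := gluingDist
  dist_self a := by cases a <;> simp [gluingDist]
  dist_comm a b := by
    rcases a with x | ⟨i, s, hs⟩ <;> rcases b with y | ⟨j, t, ht⟩ <;> simp only [gluingDist]
    · exact dist_comm _ _
    · rw [dist_comm, add_comm]
    · rw [dist_comm, add_comm]
    · by_cases h : i = j
      · simp [h, abs_sub_comm]
      · rw [if_neg h, if_neg (Ne.symm h), dist_comm]; ring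
  dist_triangle a b c := by
    rcases a with x | ⟨i, s, hs⟩ <;> rcases b with y | ⟨j, t, ht⟩ <;>
      rcases c with z | ⟨k, u, hu⟩ <;> simp only [gluingDist]
    · exact dist_triangle _ _ _
    · linarith [dist_triangle x y (p k)]
    · linarith [dist_triangle x (p j) z]
    · by_cases h : j = k
      · subst h; rw [if_pos rfl]; linarith [neg_le_abs (t - u)]
      · rw [if_neg h]; linarith [dist_triangle x (p j) (p k)]
    · linarith [dist_triangle (p i) y z]
    · by_cases h : i = k
      · subst h; rw [if_pos rfl, abs_le]
        have := dist_nonneg (x := p i) (y := y)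
        have := dist_nonneg (x := y) (y := p i)
        constructor <;> linarith
      · rw [if_neg h]; linarith [dist_triangle (p i) y (p k)]
    · by_cases h : i = j
      · subst h; rw [if_pos rfl]; linarith [le_abs_self (s - t)]
      · rw [if_neg h]; linarith [dist_triangle (p i) (p j) z]
    · by_cases hij : i = j
      · subst hij
        by_cases hik : i = k
        · subst hik; simp only [if_true]; exact abs_sub_le _ _ _
        · simp only [if_true, if_neg hik]; linarith [le_abs_self (s - t)]
      · by_cases hjk : j = k
        · subst hjk; simp only [if_true, if_neg hij]; linarith [neg_le_abs (t - u)]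
        · by_cases hik : i = k
          · subst hik
            simp only [if_true, if_neg hij, if_neg hjk]
            have := dist_nonneg (x := p i) (y := p j)
            have := dist_nonneg (x := p j) (y := p i)
            rw [abs_le]; constructor <;> linarith
          · simp only [if_neg hij, if_neg hjk, if_neg hik]
            linarith [dist_triangle (p i) (p j) (p k)]
  eq_of_dist_eq_zero {a b} h := by
    rcases a with x | ⟨i, s, hs⟩ <;> rcases b with y | ⟨j, t, ht⟩ <;>
      simp only [gluingDist] at h
    · rw [eq_of_dist_eq_zero h]
    · linarith [dist_nonneg (x := x) (y := p j)]
    · linarith [dist_nonneg (x := p i) (y := y)]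
    · by_cases hij : i = j
      · subst hij
        rw [if_pos rfl, abs_eq_zero, sub_eq_zero] at h
        subst h; rfl
      · rw [if_neg hij] at h
        linarith [dist_nonneg (x := p i) (y := p j)]

/-- The `i`-th glued ray `[0, ∞) → RayGluing p`, starting at `p i` (constant for negative
parameters). -/
def gluedRay (p : ℕ → X) (i : ℕ) (s : ℝ) : RayGluing p :=
  if hs : 0 < s then ray i s hs else base (p i)

end RayGluing

/-! ### The spaces `W` and `Z` -/

/-- The point with polar coordinates `(i, 2^i)`. -/
def pointW (i : ℕ) : ParkingLot := ⟨i, 2 ^ i, one_le_pow₀ one_le_two⟩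

/-- The point with polar coordinates `(0, 2^i)`. -/
def pointZ (i : ℕ) : ParkingLot := ⟨0, 2 ^ i, one_le_pow₀ one_le_two⟩

/-- The parking lot with a ray `γ_i` glued at each of the points `(i, 2^i)`. -/
abbrev SpaceW : Type := RayGluing pointW

/-- The parking lot with a ray glued at each of the points `(0, 2^i)`. -/
abbrev SpaceZ : Type := RayGluing pointZ

/-- The positive direction `α⁺` of the spiral, as a ray in `W`. -/
def alphaPlus (t : ℝ) : SpaceW := RayGluing.base (ParkingLot.spiral t)

end

noncomputable section

/-! ### The inequality of Bruhat and Tits -/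

/-! The two spaces differ only in where their rays are attached, and the curtain model forgets
everything except these positions along the spiral.

CAT(0) geometry. The CAT(0) condition is used in the weighted form of Bruhat and Tits,
`HasCNPoints`. In the parking lot there is an explicit logarithm map at every point m: its norm is
the distance to m, and it is 1-Lipschitz because it does not increase the length of paths
(`edist_logMap_le_pathLength`). If the logarithms of x and y at m balance, expanding squares gives
the inequality at m (`cn_of_logMap`). Gluing rays preserves it (`RayGluing.hasCNPoints`). The
logarithmic shear (θ, r) ↦ (θ - log r / log 2, r) is bi-Lipschitz and carries (i, 2^i) to (0, 2^i),
which gives the quasi-isometry.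

Curtain models. Under the CAT(0) condition, d_L is additive along geodesics up to an error linear in
L (`curtainDistL_add_le`): L-chains on two consecutive pieces of a geodesic form one L-chain once a
number of members linear in L is removed at the junction. Since ∑ L² λ_L converges, the weighted sum
of these errors is finite. A radial segment is a side of a flat strip, which many parallel curtains
cross like the rungs of a ladder, so L-chains along it have length at most 4L + 7
(`curtainDistL_radial_le`); in the model the whole parking lot therefore lies within bounded
distance of the spiral. The spiral itself stays unbounded: geodesics between points of sufficiently
different angles run along it, so curtains dual to it at distance 10 are 9-separated
(`lSeparated_axis`). The glued rays stay unbounded because curtains dual to them at distance 2 are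
1-separated (`lSeparated_gluedRay`). Hence the model metric is, up to a bounded error, that of a
line with a ray attached at the position of the angle of each gluing point (`RayGluing.treeLike`).

Boundaries. Gromov hyperbolicity and convergence at infinity can now be read off from the products
in this tree. For W, the product of the ends of γ_i and α⁺ is the attaching position of γ_i up to a
constant, which tends to infinity with i. For Z all rays are attached at one position, so the tree
is a star and its boundary is discrete (`TreeLike.isOpen_singleton`). A homeomorphism would
transport the nontrivial convergent sequence from one boundary to the other. -/

/-- Every division ratio of the pair `x, y` is realized by a point that satisfies the inequality
of Bruhat and Tits (with weights). -/
def HasCNPointsBetween {X : Type*} [MetricSpace X] (x y : X) : Prop :=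
  ∀ s ∈ Icc (0 : ℝ) 1, ∃ m : X, ∀ p : X,
    dist p m ^ 2 ≤ (1 - s) * dist p x ^ 2 + s * dist p y ^ 2 - s * (1 - s) * dist x y ^ 2

/-- The inequality of Bruhat and Tits, a reformulation of the CAT(0) condition. -/
def HasCNPoints (X : Type*) [MetricSpace X] : Prop :=
  ∀ x y : X, HasCNPointsBetween x y

section CN

variable {X : Type*} [MetricSpace X]

theorem LiesBetween.symm {x m y : X} (h : LiesBetween x m y) : LiesBetween y m x := by
  unfold LiesBetween at *
  rw [dist_comm y m, dist_comm m x, dist_comm y x]; linarith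

theorem LiesBetween.left (x y : X) : LiesBetween x x y := by simp [LiesBetween]

theorem LiesBetween.right (x y : X) : LiesBetween x y y := by simp [LiesBetween]

theorem HasCNPointsBetween.symm {x y : X} (h : HasCNPointsBetween x y) :
    HasCNPointsBetween y x := by
  intro s hs
  obtain ⟨m, hm⟩ := h (1 - s) ⟨by linarith [hs.2], by linarith [hs.1]⟩
  refine ⟨m, fun p => (hm p).trans (le_of_eq ?_)⟩
  rw [dist_comm y x]; ring

/-- Testing the inequality at x and at y bounds the two distances above by the right proportions of
`dist x y`; the triangle inequality forces equality in both. -/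
theorem dist_eq_of_forall_cn {x y m : X} {s : ℝ} (hs : s ∈ Icc (0 : ℝ) 1)
    (h : ∀ p : X, dist p m ^ 2 ≤
      (1 - s) * dist p x ^ 2 + s * dist p y ^ 2 - s * (1 - s) * dist x y ^ 2) :
    dist x m = s * dist x y ∧ dist m y = (1 - s) * dist x y := by
  have hx : dist x m ≤ s * dist x y := by
    apply (sq_le_sq₀ dist_nonneg (mul_nonneg hs.1 dist_nonneg)).1
    have := h x
    rw [dist_self] at this
    nlinarith
  have hy : dist m y ≤ (1 - s) * dist x y := by
    apply (sq_le_sq₀ dist_nonneg (mul_nonneg (by linarith [hs.2]) dist_nonneg)).1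
    have := h y
    rw [dist_self, dist_comm y x, dist_comm y m] at this
    nlinarith
  have := dist_triangle x m y
  constructor <;> linarith

namespace HasCNPoints

variable (hX : HasCNPoints X)
include hX

/-- The inequality form of Stewart's theorem. -/
theorem stewart {x m y : X} (h : LiesBetween x m y) (p : X) :
    dist x y * dist p m ^ 2 ≤ dist m y * dist p x ^ 2 + dist x m * dist p y ^ 2 -
      dist x m * dist m y * dist x y := by
  unfold LiesBetween at h
  have h1 := dist_nonneg (x := x) (y := m)
  have h2 := dist_nonneg (x := m) (y := y)
  rcases (dist_nonneg (x := x) (y := y)).eq_or_lt with h0 | h0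
  · have e1 : dist x m = 0 := by linarith
    have e2 : dist m y = 0 := by linarith
    rw [← h0, e1, e2]; simp
  · set d := dist x y with hd
    have hs : dist x m / d ∈ Icc (0 : ℝ) 1 :=
      ⟨by positivity, by rw [div_le_one h0]; linarith⟩
    obtain ⟨m', hm'⟩ := hX x y (dist x m / d) hs
    -- The point m is itself a test point for m'. As m divides the pair in the same ratio, the
    -- right-hand side vanishes there, so m = m' and m inherits the inequality.
    have hmm : m = m' := by
      have := hm' m
      rw [dist_comm m x, ← hd] at this
      have e : (1 - dist x m / d) * dist x m ^ 2 + dist x m / d * dist m y ^ 2 -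
          dist x m / d * (1 - dist x m / d) * d ^ 2 = 0 := by
        have : dist m y = d - dist x m := by linarith
        rw [this]; field_simp; ring
      rw [e] at this
      exact dist_eq_zero.1 (by nlinarith [dist_nonneg (x := m) (y := m')])
    subst hmm
    have := mul_le_mul_of_nonneg_left (hm' p) h0.le
    refine this.trans (le_of_eq ?_)
    have e : dist m y = d - dist x m := by linarith
    rw [e, ← hd]; field_simp

/-- Uniqueness of geodesics: Stewart's inequality for m, tested at m', has right-hand side zero. -/
theorem eq_of_liesBetween {x y m m' : X} (h : LiesBetween x m y) (h' : LiesBetween x m' y)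
    (he : dist x m = dist x m') : m = m' := by
  have h3 := hX.stewart h m'
  unfold LiesBetween at h h'
  rcases (dist_nonneg (x := x) (y := y)).eq_or_lt with h0 | h0
  · have h1 := dist_nonneg (x := x) (y := m)
    have h2 := dist_nonneg (x := m) (y := y)
    have e1 : dist x m = 0 := by linarith
    have e2 : dist x m' = 0 := by linarith
    rw [← dist_eq_zero.1 e1, ← dist_eq_zero.1 e2]
  · have e : dist m y * dist m' x ^ 2 + dist x m * dist m' y ^ 2 -
      dist x m * dist m y * dist x y = 0 := by
      have e1 : dist m' y = dist m y := by linarith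
      rw [e1, dist_comm m' x, ← he, ← h]; ring
    rw [e] at h3
    have := nonpos_of_mul_nonpos_right h3 h0
    exact (dist_eq_zero.1 (by nlinarith [dist_nonneg (x := m') (y := m)])).symm

theorem exists_liesBetween (x y : X) {t : ℝ} (ht : t ∈ Icc 0 (dist x y)) :
    ∃ m, dist x m = t ∧ dist m y = dist x y - t := by
  rcases (dist_nonneg (x := x) (y := y)).eq_or_lt with h0 | h0
  · rw [← h0] at ht
    refine ⟨x, by rw [dist_self]; linarith [ht.1, ht.2], by linarith [ht.1, ht.2]⟩
  · have hs : t / dist x y ∈ Icc (0 : ℝ) 1 := ⟨div_nonneg ht.1 h0.le, by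
      rw [div_le_one h0]; exact ht.2⟩
    obtain ⟨m, hm⟩ := hX x y _ hs
    obtain ⟨h1, h2⟩ := dist_eq_of_forall_cn hs hm
    refine ⟨m, by rw [h1]; field_simp, by rw [h2]; field_simp⟩

theorem isGeodesicSpace : IsGeodesicSpace X := by
  intro x y
  have key : ∀ t : ℝ, ∃ m : X, t ∈ Icc 0 (dist x y) → dist x m = t ∧ dist m y = dist x y - t := by
    intro t
    by_cases ht : t ∈ Icc 0 (dist x y)
    · obtain ⟨m, hm⟩ := hX.exists_liesBetween x y ht
      exact ⟨m, fun _ => hm⟩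
    · exact ⟨x, fun h => absurd h ht⟩
  choose γ hγ using key
  have hmono : ∀ s ∈ Icc 0 (dist x y), ∀ t ∈ Icc 0 (dist x y), s ≤ t →
      dist (γ s) (γ t) = t - s := by
    intro s hs t ht hst
    obtain ⟨h1, h2⟩ := hγ s hs
    obtain ⟨h3, h4⟩ := hγ t ht
    -- The independent choices of the γ t fit together by uniqueness: the point at distance t - s
    -- from γ s towards y also lies between x and y, at distance t from x.
    obtain ⟨m, h5, h6⟩ := hX.exists_liesBetween (γ s) y (t := t - s)
      ⟨by linarith, by rw [h2]; linarith [ht.2]⟩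
    have h7 := dist_triangle x (γ s) m
    have h8 := dist_triangle x m y
    have : m = γ t := by
      refine hX.eq_of_liesBetween (x := x) (y := y) ?_ ?_ ?_
      · unfold LiesBetween; linarith
      · unfold LiesBetween; linarith
      · linarith
    rw [← this, h5]
  have h0 : (0 : ℝ) ∈ Icc 0 (dist x y) := ⟨le_rfl, dist_nonneg⟩
  have h1 : dist x y ∈ Icc 0 (dist x y) := ⟨dist_nonneg, le_rfl⟩
  refine ⟨γ, (dist_eq_zero.1 (hγ 0 h0).1).symm, ?_, ?_⟩
  · exact dist_eq_zero.1 (by rw [(hγ _ h1).2, sub_self])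
  · intro s hs t ht
    rcases le_total s t with h | h
    · rw [hmono s hs t ht h, abs_sub_comm, abs_of_nonneg (by linarith)]
    · rw [dist_comm, hmono t ht s hs h, abs_of_nonneg (by linarith)]

end HasCNPoints

theorem stewart_euclidean {E : Type*} [NormedAddCommGroup E] [InnerProductSpace ℝ E]
    {x m y : E} (h : dist x m + dist m y = dist x y) (p : E) :
    dist x y * dist p m ^ 2 = dist m y * dist p x ^ 2 + dist x m * dist p y ^ 2 -
      dist x m * dist m y * dist x y := by
  obtain ⟨s, ⟨hs0, hs1⟩, rfl⟩ := dist_add_dist_eq_iff.1 h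
  have h1 : dist x (AffineMap.lineMap x y s) = s * dist x y := by
    rw [dist_left_lineMap, Real.norm_of_nonneg hs0]
  have h2 : dist (AffineMap.lineMap x y s) y = (1 - s) * dist x y := by
    rw [dist_lineMap_right, Real.norm_of_nonneg (by linarith)]
  have h3 : dist p (AffineMap.lineMap x y s) ^ 2 =
      (1 - s) * dist p x ^ 2 + s * dist p y ^ 2 - s * (1 - s) * dist x y ^ 2 := by
    have e : p - AffineMap.lineMap x y s = (1 - s) • (p - x) + s • (p - y) := by
      rw [AffineMap.lineMap_apply_module]; module
    have e' : x - y = (p - y) - (p - x) := by abel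
    rw [dist_eq_norm, dist_eq_norm, dist_eq_norm, dist_eq_norm, e, e', norm_sub_sq_real (p - y),
      norm_add_sq_real, norm_smul, norm_smul, inner_smul_left, inner_smul_right,
      Real.norm_of_nonneg hs0, Real.norm_of_nonneg (by linarith : 0 ≤ 1 - s),
      real_inner_comm (p - x) (p - y)]
    simp only [conj_trivial]
    ring
  rw [h1, h2, h3]; ring

/-- Stewart's inequality in the space is compared twice with Stewart's equality in the plane: first
for q on the side from x to z, seen from y, then for p on the side from x to y, seen from q. The
second comparison uses the bound on the distance from y to q obtained in the first. Sides of length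
zero are treated apart, as Stewart's formula is empty for them. -/
theorem HasCNPoints.isCAT0 (hX : HasCNPoints X) : IsCAT0 X := by
  refine ⟨hX.isGeodesicSpace, ?_⟩
  intro x y z p q x' y' z' p' q' hxy hyz hxz hp hq hxp hpy hxq hqz
  have hp' : dist x' p' + dist p' y' = dist x' y' := by rw [hxp, hpy, hxy]; exact hp
  have hq' : dist x' q' + dist q' z' = dist x' z' := by rw [hxq, hqz, hxz]; exact hq
  have hyq : dist y q ≤ dist y' q' := by
    have h1 := hX.stewart hq y
    have h2 := stewart_euclidean hq' y'
    rcases (dist_nonneg (x := x) (y := z)).eq_or_lt with h0 | h0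
    · have e1 : dist x q = 0 := by
        linarith [dist_nonneg (x := x) (y := q), dist_nonneg (x := q) (y := z),
          show dist x q + dist q z = dist x z from hq]
      have e2 : x = q := dist_eq_zero.1 e1
      have e3 : x' = q' := dist_eq_zero.1 (by rw [hxq, e1])
      rw [← e2, ← e3, dist_comm y, dist_comm y', hxy]
    · rw [hxz, hxq, hqz, dist_comm y' x', hxy, hyz, dist_comm x y] at h2
      have h3 : dist x z * dist y q ^ 2 ≤ dist x z * dist y' q' ^ 2 := h1.trans h2.ge
      exact (sq_le_sq₀ dist_nonneg dist_nonneg).1 (le_of_mul_le_mul_left h3 h0)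
  have h1 := hX.stewart hp q
  have h2 := stewart_euclidean hp' q'
  rcases (dist_nonneg (x := x) (y := y)).eq_or_lt with h0 | h0
  · have e1 : dist x p = 0 := by
      linarith [dist_nonneg (x := x) (y := p), dist_nonneg (x := p) (y := y),
        show dist x p + dist p y = dist x y from hp]
    have e2 : x = p := dist_eq_zero.1 e1
    have e3 : x' = p' := dist_eq_zero.1 (by rw [hxp, e1])
    rw [← e2, ← e3, hxq]
  · rw [hxy, hxp, hpy, dist_comm q' x', hxq, dist_comm x q] at h2
    rw [dist_comm p q, dist_comm p' q']
    have h3 : dist x y * dist q p ^ 2 ≤ dist x y * dist q' p' ^ 2 := by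
      rw [h2]
      refine h1.trans ?_
      have : dist q y ^ 2 ≤ dist q' y' ^ 2 := by
        rw [dist_comm q y, dist_comm q' y']
        exact pow_le_pow_left₀ dist_nonneg hyq 2
      have := mul_le_mul_of_nonneg_left this (dist_nonneg (x := x) (y := p))
      linarith
    exact (sq_le_sq₀ dist_nonneg dist_nonneg).1 (le_of_mul_le_mul_left h3 h0)

end CN

/-! ### Gluing rays -/

namespace RayGluing

variable {X : Type*} {p : ℕ → X}

/-- The point `y` is not an interior point of the `i`-th glued ray. -/
def OffRay (i : ℕ) (y : RayGluing p) : Prop := ∀ s hs, y ≠ ray i s hs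

theorem offRay_or_eq_ray (i : ℕ) (y : RayGluing p) : OffRay i y ∨ ∃ s hs, y = ray i s hs := by
  by_cases h : ∃ s hs, y = ray i s hs
  · exact Or.inr h
  · push Not at h; exact Or.inl h

theorem offRay_base (i : ℕ) (x : X) : OffRay i (base x : RayGluing p) := by
  intro s hs h; cases h

theorem offRay_ray {i j : ℕ} (hij : i ≠ j) (s : ℝ) (hs : 0 < s) :
    OffRay i (ray j s hs : RayGluing p) := by
  intro t ht h; cases h; exact hij rfl

theorem gluedRay_zero (i : ℕ) : gluedRay p i 0 = base (p i) := by simp [gluedRay]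

theorem gluedRay_of_pos (i : ℕ) {s : ℝ} (hs : 0 < s) : gluedRay p i s = ray i s hs := by
  simp [gluedRay, hs]

variable [MetricSpace X]

theorem dist_base_base (x y : X) : dist (base x : RayGluing p) (base y) = dist x y := rfl

theorem dist_base_ray (x : X) (i : ℕ) (s : ℝ) (hs : 0 < s) :
    dist (base x : RayGluing p) (ray i s hs) = dist x (p i) + s := rfl

theorem dist_ray_ray_self (i : ℕ) (s t : ℝ) (hs : 0 < s) (ht : 0 < t) :
    dist (ray i s hs : RayGluing p) (ray i t ht) = |s - t| := by
  change gluingDist _ _ = _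
  simp [gluingDist]

theorem OffRay.dist_ray {i : ℕ} {y : RayGluing p} (hy : OffRay i y) (s : ℝ) (hs : 0 < s) :
    dist (ray i s hs) y = s + dist (base (p i)) y := by
  rcases y with y | ⟨j, t, ht⟩
  · rfl
  · have hij : i ≠ j := fun h => by subst h; exact hy t ht rfl
    change gluingDist _ _ = s + gluingDist _ _
    simp [gluingDist, hij]; ring

theorem dist_gluedRay_gluedRay (i : ℕ) {s t : ℝ} (hs : 0 ≤ s) (ht : 0 ≤ t) :
    dist (gluedRay p i s) (gluedRay p i t) = |s - t| := by
  unfold gluedRay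
  split_ifs with h1 h2 h2
  · exact dist_ray_ray_self _ _ _ _ _
  · rw [(offRay_base i _).dist_ray, dist_self, abs_of_nonneg] <;> linarith
  · rw [dist_comm, (offRay_base i _).dist_ray, dist_self, abs_sub_comm, abs_of_nonneg] <;> linarith
  · rw [dist_self, show s - t = 0 by linarith, abs_zero]

theorem OffRay.dist_gluedRay {i : ℕ} {y : RayGluing p} (hy : OffRay i y) {s : ℝ} (hs : 0 ≤ s) :
    dist (gluedRay p i s) y = s + dist (base (p i)) y := by
  rcases hs.eq_or_lt with h | h
  · rw [← h, gluedRay_zero, zero_add]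
  · rw [gluedRay_of_pos i h, hy.dist_ray]

/-- A geodesic from x to y runs through a cut point o, with a and b the lengths of its two parts,
and m is on the part from o to y at distance c from o. The test point is on the side of y, so its
distance to x is measured through o; the inequality for o, m, y then implies that for x, m, y. -/
theorem cn_concat_near {a b c Po Px Py Pm : ℝ} (ha : 0 ≤ a) (hb : 0 < b) (hcb : c ≤ b)
    (hx : Px = a + Po) (hy : |Po - b| ≤ Py)
    (hm : b * Pm ^ 2 ≤ (b - c) * Po ^ 2 + c * Py ^ 2 - c * (b - c) * b) :
    (a + b) * Pm ^ 2 ≤ (b - c) * Px ^ 2 + (a + c) * Py ^ 2 - (a + c) * (b - c) * (a + b) := by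
  subst hx
  have h1 : (Po - b) ^ 2 ≤ Py ^ 2 := by
    rw [← sq_abs (Po - b)]; exact pow_le_pow_left₀ (abs_nonneg _) hy 2
  have h2 := mul_le_mul_of_nonneg_left hm (by linarith : 0 ≤ a + b)
  have h3 : 0 ≤ a * (b - c) * (Py ^ 2 - (Po - b) ^ 2) :=
    mul_nonneg (mul_nonneg ha (by linarith)) (by linarith)
  refine le_of_mul_le_mul_left (a := b) ?_ hb
  nlinarith

/-- The configuration of `cn_concat_near` with the test point on the side of x: its distances to m
and y are now measured through o, and no inequality for o, m, y is needed. -/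
theorem cn_concat_far {a b c Po Px Py Pm : ℝ} (hcb : c ≤ b)
    (hx : |Po - a| ≤ Px) (hy : Py = Po + b) (hm : Pm = Po + c) :
    (a + b) * Pm ^ 2 ≤ (b - c) * Px ^ 2 + (a + c) * Py ^ 2 - (a + c) * (b - c) * (a + b) := by
  subst hy hm
  have h1 : (Po - a) ^ 2 ≤ Px ^ 2 := by
    rw [← sq_abs (Po - a)]; exact pow_le_pow_left₀ (abs_nonneg _) hx 2
  have h3 := mul_le_mul_of_nonneg_left h1 (by linarith : 0 ≤ b - c)
  nlinarith

theorem abs_dist_sub_le' {Y : Type*} [MetricSpace Y] (x y z : Y) :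
    |dist x y - dist y z| ≤ dist x z := by
  rw [dist_comm y z]; exact abs_dist_sub_le x z y

theorem cn_of_mul {ℓ s Pm Px Py : ℝ} (hℓ : 0 < ℓ)
    (h : ℓ * Pm ^ 2 ≤ (ℓ - s * ℓ) * Px ^ 2 + s * ℓ * Py ^ 2 - s * ℓ * (ℓ - s * ℓ) * ℓ) :
    Pm ^ 2 ≤ (1 - s) * Px ^ 2 + s * Py ^ 2 - s * (1 - s) * ℓ ^ 2 := by
  refine le_of_mul_le_mul_left (a := ℓ) (h.trans (le_of_eq ?_)) hℓ
  ring

/-- The origin of the ray is a cut point, so the geodesic to y is the concatenation of a piece of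
the ray and a geodesic from the origin, and the test point is on one side or the other. -/
theorem hasCNPointsBetween_ray {i : ℕ} {a : ℝ} (ha : 0 < a) {y : RayGluing p} (hy : OffRay i y)
    (h : HasCNPointsBetween (base (p i) : RayGluing p) y) : HasCNPointsBetween (ray i a ha) y := by
  intro s hs
  set o : RayGluing p := base (p i)
  set b := dist o y with hb
  have hb0 : 0 ≤ b := dist_nonneg
  have hℓ : dist (ray i a ha) y = a + b := hy.dist_ray a ha
  have hsℓ : s * (a + b) ≤ a + b := by nlinarith [hs.2]
  have hsℓ0 : 0 ≤ s * (a + b) := by nlinarith [hs.1]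
  rw [hℓ]
  rcases le_or_gt (s * (a + b)) a with hc | hc
  -- Here m is on the ray, at distance c from the origin; the concatenation lemmas are read from y
  -- towards the ray, so that a and b change roles.
  · set c := a - s * (a + b) with hcdef
    have hc0 : 0 ≤ c := by linarith
    refine ⟨gluedRay p i c, fun q => cn_of_mul (by linarith) ?_⟩
    have e1 : a + b - s * (a + b) = b + c := by linarith
    have e2 : s * (a + b) = a - c := by linarith
    rw [e1, e2]
    rcases offRay_or_eq_ray i q with hq | ⟨t, ht, rfl⟩
    · have h1 := cn_concat_far (a := b) (b := a) (c := c) (Po := dist o q) (Px := dist q y)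
        (Py := dist q (ray i a ha)) (Pm := dist q (gluedRay p i c)) (by linarith)
        (by rw [hb, dist_comm o q, dist_comm o y, dist_comm y o]
            exact abs_dist_sub_le' q o y)
        (by rw [dist_comm, hq.dist_ray]; ring)
        (by rw [dist_comm, hq.dist_gluedRay hc0]; ring)
      linarith
    · have ha' : ray i a ha = gluedRay p i a := (gluedRay_of_pos i ha).symm
      have ht' : ray i t ht = gluedRay p i t := (gluedRay_of_pos i ht).symm
      have h1 := cn_concat_near (a := b) (b := a) (c := c) (Po := t) (Px := dist (ray i t ht) y)
        (Py := dist (ray i t ht : RayGluing p) (ray i a ha)) (Pm := dist (ray i t ht) (gluedRay p i c)) hb0 ha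
        (by linarith) (by rw [hy.dist_ray]; ring)
        (by rw [dist_ray_ray_self])
        (by rw [ht', ha', dist_gluedRay_gluedRay i ht.le hc0, dist_gluedRay_gluedRay i ht.le ha.le,
              sq_abs, sq_abs]
            apply le_of_eq; ring)
      linarith
  · set c := s * (a + b) - a with hcdef
    have hb' : 0 < b := by linarith
    have hτ : c / b ∈ Icc (0 : ℝ) 1 := ⟨div_nonneg (by linarith) hb0, by
      rw [div_le_one hb']; linarith⟩
    obtain ⟨m, hm⟩ := h (c / b) hτ
    obtain ⟨h1, h2⟩ := dist_eq_of_forall_cn hτ hm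
    rw [← hb] at h1 h2
    have e0 : dist o m = c := by rw [h1]; field_simp
    refine ⟨m, fun q => cn_of_mul (by linarith) ?_⟩
    have e1 : a + b - s * (a + b) = b - c := by linarith
    have e2 : s * (a + b) = a + c := by linarith
    rw [e1, e2]
    -- An interior point of the ray would be farther from y than the origin of the ray is.
    have hmo : OffRay i m := by
      rintro t ht rfl
      rw [hy.dist_ray, ← hb] at h2
      have : (1 - c / b) * b ≤ b := by nlinarith [hτ.1]
      linarith
    rcases offRay_or_eq_ray i q with hq | ⟨t, ht, rfl⟩
    · refine cn_concat_near (Po := dist q o) ha.le hb' (by linarith) ?_ ?_ ?_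
      · rw [dist_comm q, hq.dist_ray, dist_comm o q]
      · exact abs_dist_sub_le' q o y
      · have := mul_le_mul_of_nonneg_left (hm q) hb0
        refine this.trans (le_of_eq ?_)
        rw [← hb]; field_simp
    · refine cn_concat_far (Po := t) (by linarith) ?_ ?_ ?_
      · rw [dist_ray_ray_self]
      · rw [hy.dist_ray]
      · rw [hmo.dist_ray, e0]

theorem hasCNPoints (hX : HasCNPoints X) : HasCNPoints (RayGluing p) := by
  have hbb : ∀ x y : X, HasCNPointsBetween (base x : RayGluing p) (base y) := by
    intro x y s hs
    obtain ⟨m, hm⟩ := hX x y s hs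
    refine ⟨base m, fun q => ?_⟩
    rcases q with q | ⟨i, t, ht⟩
    · exact hm q
    · rw [(offRay_base i _).dist_ray, (offRay_base i _).dist_ray, (offRay_base i _).dist_ray]
      simp only [dist_base_base]
      have h1 := hm (p i)
      have h2 := abs_dist_sub_le' x (p i) y
      set A := dist (p i) x with hA
      set B := dist (p i) y
      set d := dist x y
      have h3 : (A - B) ^ 2 ≤ d ^ 2 := by
        rw [← sq_abs (A - B)]
        rw [dist_comm x] at h2
        exact pow_le_pow_left₀ (abs_nonneg _) h2 2
      have h4 : 0 ≤ s * (1 - s) := mul_nonneg hs.1 (by linarith [hs.2])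
      -- Seen from height t on a ray all distances grow by t. Squaring produces the cross term 2 t ·
      -- `dist (p i) m`, which is controlled by the convexity of the distance to `p i`.
      have h5 : dist (p i) m ≤ (1 - s) * A + s * B := by
        apply (sq_le_sq₀ dist_nonneg (add_nonneg (mul_nonneg (by linarith [hs.2]) dist_nonneg)
          (mul_nonneg hs.1 dist_nonneg))).1
        nlinarith
      nlinarith
  have hrb : ∀ i a ha (y : X), HasCNPointsBetween (ray i a ha : RayGluing p) (base y) :=
    fun i a ha y => hasCNPointsBetween_ray ha (offRay_base i y) (hbb _ _)
  intro x y
  rcases x with x | ⟨i, a, ha⟩ <;> rcases y with y | ⟨j, b, hb⟩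
  · exact hbb x y
  · exact (hrb j b hb x).symm
  · exact hrb i a ha y
  · by_cases hij : i = j
    · subst hij
      intro s hs
      have hc : 0 ≤ (1 - s) * a + s * b :=
        add_nonneg (mul_nonneg (by linarith [hs.2]) ha.le) (mul_nonneg hs.1 hb.le)
      refine ⟨gluedRay p i ((1 - s) * a + s * b), fun q => ?_⟩
      rcases offRay_or_eq_ray i q with hq | ⟨t, ht, rfl⟩
      · rw [dist_comm q, dist_comm q, dist_comm q, hq.dist_gluedRay hc, hq.dist_ray, hq.dist_ray,
          dist_ray_ray_self, sq_abs]
        apply le_of_eq; ring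
      · rw [← gluedRay_of_pos i ht, ← gluedRay_of_pos i ha, ← gluedRay_of_pos i hb,
          dist_gluedRay_gluedRay i ht.le hc, dist_gluedRay_gluedRay i ht.le ha.le,
          dist_gluedRay_gluedRay i ht.le hb.le, dist_gluedRay_gluedRay i ha.le hb.le]
        simp only [sq_abs]
        apply le_of_eq; ring
    · exact hasCNPointsBetween_ray ha (offRay_ray hij b hb) (hrb j b hb _).symm

end RayGluing

namespace ParkingLot

/-! ### Tangents to the unit circle -/

/-- The point of the plane with polar coordinates `(θ, r)`. -/
def polar (θ r : ℝ) : ℂ := r * Complex.exp (θ * Complex.I)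

/-- The length of the tangents from a point at distance `r` from the origin to the unit circle. -/
def tanLen (r : ℝ) : ℝ := √(r ^ 2 - 1)

/-- The angle, seen from the origin, between a point at distance `r` and the points where the
tangents from it touch the unit circle. -/
def tanAng (r : ℝ) : ℝ := Real.arccos r⁻¹

theorem tanLen_nonneg (r : ℝ) : 0 ≤ tanLen r := Real.sqrt_nonneg _

theorem tanAng_nonneg (r : ℝ) : 0 ≤ tanAng r := Real.arccos_nonneg _

theorem tanAng_lt {r : ℝ} (hr : 1 ≤ r) : tanAng r < Real.pi / 2 :=
  Real.arccos_lt_pi_div_two.2 (by positivity)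

theorem tanLen_one : tanLen 1 = 0 := by simp [tanLen]

theorem tanAng_one : tanAng 1 = 0 := by simp [tanAng]

theorem mul_cos_tanAng {r : ℝ} (hr : 1 ≤ r) : r * Real.cos (tanAng r) = 1 := by
  have h0 : 0 < r⁻¹ := by positivity
  rw [tanAng, Real.cos_arccos (by linarith) (inv_le_one_of_one_le₀ hr)]
  field_simp

theorem mul_sin_tanAng {r : ℝ} (hr : 1 ≤ r) : r * Real.sin (tanAng r) = tanLen r := by
  rw [tanAng, Real.sin_arccos, tanLen]
  have h1 : r ^ 2 - 1 = r ^ 2 * (1 - r⁻¹ ^ 2) := by field_simp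
  rw [h1, Real.sqrt_mul (sq_nonneg r), Real.sqrt_sq (by linarith)]

theorem tanAng_eq_of_cos {r x : ℝ} (hx0 : 0 ≤ x) (hx : x ≤ Real.pi) (h : r * Real.cos x = 1) :
    tanAng r = x := by
  have hr : r ≠ 0 := by rintro rfl; simp at h
  rw [tanAng, show r⁻¹ = Real.cos x by field_simp; linarith, Real.arccos_cos hx0 hx]

theorem le_tanAng {r x : ℝ} (hr : 1 ≤ r) (hx : |x| ≤ Real.pi) (h : 1 ≤ r * Real.cos x) :
    |x| ≤ tanAng r := by
  rw [← Real.arccos_cos (abs_nonneg x) hx, tanAng, Real.cos_abs]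
  apply Real.arccos_le_arccos
  rw [inv_le_iff_one_le_mul₀ (by linarith)]
  linarith

theorem continuous_tanAng_comp {Y : Type*} [TopologicalSpace Y] {f : Y → ℝ} (hf : Continuous f)
    (h1 : ∀ y, 1 ≤ f y) : Continuous fun y => tanAng (f y) :=
  Real.continuous_arccos.comp (hf.inv₀ fun y => by linarith [h1 y])

/-- The function r sin x - x is critical where r cos x = 1, that is at x = `tanAng r`, and the
right-hand side is its value there. The sine is concave on [0, π] and so lies below its tangent line
at that point. -/
theorem mul_sin_sub_le {r x : ℝ} (hr : 1 ≤ r) (hx0 : 0 ≤ x) (hx : x ≤ Real.pi) :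
    r * Real.sin x - x ≤ tanLen r - tanAng r := by
  have hc := mul_cos_tanAng hr
  have hs := mul_sin_tanAng hr
  have ha0 := tanAng_nonneg r
  have ha := tanAng_lt hr
  set a := tanAng r
  have hsa : 0 ≤ Real.sin a := Real.sin_nonneg_of_nonneg_of_le_pi ha0 (by linarith)
  have hca : 0 < Real.cos a := Real.cos_pos_of_mem_Ioo ⟨by linarith, ha⟩
  have key : Real.sin x ≤ Real.sin a + Real.cos a * (x - a) := by
    rcases le_total a x with h | h
    · have e : Real.sin x = Real.sin a * Real.cos (x - a) + Real.cos a * Real.sin (x - a) := by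
        rw [← Real.sin_add]; congr 1; ring
      rw [e]
      have h1 := mul_le_mul_of_nonneg_left (Real.cos_le_one (x - a)) hsa
      have h2 := mul_le_mul_of_nonneg_left (Real.sin_le (by linarith : 0 ≤ x - a)) hca.le
      linarith
    · set y := a - x with hy
      have e : Real.sin x = Real.sin a * Real.cos y - Real.cos a * Real.sin y := by
        rw [← Real.sin_sub]; congr 1; linarith
      have hy0 : 0 ≤ y := by linarith
      have hcy : 0 < Real.cos y := Real.cos_pos_of_mem_Ioo ⟨by linarith, by linarith⟩
      have h1 : 0 ≤ Real.sin x := Real.sin_nonneg_of_nonneg_of_le_pi hx0 hx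
      have h2 : y * Real.cos y ≤ Real.sin y := by
        rcases hy0.eq_or_lt with h0 | h0
        · rw [← h0]; simp
        · have := Real.lt_tan h0 (by linarith)
          rw [Real.tan_eq_sin_div_cos, lt_div_iff₀ hcy] at this
          exact this.le
      have h3 : 0 ≤ 1 - Real.cos y := by linarith [Real.cos_le_one y]
      rw [e] at h1 ⊢
      refine le_of_mul_le_mul_left (a := Real.cos y) ?_ hcy
      have h4 := mul_le_mul_of_nonneg_left h2 hca.le
      have h5 := mul_nonneg h1 h3
      nlinarith
  have := mul_le_mul_of_nonneg_left key (by linarith : 0 ≤ r)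
  have e : r * (Real.sin a + Real.cos a * (x - a)) = tanLen r + (x - a) := by
    rw [← hs]; linear_combination (x - a) * hc
  linarith

/-! ### Polar coordinates -/

theorem norm_polar {r : ℝ} (hr : 1 ≤ r) (θ : ℝ) : ‖polar θ r‖ = r := by
  rw [polar, norm_mul, Complex.norm_exp_ofReal_mul_I, Complex.norm_real, mul_one,
    Real.norm_of_nonneg (by linarith)]

theorem polar_mul_exp (θ r τ : ℝ) :
    polar θ r * Complex.exp (-(τ : ℂ) * Complex.I) = polar (θ - τ) r := by
  rw [polar, polar, mul_assoc, ← Complex.exp_add]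
  congr 2; push_cast; ring

theorem polar_re (θ r : ℝ) : (polar θ r).re = r * Real.cos θ := by
  rw [polar, Complex.re_ofReal_mul, Complex.exp_ofReal_mul_I_re]

theorem polar_im (θ r : ℝ) : (polar θ r).im = r * Real.sin θ := by
  rw [polar, Complex.im_ofReal_mul, Complex.exp_ofReal_mul_I_im]

theorem norm_polar_sub_polar_sub (θ r θ' r' τ : ℝ) :
    ‖polar (θ - τ) r - polar (θ' - τ) r'‖ = ‖polar θ r - polar θ' r'‖ := by
  rw [← polar_mul_exp, ← polar_mul_exp, ← sub_mul, norm_mul, ← Complex.ofReal_neg,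
    Complex.norm_exp_ofReal_mul_I, mul_one]

theorem norm_polar_neg_sub (θ r θ' r' : ℝ) :
    ‖polar (-θ) r - polar (-θ') r'‖ = ‖polar θ r - polar θ' r'‖ := by
  rw [← Complex.norm_conj (polar θ r - polar θ' r')]
  congr 1
  apply Complex.ext <;>
    simp [polar_re, polar_im]

theorem norm_polar_sub_sq (θ r θ' r' : ℝ) :
    ‖polar θ r - polar θ' r'‖ ^ 2 = (r - r') ^ 2 + 2 * r * r' * (1 - Real.cos (θ - θ')) := by
  rw [Complex.sq_norm, Complex.normSq_apply]
  simp only [Complex.sub_re, Complex.sub_im, polar_re, polar_im]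
  rw [Real.cos_sub]
  have e1 := Real.sin_sq_add_cos_sq θ
  have e2 := Real.sin_sq_add_cos_sq θ'
  linear_combination r ^ 2 * e1 + r' ^ 2 * e2

/-- For radii at least 1 a chord controls the angle under which it is seen from the origin. The
bound serves to absorb the error term of `involute_sub_le`. -/
theorem abs_sub_le_two_mul_norm {θ r θ' r' : ℝ} (hr : 1 ≤ r) (hr' : 1 ≤ r')
    (h : |θ - θ'| ≤ 1) : |θ - θ'| ≤ 2 * ‖polar θ r - polar θ' r'‖ := by
  have h0 := norm_polar_sub_sq θ r θ' r'
  have h1 : Real.cos (θ - θ') ≤ 1 - 2 / Real.pi ^ 2 * (θ - θ') ^ 2 :=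
    Real.cos_le_one_sub_mul_cos_sq (h.trans (by linarith [Real.pi_gt_three]))
  -- A crude constant, from π < 4; it is what produces the factor 2 in the conclusion.
  have h2 : 1 / 8 ≤ 2 / Real.pi ^ 2 := by
    rw [div_le_div_iff₀ (by norm_num) (by positivity)]
    nlinarith [Real.pi_lt_four, Real.pi_pos]
  have h3 : (θ - θ') ^ 2 / 8 ≤ 1 - Real.cos (θ - θ') := by nlinarith [sq_nonneg (θ - θ')]
  have h4 : 1 ≤ r * r' := by nlinarith
  apply (sq_le_sq₀ (abs_nonneg _) (by positivity)).1
  rw [sq_abs, mul_pow, h0]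
  nlinarith [sq_nonneg (r - r'), sq_nonneg (θ - θ')]

theorem mul_sin_sub_mul_sin_le (θ r θ' r' τ : ℝ) :
    r * Real.sin (θ - τ) - r' * Real.sin (θ' - τ) ≤ ‖polar θ r - polar θ' r'‖ := by
  rw [← norm_polar_sub_polar_sub θ r θ' r' τ, ← polar_im, ← polar_im, ← Complex.sub_im]
  exact (le_abs_self _).trans (Complex.abs_im_le_norm _)

/-- Up to a constant, the distance to a point in whose shadow `(θ, r)` lies. -/
def involute (θ r : ℝ) : ℝ := θ + tanLen r - tanAng r

/-- The gradient of the involute at (θ, r) is the unit vector along the tangent touching the circle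
at the angle θ - `tanAng r`. The linear function with this gradient is 1-Lipschitz, and by
`mul_sin_sub_le` it lies below the involute up to a constant, with equality at (θ, r). The cubic
term is harmless, since it disappears when a path is subdivided. -/
theorem involute_sub_le {θ r θ' r' : ℝ} (hr : 1 ≤ r) (hr' : 1 ≤ r') (h : |θ - θ'| ≤ 1) :
    involute θ r - involute θ' r' ≤ ‖polar θ r - polar θ' r'‖ + |θ - θ'| ^ 3 := by
  have ha0 := tanAng_nonneg r
  have ha := tanAng_lt hr
  have h1 := mul_sin_sub_mul_sin_le θ r θ' r' (θ - tanAng r)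
  rw [sub_sub_cancel, mul_sin_tanAng hr] at h1
  have habs := abs_le.1 h
  have hcube : 0 ≤ |θ - θ'| ^ 3 := by positivity
  set x := θ' - (θ - tanAng r) with hx
  have h2 : r' * Real.sin x - x ≤ tanLen r' - tanAng r' + |θ - θ'| ^ 3 := by
    rcases le_or_gt 0 x with h0 | h0
    · have := mul_sin_sub_le hr' h0 (by linarith [Real.pi_gt_three])
      linarith
    -- The second point lies before the touching point, where the supporting inequality fails. As x
    -- is then at most |θ - θ'| in absolute value, the defect sin x - x is cubic in the change of
    -- angle.
    · have h3 := mul_sin_sub_le hr' le_rfl Real.pi_pos.le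
      rw [Real.sin_zero] at h3
      have h4 := Real.sin_gt_sub_cube (x := -x) (by linarith)
      rw [Real.sin_neg] at h4
      have h5 : -x ≤ |θ - θ'| := by linarith [le_abs_self (θ - θ')]
      have h6 : (-x) ^ 3 ≤ |θ - θ'| ^ 3 := pow_le_pow_left₀ (by linarith) h5 3
      have h7 : 0 ≤ (-x) ^ 3 := pow_nonneg (by linarith) 3
      have h8 : r' * Real.sin x ≤ Real.sin x := by
        have : Real.sin x ≤ 0 :=
          Real.sin_nonpos_of_nonpos_of_neg_pi_le h0.le (by linarith [Real.pi_gt_three])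
        nlinarith
      linarith
  unfold involute
  linarith

/-- The cubic error is at most δ |θ - θ'|, hence at most 2δ times the chord by
`abs_sub_le_two_mul_norm`. -/
theorem abs_involute_sub_le {θ r θ' r' δ : ℝ} (hr : 1 ≤ r) (hr' : 1 ≤ r') (hδ : δ ≤ 1)
    (h : |θ - θ'| ≤ δ) :
    |involute θ r - involute θ' r'| ≤ (1 + 2 * δ) * ‖polar θ r - polar θ' r'‖ := by
  have h1 := involute_sub_le hr hr' (h.trans hδ)
  have h2 := involute_sub_le hr' hr ((abs_sub_comm θ' θ).trans_le (h.trans hδ))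
  rw [abs_sub_comm θ' θ, norm_sub_rev] at h2
  have h3 := abs_sub_le_two_mul_norm hr hr' (h.trans hδ)
  have h0 := abs_nonneg (θ - θ')
  have h4 : |θ - θ'| ^ 3 ≤ δ * |θ - θ'| := by
    have h5 : |θ - θ'| ^ 2 ≤ δ := by nlinarith
    nlinarith
  have h5 : |θ - θ'| ^ 3 ≤ 2 * δ * ‖polar θ r - polar θ' r'‖ := by nlinarith
  rw [abs_le]; constructor <;> linarith

theorem polar_eq_right {r : ℝ} (hr : 1 ≤ r) (θ : ℝ) : polar θ r =
    Complex.exp ((θ + tanAng r : ℝ) * Complex.I) * (1 - tanLen r * Complex.I) := by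
  have h : (1 - tanLen r * Complex.I : ℂ) = polar (-tanAng r) r := by
    apply Complex.ext
    · simp [polar_re, mul_cos_tanAng hr]
    · simp [polar_im, mul_sin_tanAng hr]
  rw [h, polar, polar, mul_left_comm, ← Complex.exp_add]
  congr 2; push_cast; ring

theorem polar_eq_left {r : ℝ} (hr : 1 ≤ r) (θ : ℝ) : polar θ r =
    Complex.exp ((θ - tanAng r : ℝ) * Complex.I) * (1 + tanLen r * Complex.I) := by
  have h : (1 + tanLen r * Complex.I : ℂ) = polar (tanAng r) r := by
    apply Complex.ext
    · simp [polar_re, mul_cos_tanAng hr]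
    · simp [polar_im, mul_sin_tanAng hr]
  rw [h, polar, polar, mul_left_comm, ← Complex.exp_add]
  congr 2; push_cast; ring

/-! ### The logarithm map -/

/-- The initial vector of the geodesic from `(θ, r)` to `(θ', r')`, scaled to have the same length
as the geodesic. -/
def logMap (θ r θ' r' : ℝ) : ℂ :=
  if tanAng r + tanAng r' < θ' - θ then
    (tanLen r - tanAng r - θ + involute θ' r' : ℝ) *
      (Complex.I * Complex.exp ((θ + tanAng r : ℝ) * Complex.I))
  else if tanAng r + tanAng r' < θ - θ' then
    (tanLen r - tanAng r + θ + involute (-θ') r' : ℝ) *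
      (-Complex.I * Complex.exp ((θ - tanAng r : ℝ) * Complex.I))
  else polar θ' r' - polar θ r

/-- The definition covers the strict inequality only. In the case of equality the straight segment
touches the circle and the two formulas agree; this lets a path be cut where it leaves the visible
region. -/
theorem logMap_of_right {θ r θ' r' : ℝ} (hr : 1 ≤ r) (hr' : 1 ≤ r')
    (h : tanAng r + tanAng r' ≤ θ' - θ) :
    logMap θ r θ' r' = (tanLen r - tanAng r - θ + involute θ' r' : ℝ) *
      (Complex.I * Complex.exp ((θ + tanAng r : ℝ) * Complex.I)) := by
  rcases h.lt_or_eq with h | h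
  · rw [logMap, if_pos h]
  · have h1 := tanAng_nonneg r
    have h2 := tanAng_nonneg r'
    rw [logMap, if_neg h.not_lt, if_neg (by linarith), polar_eq_right hr, polar_eq_left hr',
      show θ' - tanAng r' = θ + tanAng r by linarith, involute,
      show tanLen r - tanAng r - θ + (θ' + tanLen r' - tanAng r') = tanLen r + tanLen r' by
        linarith]
    push_cast; ring

theorem logMap_of_left {θ r θ' r' : ℝ} (hr : 1 ≤ r) (hr' : 1 ≤ r')
    (h : tanAng r + tanAng r' ≤ θ - θ') :
    logMap θ r θ' r' = (tanLen r - tanAng r + θ + involute (-θ') r' : ℝ) *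
      (-Complex.I * Complex.exp ((θ - tanAng r : ℝ) * Complex.I)) := by
  have h1 := tanAng_nonneg r
  have h2 := tanAng_nonneg r'
  rcases h.lt_or_eq with h | h
  · rw [logMap, if_neg (by linarith), if_pos h]
  · rw [logMap, if_neg (by linarith), if_neg (by linarith), polar_eq_left hr, polar_eq_right hr',
      show θ' + tanAng r' = θ - tanAng r by linarith, involute,
      show tanLen r - tanAng r + θ + (-θ' + tanLen r' - tanAng r') = tanLen r + tanLen r' by
        linarith]
    push_cast; ring

theorem logMap_of_visible {θ r θ' r' : ℝ} (h : |θ' - θ| ≤ tanAng r + tanAng r') :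
    logMap θ r θ' r' = polar θ' r' - polar θ r := by
  have := abs_le.1 h
  rw [logMap, if_neg (by linarith), if_neg (by linarith)]

theorem logMap_self (θ r : ℝ) : logMap θ r θ r = 0 := by
  have := tanAng_nonneg r
  rw [logMap_of_visible (by simp; linarith), sub_self]

theorem norm_I_mul_exp (τ : ℝ) : ‖Complex.I * Complex.exp (τ * Complex.I)‖ = 1 := by
  rw [norm_mul, Complex.norm_I, Complex.norm_exp_ofReal_mul_I, one_mul]

theorem norm_neg_I_mul_exp (τ : ℝ) : ‖-Complex.I * Complex.exp (τ * Complex.I)‖ = 1 := by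
  rw [norm_mul, norm_neg, Complex.norm_I, Complex.norm_exp_ofReal_mul_I, one_mul]

section

variable {θ₀ r₀ θ r θ' r' δ : ℝ}

theorem norm_logMap_sub_le_of_visible (h : |θ - θ₀| ≤ tanAng r₀ + tanAng r)
    (h' : |θ' - θ₀| ≤ tanAng r₀ + tanAng r') :
    ‖logMap θ₀ r₀ θ r - logMap θ₀ r₀ θ' r'‖ = ‖polar θ r - polar θ' r'‖ := by
  rw [logMap_of_visible h, logMap_of_visible h', sub_sub_sub_cancel_right]

theorem norm_logMap_sub_le_of_right (hr₀ : 1 ≤ r₀) (hr : 1 ≤ r) (hr' : 1 ≤ r') (hδ : δ ≤ 1)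
    (hθ : |θ - θ'| ≤ δ) (h : tanAng r₀ + tanAng r ≤ θ - θ₀)
    (h' : tanAng r₀ + tanAng r' ≤ θ' - θ₀) :
    ‖logMap θ₀ r₀ θ r - logMap θ₀ r₀ θ' r'‖ ≤ (1 + 2 * δ) * ‖polar θ r - polar θ' r'‖ := by
  rw [logMap_of_right hr₀ hr h, logMap_of_right hr₀ hr' h', ← sub_mul, norm_mul, norm_I_mul_exp,
    mul_one, ← Complex.ofReal_sub, add_sub_add_left_eq_sub, Complex.norm_real]
  exact abs_involute_sub_le hr hr' hδ hθ

theorem norm_logMap_sub_le_of_left (hr₀ : 1 ≤ r₀) (hr : 1 ≤ r) (hr' : 1 ≤ r') (hδ : δ ≤ 1)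
    (hθ : |θ - θ'| ≤ δ) (h : tanAng r₀ + tanAng r ≤ θ₀ - θ)
    (h' : tanAng r₀ + tanAng r' ≤ θ₀ - θ') :
    ‖logMap θ₀ r₀ θ r - logMap θ₀ r₀ θ' r'‖ ≤ (1 + 2 * δ) * ‖polar θ r - polar θ' r'‖ := by
  rw [logMap_of_left hr₀ hr h, logMap_of_left hr₀ hr' h', ← sub_mul, norm_mul,
    norm_neg_I_mul_exp, mul_one, ← Complex.ofReal_sub, add_sub_add_left_eq_sub, Complex.norm_real,
    ← norm_polar_neg_sub]
  exact abs_involute_sub_le hr hr' hδ (by rwa [neg_sub_neg, abs_sub_comm])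

end

end ParkingLot

namespace ParkingLot

/-! ### The logarithm map does not increase lengths -/

/-- The points visible from m, those to their right and those to their left form three closed
regions, and the estimate is known when both ends lie in one of them. Otherwise the intermediate
value theorem yields crossing points on the path, and the estimate is additive over the pieces
because variation is. -/
theorem edist_logMap_le_of_abs_sub_le (m : Coord) {p q : Coord} (γ : Path p q) {δ : ℝ}
    (hδ0 : 0 ≤ δ) (hδ : δ ≤ 1) {a b : unitInterval} (hab : a ≤ b)
    (hθ : ∀ u ∈ Icc a b, ∀ v ∈ Icc a b, |(γ u).1 - (γ v).1| ≤ δ) :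
    edist (logMap m.1 m.2 (γ a).1 (γ a).2) (logMap m.1 m.2 (γ b).1 (γ b).2) ≤
      ENNReal.ofReal (1 + 2 * δ) * eVariationOn (fun t => cover (γ t)) (univ ∩ Icc a b) := by
  set K := ENNReal.ofReal (1 + 2 * δ)
  set N : unitInterval → ℂ := fun u => logMap m.1 m.2 (γ u).1 (γ u).2 with hN
  set V : unitInterval → unitInterval → ENNReal := fun s t =>
    eVariationOn (fun t => cover (γ t)) (univ ∩ Icc s t) with hV
  set f : unitInterval → ℝ := fun u => (γ u).1 - m.1 with hf
  set g : unitInterval → ℝ := fun u => tanAng m.2 + tanAng (γ u).2 with hg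
  have hg0 : ∀ u, 0 ≤ g u := fun u => add_nonneg (tanAng_nonneg _) (tanAng_nonneg _)
  have hfc : Continuous f := by fun_prop
  have hgc : Continuous g := by
    refine continuous_const.add (continuous_tanAng_comp (by fun_prop) fun u => (γ u).2.2)
  have hr : ∀ u, (1 : ℝ) ≤ (γ u).2 := fun u => (γ u).2.2
  have hm : (1 : ℝ) ≤ m.2 := m.2.2
  have same : ∀ s ∈ Icc a b, ∀ t ∈ Icc a b, s ≤ t →
      (|f s| ≤ g s ∧ |f t| ≤ g t ∨ g s ≤ f s ∧ g t ≤ f t ∨ g s ≤ -f s ∧ g t ≤ -f t) →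
      edist (N s) (N t) ≤ K * V s t := by
    intro s hs t ht hst h
    have h1 : ‖N s - N t‖ ≤ (1 + 2 * δ) * ‖cover (γ s) - cover (γ t)‖ := by
      rcases h with ⟨h, h'⟩ | ⟨h, h'⟩ | ⟨h, h'⟩
      · refine (norm_logMap_sub_le_of_visible h h').le.trans ?_
        exact le_mul_of_one_le_left (norm_nonneg _) (by linarith)
      · exact norm_logMap_sub_le_of_right hm (hr s) (hr t) hδ (hθ s hs t ht) h h'
      · refine norm_logMap_sub_le_of_left hm (hr s) (hr t) hδ (hθ s hs t ht) ?_ ?_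
        · simpa [hf] using h
        · simpa [hf] using h'
    calc edist (N s) (N t) ≤ K * edist (cover (γ s)) (cover (γ t)) := by
          rw [edist_dist, edist_dist, dist_eq_norm, dist_eq_norm,
            ← ENNReal.ofReal_mul (by linarith)]
          exact ENNReal.ofReal_le_ofReal h1
      _ ≤ K * V s t := by
          gcongr
          exact eVariationOn.edist_le (fun t => cover (γ t)) ⟨mem_univ _, le_rfl, hst⟩
            ⟨mem_univ _, hst, le_rfl⟩
  have trans : ∀ s w t, s ≤ w → w ≤ t → edist (N s) (N w) ≤ K * V s w →
      edist (N w) (N t) ≤ K * V w t → edist (N s) (N t) ≤ K * V s t := by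
    intro s w t hsw hwt h1 h2
    rw [hV] at *
    simp only at *
    rw [← eVariationOn.Icc_add_Icc _ hsw hwt (mem_univ w), mul_add]
    exact (edist_triangle _ _ _).trans (add_le_add h1 h2)
  have ivt : ∀ s ∈ Icc a b, ∀ t ∈ Icc a b, s ≤ t → ∀ f' g' : unitInterval → ℝ, Continuous f' →
      Continuous g' → (f' s ≤ g' s ∧ g' t ≤ f' t ∨ f' t ≤ g' t ∧ g' s ≤ f' s) →
      ∃ w ∈ Icc a b, s ≤ w ∧ w ≤ t ∧ f' w = g' w := by
    intro s hs t ht hst f' g' hf' hg' h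
    have hpc : IsPreconnected (Icc s t) := isPreconnected_Icc
    rcases h with ⟨h1, h2⟩ | ⟨h1, h2⟩
    · obtain ⟨w, hw, h⟩ := hpc.intermediate_value₂ (left_mem_Icc.2 hst) (right_mem_Icc.2 hst)
        hf'.continuousOn hg'.continuousOn h1 h2
      exact ⟨w, ⟨hs.1.trans hw.1, hw.2.trans ht.2⟩, hw.1, hw.2, h⟩
    · obtain ⟨w, hw, h⟩ := hpc.intermediate_value₂ (right_mem_Icc.2 hst) (left_mem_Icc.2 hst)
        hf'.continuousOn hg'.continuousOn h1 h2
      exact ⟨w, ⟨hs.1.trans hw.1, hw.2.trans ht.2⟩, hw.1, hw.2, h⟩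
  have vis_of_eq : ∀ w, f w = g w → |f w| ≤ g w := fun w h => by
    rw [abs_of_nonneg (h ▸ hg0 w)]; exact h.le
  have vis_of_eq' : ∀ w, -f w = g w → |f w| ≤ g w := fun w h => by
    rw [← abs_neg, abs_of_nonneg (h ▸ hg0 w)]; exact h.le
  have step : ∀ s ∈ Icc a b, ∀ t ∈ Icc a b, s ≤ t → (|f s| ≤ g s ∨ |f t| ≤ g t) →
      edist (N s) (N t) ≤ K * V s t := by
    intro s hs t ht hst h
    by_cases hvs : |f s| ≤ g s
    · by_cases hvt : |f t| ≤ g t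
      · exact same s hs t ht hst (Or.inl ⟨hvs, hvt⟩)
      · have h1 := abs_le.1 hvs
        rcases lt_abs.1 (not_le.1 hvt) with h2 | h2
        · obtain ⟨w, hw, hsw, hwt, e⟩ := ivt s hs t ht hst f g hfc hgc (Or.inl ⟨h1.2, h2.le⟩)
          exact trans s w t hsw hwt (same s hs w hw hsw (Or.inl ⟨hvs, vis_of_eq w e⟩))
            (same w hw t ht hwt (Or.inr (Or.inl ⟨e.ge, h2.le⟩)))
        · obtain ⟨w, hw, hsw, hwt, e⟩ := ivt s hs t ht hst (fun u => -f u) g hfc.neg hgc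
            (Or.inl ⟨by linarith, h2.le⟩)
          exact trans s w t hsw hwt (same s hs w hw hsw (Or.inl ⟨hvs, vis_of_eq' w e⟩))
            (same w hw t ht hwt (Or.inr (Or.inr ⟨e.ge, h2.le⟩)))
    · have hvt := h.resolve_left hvs
      have h1 := abs_le.1 hvt
      rcases lt_abs.1 (not_le.1 hvs) with h2 | h2
      · obtain ⟨w, hw, hsw, hwt, e⟩ := ivt s hs t ht hst f g hfc hgc (Or.inr ⟨h1.2, h2.le⟩)
        exact trans s w t hsw hwt (same s hs w hw hsw (Or.inr (Or.inl ⟨h2.le, e.ge⟩)))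
          (same w hw t ht hwt (Or.inl ⟨vis_of_eq w e, hvt⟩))
      · obtain ⟨w, hw, hsw, hwt, e⟩ := ivt s hs t ht hst (fun u => -f u) g hfc.neg hgc
          (Or.inr ⟨by linarith, h2.le⟩)
        exact trans s w t hsw hwt (same s hs w hw hsw (Or.inr (Or.inr ⟨h2.le, e.ge⟩)))
          (same w hw t ht hwt (Or.inl ⟨vis_of_eq' w e, hvt⟩))
  have ha : a ∈ Icc a b := left_mem_Icc.2 hab
  have hb : b ∈ Icc a b := right_mem_Icc.2 hab
  -- A path from one side to the other passes through the angle of m, and points at that angle are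
  -- visible from m.
  have cross : (f a ≤ 0 ∧ 0 ≤ f b ∨ f b ≤ 0 ∧ 0 ≤ f a) → edist (N a) (N b) ≤ K * V a b := by
    intro h
    obtain ⟨w, hw, haw, hwb, e⟩ := ivt a ha b hb hab f (fun _ => 0) hfc continuous_const h
    have hv : |f w| ≤ g w := by rw [e, abs_zero]; exact hg0 w
    exact trans a w b haw hwb (step a ha w hw haw (Or.inr hv)) (step w hw b hb hwb (Or.inl hv))
  by_cases hv : |f a| ≤ g a ∨ |f b| ≤ g b
  · exact step a ha b hb hab hv
  · push Not at hv
    have ha0 := hg0 a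
    have hb0 := hg0 b
    rcases lt_abs.1 hv.1 with h1 | h1 <;> rcases lt_abs.1 hv.2 with h2 | h2
    · exact same a ha b hb hab (Or.inr (Or.inl ⟨h1.le, h2.le⟩))
    · exact cross (Or.inr ⟨by linarith, by linarith⟩)
    · exact cross (Or.inl ⟨by linarith, by linarith⟩)
    · exact same a ha b hb hab (Or.inr (Or.inr ⟨h1.le, h2.le⟩))

/-- A path is cut into pieces on which the angle varies by less than δ; the estimates for the pieces
add up with the factor 1 + 2δ, and δ tends to 0. -/
theorem edist_logMap_le_pathLength (m : Coord) {p q : Coord} (γ : Path p q) :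
    edist (logMap m.1 m.2 p.1 p.2) (logMap m.1 m.2 q.1 q.2) ≤ pathLength γ := by
  have key : ∀ δ : ℝ, 0 < δ → δ ≤ 1 →
      edist (logMap m.1 m.2 p.1 p.2) (logMap m.1 m.2 q.1 q.2) ≤
        ENNReal.ofReal (1 + 2 * δ) * pathLength γ := by
    intro δ hδ0 hδ
    obtain ⟨t, ht0, htm, ⟨n, hn⟩, ht⟩ := exists_monotone_Icc_subset_open_cover_unitInterval
      (c := fun x : ℝ => {u : unitInterval | |(γ u).1 - x| < δ / 2})
      (fun x => isOpen_lt (by fun_prop) continuous_const)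
      (fun u _ => mem_iUnion.2 ⟨(γ u).1, by simp; linarith⟩)
    have ind : ∀ k, edist (logMap m.1 m.2 (γ 0).1 (γ 0).2) (logMap m.1 m.2 (γ (t k)).1 (γ (t k)).2) ≤
        ENNReal.ofReal (1 + 2 * δ) *
          eVariationOn (fun t => cover (γ t)) (univ ∩ Icc 0 (t k)) := by
      intro k
      induction k with
      | zero => rw [ht0, edist_self]; exact zero_le
      | succ k ih =>
        have hk : t k ≤ t (k + 1) := htm (Nat.le_succ k)
        rw [← eVariationOn.Icc_add_Icc _ (unitInterval.nonneg' (t := t k)) hk (mem_univ _), mul_add]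
        refine (edist_triangle _ _ _).trans (add_le_add ih ?_)
        refine edist_logMap_le_of_abs_sub_le m γ hδ0.le hδ hk ?_
        obtain ⟨x, hx⟩ := ht k
        intro u hu v hv
        have h1 : |(γ u).1 - x| < δ / 2 := hx hu
        have h2 : |(γ v).1 - x| < δ / 2 := hx hv
        rw [abs_lt] at h1 h2
        rw [abs_le]; constructor <;> linarith
    have h := ind n
    rw [hn n le_rfl, γ.source, γ.target] at h
    refine h.trans ?_
    gcongr
    exact eVariationOn.mono _ inter_subset_left
  by_cases htop : pathLength γ = ⊤
  · rw [htop]; exact le_top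
  · have hlim : Tendsto (fun δ : ℝ => ENNReal.ofReal (1 + 2 * δ) * pathLength γ) (𝓝[>] 0)
        (𝓝 (ENNReal.ofReal (1 + 2 * 0) * pathLength γ)) := by
      refine ENNReal.Tendsto.mul_const ?_ (Or.inr htop)
      refine (ENNReal.tendsto_ofReal ?_).mono_left nhdsWithin_le_nhds
      exact Continuous.tendsto (by fun_prop) 0
    rw [mul_zero, add_zero, ENNReal.ofReal_one, one_mul] at hlim
    refine ge_of_tendsto hlim ?_
    filter_upwards [Ioc_mem_nhdsGT (zero_lt_one' ℝ)] with δ hδ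
    exact key δ hδ.1 hδ.2

/-! ### Flat half-planes -/

/-- The point with Cartesian coordinates `w`, `1 ≤ re w`, in the half-plane bounded by the tangent
at `(ψ, 1)`. -/
def flat (ψ : ℝ) (w : ℂ) (hw : 1 ≤ w.re) : ParkingLot :=
  ⟨ψ + w.arg, ‖w‖, hw.trans ((le_abs_self _).trans (Complex.abs_re_le_norm w))⟩

theorem cover_flat (ψ : ℝ) (w : ℂ) (hw : 1 ≤ w.re) :
    cover (flat ψ w hw).coord = Complex.exp (ψ * Complex.I) * w := by
  change (‖w‖ : ℂ) * Complex.exp ((ψ + w.arg : ℝ) * Complex.I) = _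
  conv_rhs => rw [← Complex.norm_mul_exp_arg_mul_I w]
  rw [mul_left_comm, ← Complex.exp_add]
  congr 2; push_cast; ring

theorem dist_def (p q : ParkingLot) : dist p q = (lengthDist p.coord q.coord).toReal := rfl

theorem norm_cover_sub_le_dist (p q : ParkingLot) :
    ‖cover p.coord - cover q.coord‖ ≤ dist p q := by
  rw [← dist_eq_norm, dist_def, ← ENNReal.ofReal_le_iff_le_toReal (lengthDist_ne_top _ _),
    ← edist_dist]
  refine le_iInf fun γ => ?_
  have h1 := eVariationOn.edist_le (fun t => cover (γ t)) (mem_univ 0) (mem_univ 1)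
  rwa [γ.source, γ.target] at h1

theorem norm_logMap_sub_le_dist (m p q : ParkingLot) :
    ‖logMap m.angle m.radius p.angle p.radius - logMap m.angle m.radius q.angle q.radius‖ ≤
      dist p q := by
  rw [← dist_eq_norm, dist_def, ← ENNReal.ofReal_le_iff_le_toReal (lengthDist_ne_top _ _),
    ← edist_dist]
  exact le_iInf fun γ => edist_logMap_le_pathLength m.coord γ

theorem dist_le_of_lipschitz {p q : ParkingLot} (γ : Path p.coord q.coord) {K : ℝ} (hK : 0 ≤ K)
    (h : ∀ s t : unitInterval, ‖cover (γ s) - cover (γ t)‖ ≤ K * |(s : ℝ) - t|) :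
    dist p q ≤ K := by
  refine ENNReal.toReal_le_of_le_ofReal hK ((iInf_le _ γ).trans ?_)
  have hlip : LipschitzOnWith (Real.toNNReal K) (fun t : ℝ => cover (γ (projIcc 0 1 zero_le_one t)))
      (Icc 0 1) := by
    refine LipschitzOnWith.of_dist_le_mul fun s hs t ht => ?_
    rw [Real.coe_toNNReal K hK, dist_eq_norm, projIcc_of_mem _ hs, projIcc_of_mem _ ht]
    exact h _ _
  have hm : MonotoneOn (fun t : unitInterval => (t : ℝ)) univ := fun a _ b _ hab => hab
  have h1 : eVariationOn (fun t : unitInterval => (t : ℝ)) univ ≤ 1 := by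
    have h := (hm.eVariationOn_eq (mem_univ 0) (mem_univ 1)).le
    have hu : (univ : Set unitInterval) ∩ Icc 0 1 = univ := by
      ext t; simp [unitInterval.le_one']
    rw [hu] at h
    simpa using h
  have h2 := hlip.comp_eVariationOn_le (g := fun t : unitInterval => (t : ℝ)) (s := univ)
    (fun t _ => t.2)
  have e : (fun t : ℝ => cover (γ (projIcc 0 1 zero_le_one t))) ∘ (fun t : unitInterval => (t : ℝ)) =
      fun t => cover (γ t) := by
    funext t; simp
  rw [e] at h2
  refine h2.trans ?_
  calc _ ≤ (Real.toNNReal K : ENNReal) * 1 := by gcongr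
    _ = ENNReal.ofReal K := by rw [mul_one]; rfl

/-- The half-plane is convex, so the straight segment stays in it and gives the upper bound; the
covering map does not increase distances, which gives the lower bound. -/
theorem dist_flat_flat (ψ : ℝ) {w w' : ℂ} (hw : 1 ≤ w.re) (hw' : 1 ≤ w'.re) :
    dist (flat ψ w hw) (flat ψ w' hw') = ‖w - w'‖ := by
  have hc : ∀ v v' : ℂ, ‖Complex.exp (ψ * Complex.I) * v - Complex.exp (ψ * Complex.I) * v'‖ =
      ‖v - v'‖ := by
    intro v v'
    rw [← mul_sub, norm_mul, Complex.norm_exp_ofReal_mul_I, one_mul]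
  apply le_antisymm
  · have hseg : ∀ t : unitInterval, 1 ≤ (w + (t : ℝ) * (w' - w)).re := by
      intro t
      have h0 := t.2.1
      have h1 := t.2.2
      simp only [Complex.add_re, Complex.re_ofReal_mul, Complex.sub_re]
      nlinarith
    let γ : Path (flat ψ w hw).coord (flat ψ w' hw').coord :=
      { toFun := fun t => (flat ψ (w + (t : ℝ) * (w' - w)) (hseg t)).coord
        continuous_toFun := by
          refine Continuous.prodMk ?_ (Continuous.subtype_mk (by
            change Continuous fun t : unitInterval => ‖w + (t : ℝ) * (w' - w)‖
            fun_prop) _)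
          change Continuous fun t : unitInterval => ψ + (w + (t : ℝ) * (w' - w)).arg
          refine continuous_const.add (continuous_iff_continuousAt.2 fun t => ?_)
          refine ContinuousAt.comp (f := fun t : unitInterval => w + (t : ℝ) * (w' - w))
            (Complex.continuousAt_arg ?_) (by fun_prop)
          exact Or.inl (by linarith [hseg t])
        source' := by simp
        target' := by simp }
    refine dist_le_of_lipschitz γ (norm_nonneg _) fun s t => le_of_eq ?_
    change ‖cover (flat ψ _ (hseg s)).coord - cover (flat ψ _ (hseg t)).coord‖ = _
    rw [cover_flat, cover_flat, hc]
    have : w + (s : ℝ) * (w' - w) - (w + (t : ℝ) * (w' - w)) = ((t - s : ℝ) : ℂ) * (w - w') := by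
      push_cast; ring
    rw [this, norm_mul, Complex.norm_real, Real.norm_eq_abs, abs_sub_comm, mul_comm]
  · rw [← hc, ← cover_flat ψ w hw, ← cover_flat ψ w' hw']
    exact norm_cover_sub_le_dist _ _

end ParkingLot

namespace ParkingLot

/-! ### Visibility and the distance formula -/

theorem flat_angle_sub (ψ : ℝ) {w : ℂ} (hw : 1 ≤ w.re) :
    |(flat ψ w hw).angle - ψ| ≤ tanAng (flat ψ w hw).radius := by
  have e : (flat ψ w hw).angle - ψ = w.arg := by simp [flat]
  rw [e]
  have hw0 : w ≠ 0 := by rintro rfl; norm_num at hw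
  refine le_tanAng (flat ψ w hw).one_le_radius (Complex.abs_arg_le_pi w) ?_
  change 1 ≤ ‖w‖ * Real.cos w.arg
  rw [Complex.cos_arg hw0, mul_div_cancel₀ _ (norm_ne_zero_iff.2 hw0)]
  exact hw

theorem exists_eq_flat {ψ : ℝ} {p : ParkingLot} (h : |p.angle - ψ| ≤ tanAng p.radius) :
    ∃ w hw, p = flat ψ w hw := by
  have hr := p.one_le_radius
  have hlt := tanAng_lt hr
  have hre : 1 ≤ (polar (p.angle - ψ) p.radius).re := by
    rw [polar_re, ← mul_cos_tanAng hr, ← Real.cos_abs (p.angle - ψ)]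
    gcongr
    exact Real.cos_le_cos_of_nonneg_of_le_pi (abs_nonneg _) (by linarith [Real.pi_pos]) h
  refine ⟨polar (p.angle - ψ) p.radius, hre, ?_⟩
  ext
  · change p.angle = ψ + (polar (p.angle - ψ) p.radius).arg
    have h1 := abs_le.1 h
    rw [polar, Complex.exp_mul_I, Complex.arg_mul_cos_add_sin_mul_I (by linarith)
      ⟨by linarith [Real.pi_pos], by linarith [Real.pi_pos]⟩]
    ring
  · exact (norm_polar hr _).symm

/-- A point lies in the half-planes whose angles of tangency are within `tanAng` of its own angle.
The hypothesis says that these intervals intersect for the two points, and the larger of the two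
left ends is a common element. -/
theorem exists_eq_flat_flat {p q : ParkingLot}
    (h : |q.angle - p.angle| ≤ tanAng p.radius + tanAng q.radius) :
    ∃ ψ w hw w' hw', p = flat ψ w hw ∧ q = flat ψ w' hw' := by
  have hp := tanAng_nonneg p.radius
  have hq := tanAng_nonneg q.radius
  have h1 := abs_le.1 h
  have : ∃ ψ, |p.angle - ψ| ≤ tanAng p.radius ∧ |q.angle - ψ| ≤ tanAng q.radius := by
    refine ⟨max (p.angle - tanAng p.radius) (q.angle - tanAng q.radius), ?_, ?_⟩ <;>
    · rw [abs_le]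
      rcases max_cases (p.angle - tanAng p.radius) (q.angle - tanAng q.radius) with h | h <;>
        constructor <;> linarith
  obtain ⟨ψ, h2, h3⟩ := this
  obtain ⟨w, hw, e⟩ := exists_eq_flat h2
  obtain ⟨w', hw', e'⟩ := exists_eq_flat h3
  exact ⟨ψ, w, hw, w', hw', e, e'⟩

theorem polar_eq_cover (p : ParkingLot) : polar p.angle p.radius = cover p.coord := rfl

theorem dist_of_visible {p q : ParkingLot}
    (h : |q.angle - p.angle| ≤ tanAng p.radius + tanAng q.radius) :
    dist p q = ‖polar q.angle q.radius - polar p.angle p.radius‖ := by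
  obtain ⟨ψ, w, hw, w', hw', rfl, rfl⟩ := exists_eq_flat_flat h
  rw [polar_eq_cover, polar_eq_cover, cover_flat, cover_flat, dist_flat_flat, ← mul_sub, norm_mul,
    Complex.norm_exp_ofReal_mul_I, one_mul, norm_sub_rev]

theorem logMap_flat_flat (ψ : ℝ) {w w' : ℂ} (hw : 1 ≤ w.re) (hw' : 1 ≤ w'.re) :
    logMap (flat ψ w hw).angle (flat ψ w hw).radius (flat ψ w' hw').angle (flat ψ w' hw').radius =
      Complex.exp (ψ * Complex.I) * (w' - w) := by
  rw [logMap_of_visible, polar_eq_cover, polar_eq_cover, cover_flat, cover_flat, mul_sub]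
  have h1 := abs_le.1 (flat_angle_sub ψ hw)
  have h2 := abs_le.1 (flat_angle_sub ψ hw')
  rw [abs_le]; constructor <;> linarith

theorem dist_spiral_le (s t : ℝ) : dist (spiral s) (spiral t) ≤ |s - t| := by
  let γ : Path (spiral s).coord (spiral t).coord :=
    { toFun := fun u => (spiral (s + u * (t - s))).coord
      continuous_toFun := by
        change Continuous fun u : unitInterval => ((s + (u : ℝ) * (t - s), ⟨1, mem_Ici.2 le_rfl⟩) : Coord)
        fun_prop
      source' := by simp
      target' := by simp }
  refine dist_le_of_lipschitz γ (abs_nonneg _) fun u v => ?_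
  refine (cover_dist_le (s + u * (t - s)) (s + v * (t - s)) 1 1).trans (le_of_eq ?_)
  rw [sub_self, abs_zero, zero_add, abs_one, one_mul, abs_sub_comm s t, ← abs_mul]
  congr 1; ring

theorem norm_logMap_le_dist (p q : ParkingLot) :
    ‖logMap p.angle p.radius q.angle q.radius‖ ≤ dist p q := by
  have := norm_logMap_sub_le_dist p q p
  rwa [logMap_self, sub_zero, dist_comm] at this

/-- The upper bound is the path made of a tangent segment, an arc of the circle and another tangent
segment. Its optimality is the Lipschitz property of the logarithm map. -/
theorem dist_of_right {p q : ParkingLot}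
    (h : tanAng p.radius + tanAng q.radius ≤ q.angle - p.angle) :
    dist p q = tanLen p.radius - tanAng p.radius - p.angle + involute q.angle q.radius := by
  have hp := p.one_le_radius
  have hq := q.one_le_radius
  have hpa := tanAng_nonneg p.radius
  have hqa := tanAng_nonneg q.radius
  have hpl := tanLen_nonneg p.radius
  have hql := tanLen_nonneg q.radius
  set u := p.angle + tanAng p.radius with hu
  set v := q.angle - tanAng q.radius with hv
  apply le_antisymm
  · have h1 : dist p (spiral u) = tanLen p.radius := by
      rw [dist_of_visible (by
        change |u - p.angle| ≤ tanAng p.radius + tanAng 1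
        rw [tanAng_one, hu, add_sub_cancel_left, abs_of_nonneg hpa, add_zero])]
      change ‖polar u 1 - polar p.angle p.radius‖ = _
      rw [polar_eq_right hp, ← hu, polar, Complex.ofReal_one, one_mul]
      nth_rewrite 1 [← mul_one (Complex.exp (u * Complex.I))]
      rw [← mul_sub, norm_mul, Complex.norm_exp_ofReal_mul_I, one_mul, sub_sub_cancel, norm_mul,
        Complex.norm_I, mul_one, Complex.norm_real, Real.norm_of_nonneg hpl]
    have h2 : dist (spiral v) q = tanLen q.radius := by
      rw [dist_of_visible (by
        change |q.angle - v| ≤ tanAng 1 + tanAng q.radius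
        rw [tanAng_one, hv, sub_sub_cancel, abs_of_nonneg hqa, zero_add])]
      change ‖polar q.angle q.radius - polar v 1‖ = _
      rw [polar_eq_left hq, ← hv, polar, Complex.ofReal_one, one_mul]
      nth_rewrite 2 [← mul_one (Complex.exp (v * Complex.I))]
      rw [← mul_sub, norm_mul, Complex.norm_exp_ofReal_mul_I, one_mul, add_sub_cancel_left,
        norm_mul, Complex.norm_I, mul_one, Complex.norm_real, Real.norm_of_nonneg hql]
    have h3 := dist_spiral_le u v
    rw [abs_sub_comm, abs_of_nonneg (by linarith)] at h3
    have h4 := dist_triangle4 p (spiral u) (spiral v) q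
    unfold involute
    linarith
  · refine le_trans ?_ (norm_logMap_le_dist p q)
    rw [logMap_of_right hp hq h, norm_mul, norm_I_mul_exp, mul_one, Complex.norm_real]
    exact le_abs_self _

theorem dist_eq_norm_logMap (p q : ParkingLot) :
    dist p q = ‖logMap p.angle p.radius q.angle q.radius‖ := by
  have hp := p.one_le_radius
  have hq := q.one_le_radius
  refine le_antisymm ?_ (norm_logMap_le_dist p q)
  by_cases hv : |q.angle - p.angle| ≤ tanAng p.radius + tanAng q.radius
  · rw [logMap_of_visible hv, dist_of_visible hv]
  rcases lt_abs.1 (not_le.1 hv) with h | h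
  · rw [dist_of_right h.le, logMap_of_right hp hq h.le, norm_mul, norm_I_mul_exp, mul_one,
      Complex.norm_real]
    exact le_abs_self _
  · rw [neg_sub] at h
    rw [dist_comm, dist_of_right (p := q) (q := p) (by linarith), logMap_of_left hp hq h.le,
      norm_mul, norm_neg_I_mul_exp, mul_one, Complex.norm_real]
    refine le_trans (le_of_eq ?_) (le_abs_self _)
    unfold involute; ring

/-! ### The inequality of Bruhat and Tits in the parking lot -/

/-- The logarithm at m is 1-Lipschitz and preserves distances to m, so the distances from p to x and
y are at least those between the vectors v, A and B. In the weighted sum of the squares |v - A|² and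
|v - B|² the inner products cancel, because the weighted sum of A and B is zero. -/
theorem cn_of_logMap {x y m : ParkingLot} {s : ℝ} (hs : s ∈ Icc (0 : ℝ) 1)
    (h : ((1 - s : ℝ) : ℂ) * logMap m.angle m.radius x.angle x.radius +
      (s : ℂ) * logMap m.angle m.radius y.angle y.radius = 0) (p : ParkingLot) :
    dist p m ^ 2 ≤ (1 - s) * dist p x ^ 2 + s * dist p y ^ 2 - s * (1 - s) * dist x y ^ 2 := by
  have hpm : dist p m = ‖logMap m.angle m.radius p.angle p.radius‖ := by
    rw [dist_comm, dist_eq_norm_logMap]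
  have hpx := norm_logMap_sub_le_dist m p x
  have hpy := norm_logMap_sub_le_dist m p y
  have hxy : dist x y ≤ ‖logMap m.angle m.radius x.angle x.radius‖ +
      ‖logMap m.angle m.radius y.angle y.radius‖ := by
    rw [← dist_eq_norm_logMap, ← dist_eq_norm_logMap, dist_comm m x]
    exact dist_triangle _ _ _
  set A := logMap m.angle m.radius x.angle x.radius
  set B := logMap m.angle m.radius y.angle y.radius
  set v := logMap m.angle m.radius p.angle p.radius
  have hs0 := hs.1
  have hs1 : 0 ≤ 1 - s := by linarith [hs.2]
  have hnorm : (1 - s) * ‖A‖ = s * ‖B‖ := by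
    have h1 : ((1 - s : ℝ) : ℂ) * A = -((s : ℂ) * B) := eq_neg_of_add_eq_zero_left h
    have h2 := congrArg norm h1
    rwa [norm_neg, norm_mul, norm_mul, Complex.norm_real, Complex.norm_real,
      Real.norm_of_nonneg hs0, Real.norm_of_nonneg hs1] at h2
  have hinner : (1 - s) * inner ℝ v A + s * inner ℝ v B = 0 := by
    rw [← real_inner_smul_right, ← real_inner_smul_right, ← inner_add_right,
      Complex.real_smul, Complex.real_smul, h, inner_zero_right]
  have e1 := norm_sub_sq_real v A
  have e2 := norm_sub_sq_real v B
  have h3 : ‖v - A‖ ^ 2 ≤ dist p x ^ 2 := pow_le_pow_left₀ (norm_nonneg _) hpx 2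
  have h4 : ‖v - B‖ ^ 2 ≤ dist p y ^ 2 := pow_le_pow_left₀ (norm_nonneg _) hpy 2
  have h5 : dist x y ^ 2 ≤ (‖A‖ + ‖B‖) ^ 2 := pow_le_pow_left₀ dist_nonneg hxy 2
  have h6 := mul_le_mul_of_nonneg_left h5 (mul_nonneg hs0 hs1)
  have h7 := mul_le_mul_of_nonneg_left h3 hs1
  have h8 := mul_le_mul_of_nonneg_left h4 hs0
  have eA : ‖A‖ = s * (‖A‖ + ‖B‖) := by linarith
  have eB : ‖B‖ = (1 - s) * (‖A‖ + ‖B‖) := by linarith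
  -- Balancing forces |A| : |B| = s : (1 - s), so the weighted squares of the norms are exactly the
  -- correction term with |A| + |B| in the place of `dist x y`.
  have h9 : s * (1 - s) * (‖A‖ + ‖B‖) ^ 2 = (1 - s) * ‖A‖ ^ 2 + s * ‖B‖ ^ 2 := by
    linear_combination (-(1 - s) * (‖A‖ + s * (‖A‖ + ‖B‖))) * eA -
      s * (‖B‖ + (1 - s) * (‖A‖ + ‖B‖)) * eB
  rw [hpm]
  nlinarith

theorem one_le_sqrt_one_add_sq (c : ℝ) : 1 ≤ √(1 + c ^ 2) :=
  Real.one_le_sqrt.2 (by nlinarith [sq_nonneg c])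

theorem tanLen_sqrt {c : ℝ} (hc : 0 ≤ c) : tanLen √(1 + c ^ 2) = c := by
  rw [tanLen, Real.sq_sqrt (by positivity), add_sub_cancel_left, Real.sqrt_sq hc]

theorem tanAng_sqrt {c : ℝ} (hc : 0 ≤ c) : tanAng √(1 + c ^ 2) = Real.arctan c := by
  refine tanAng_eq_of_cos (Real.arctan_nonneg.2 hc)
    (by linarith [Real.arctan_lt_pi_div_two c, Real.pi_pos]) ?_
  rw [Real.cos_arctan]
  have : √(1 + c ^ 2) ≠ 0 := by linarith [one_le_sqrt_one_add_sq c]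
  field_simp

/-- It suffices to find a point whose logarithms balance. For mutually visible points it is the
division point in a common half-plane; otherwise it is found on the first tangent segment, the arc
or the last tangent segment of the geodesic. -/
theorem hasCNPoints : HasCNPoints ParkingLot := by
  have main : ∀ x y : ParkingLot, x.angle ≤ y.angle → HasCNPointsBetween x y := by
    intro x y hxy s hs
    have hs0 := hs.1
    have hs1 := hs.2
    suffices h : ∃ m : ParkingLot, ((1 - s : ℝ) : ℂ) * logMap m.angle m.radius x.angle x.radius +
        (s : ℂ) * logMap m.angle m.radius y.angle y.radius = 0 by
      obtain ⟨m, hm⟩ := h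
      exact ⟨m, cn_of_logMap hs hm⟩
    have hx := x.one_le_radius
    have hy := y.one_le_radius
    have hxa := tanAng_nonneg x.radius
    have hya := tanAng_nonneg y.radius
    have hxl := tanLen_nonneg x.radius
    have hyl := tanLen_nonneg y.radius
    by_cases hv : |y.angle - x.angle| ≤ tanAng x.radius + tanAng y.radius
    · obtain ⟨ψ, w, hw, w', hw', rfl, rfl⟩ := exists_eq_flat_flat hv
      have hm : 1 ≤ (((1 - s : ℝ) : ℂ) * w + (s : ℂ) * w').re := by
        rw [Complex.add_re, Complex.re_ofReal_mul, Complex.re_ofReal_mul]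
        nlinarith
      refine ⟨flat ψ _ hm, ?_⟩
      rw [logMap_flat_flat, logMap_flat_flat]
      push_cast; ring
    · rw [abs_of_nonneg (by linarith), not_le] at hv
      set u := x.angle + tanAng x.radius with hu
      set v := y.angle - tanAng y.radius with hv'
      set ℓ := tanLen x.radius + (v - u) + tanLen y.radius with hℓ
      have hℓ0 : 0 ≤ ℓ := by linarith
      have ht0 : 0 ≤ s * ℓ := mul_nonneg hs0 hℓ0
      have htℓ : s * ℓ ≤ ℓ := mul_le_of_le_one_left hℓ0 hs1
      rcases le_total (s * ℓ) (tanLen x.radius) with h1 | h1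
      -- The division point is still c away from the touching point at angle u. A point with tangent
      -- length c has radius √(1 + c²) and tangent angle arctan c.
      · set c := tanLen x.radius - s * ℓ with hc
        have hc0 : 0 ≤ c := by linarith
        have hac := Real.arctan_nonneg.2 hc0
        refine ⟨⟨u - Real.arctan c, √(1 + c ^ 2), one_le_sqrt_one_add_sq c⟩, ?_⟩
        simp only
        rw [logMap_of_right (one_le_sqrt_one_add_sq c) hy
            (by rw [tanAng_sqrt hc0]; linarith),
          logMap_of_visible (by rw [tanAng_sqrt hc0, abs_le]; constructor <;> linarith),
          polar_eq_right hx, polar_eq_right (one_le_sqrt_one_add_sq c), tanAng_sqrt hc0,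
          tanLen_sqrt hc0, sub_add_cancel, ← hu]
        have e : c - Real.arctan c - (u - Real.arctan c) + involute y.angle y.radius =
            ℓ - s * ℓ := by unfold involute; linarith
        rw [e, hc]
        push_cast; ring
      · rcases le_total (s * ℓ) (ℓ - tanLen y.radius) with h2 | h2
        · set τ := u + (s * ℓ - tanLen x.radius) with hτ
          refine ⟨spiral τ, ?_⟩
          simp only [spiral]
          rw [logMap_of_right le_rfl hy (by rw [tanAng_one]; linarith),
            logMap_of_left le_rfl hx (by rw [tanAng_one]; linarith), tanAng_one, tanLen_one]
          have e1 : 0 - 0 + τ + involute (-x.angle) x.radius = s * ℓ := by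
            unfold involute; linarith
          have e2 : 0 - 0 - τ + involute y.angle y.radius = ℓ - s * ℓ := by
            unfold involute; linarith
          rw [e1, e2, add_zero, sub_zero]
          push_cast; ring
        · set c := tanLen y.radius - (ℓ - s * ℓ) with hc
          have hc0 : 0 ≤ c := by linarith
          have hac := Real.arctan_nonneg.2 hc0
          refine ⟨⟨v + Real.arctan c, √(1 + c ^ 2), one_le_sqrt_one_add_sq c⟩, ?_⟩
          simp only
          rw [logMap_of_left (one_le_sqrt_one_add_sq c) hx
              (by rw [tanAng_sqrt hc0]; linarith),
            logMap_of_visible (θ' := y.angle)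
              (by rw [tanAng_sqrt hc0, abs_le]; constructor <;> linarith),
            polar_eq_left hy, polar_eq_left (one_le_sqrt_one_add_sq c), tanAng_sqrt hc0,
            tanLen_sqrt hc0, add_sub_cancel_right, ← hv']
          have e : c - Real.arctan c + (v + Real.arctan c) + involute (-x.angle) x.radius =
              s * ℓ := by unfold involute; linarith
          rw [e, hc]
          push_cast; ring
  intro x y
  rcases le_total x.angle y.angle with h | h
  · exact main x y h
  · exact (main y x h).symm

/-! ### The spiral as a geodesic -/

theorem isGeodesicOn_spiral : IsGeodesicOn spiral univ := by
  have main : ∀ s t : ℝ, s ≤ t → dist (spiral s) (spiral t) = t - s := by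
    intro s t hst
    rw [dist_of_right (by simp [spiral, tanAng_one, hst])]
    simp [spiral, tanAng_one, tanLen_one, involute]; ring
  intro s _ t _
  rcases le_total s t with h | h
  · rw [main s t h, abs_sub_comm, abs_of_nonneg (by linarith)]
  · rw [dist_comm, main t s h, abs_of_nonneg (by linarith)]

/-- Tangent angles are less than π/2, so the geodesic from p has reached the circle before the angle
t and leaves it only after t. -/
theorem liesBetween_spiral {p q : ParkingLot} {t : ℝ} (hp : p.angle + Real.pi / 2 ≤ t)
    (hq : t + Real.pi / 2 ≤ q.angle) : LiesBetween p (spiral t) q := by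
  have h1 := tanAng_lt p.one_le_radius
  have h2 := tanAng_lt q.one_le_radius
  have e1 : (spiral t).angle = t := rfl
  have e2 : (spiral t).radius = 1 := rfl
  unfold LiesBetween
  rw [dist_of_right (q := q) (p := p) (by linarith),
    dist_of_right (q := spiral t) (p := p) (by rw [e1, e2, tanAng_one]; linarith),
    dist_of_right (q := q) (p := spiral t) (by rw [e1, e2, tanAng_one]; linarith),
    e1, e2, tanAng_one, tanLen_one, involute, involute, tanAng_one, tanLen_one]
  ring

theorem abs_radius_sub_le_dist (p q : ParkingLot) : |p.radius - q.radius| ≤ dist p q := by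
  refine le_trans ?_ (norm_cover_sub_le_dist p q)
  rw [← polar_eq_cover, ← polar_eq_cover]
  nth_rewrite 1 [← norm_polar p.one_le_radius p.angle, ← norm_polar q.one_le_radius q.angle]
  exact abs_norm_sub_norm_le _ _

end ParkingLot

namespace ParkingLot

/-! ### Logarithmic shears -/

/-- The logarithmic shear of the plane. -/
def planeShear (c : ℝ) (w : ℂ) : ℂ := w * Complex.exp ((c * Real.log ‖w‖ : ℝ) * Complex.I)

/-- The two angles of rotation differ by |c| (log |w| - log |w'|). If |w'| is the smaller norm, this
is at most |c| (|w| - |w'|) / |w'|, and the rotation moves w' by at most |w'| times that. -/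
theorem norm_planeShear_sub_le (c : ℝ) {w w' : ℂ} (hw : 1 ≤ ‖w‖) (hw' : 1 ≤ ‖w'‖) :
    ‖planeShear c w - planeShear c w'‖ ≤ (1 + |c|) * ‖w - w'‖ := by
  wlog h : ‖w'‖ ≤ ‖w‖ generalizing w w'
  · rw [norm_sub_rev, norm_sub_rev w]
    exact this hw' hw (by linarith)
  have e : planeShear c w - planeShear c w' =
      (w - w') * Complex.exp ((c * Real.log ‖w‖ : ℝ) * Complex.I) +
        w' * (Complex.exp ((c * Real.log ‖w'‖ : ℝ) * Complex.I) *
          (Complex.exp (Complex.I * (c * Real.log ‖w‖ - c * Real.log ‖w'‖ : ℝ)) - 1)) := by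
    rw [mul_sub (Complex.exp _), ← Complex.exp_add, planeShear, planeShear]
    have : ((c * Real.log ‖w'‖ : ℝ) : ℂ) * Complex.I +
        Complex.I * ((c * Real.log ‖w‖ - c * Real.log ‖w'‖ : ℝ) : ℂ) =
        (c * Real.log ‖w‖ : ℝ) * Complex.I := by push_cast; ring
    rw [this]; ring
  rw [e]
  refine (norm_add_le _ _).trans ?_
  rw [norm_mul, norm_mul, norm_mul, Complex.norm_exp_ofReal_mul_I, Complex.norm_exp_ofReal_mul_I,
    mul_one, one_mul, add_mul, one_mul]
  refine add_le_add_right ?_ _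
  have h1 := Real.norm_exp_I_mul_ofReal_sub_one_le (x := c * Real.log ‖w‖ - c * Real.log ‖w'‖)
  have h0 : 0 < ‖w'‖ := by linarith
  have h2 : Real.log ‖w‖ - Real.log ‖w'‖ ≤ (‖w‖ - ‖w'‖) / ‖w'‖ := by
    rw [← Real.log_div (by linarith) h0.ne']
    refine (Real.log_le_sub_one_of_pos (by positivity)).trans (le_of_eq ?_)
    field_simp
  have h3 : 0 ≤ Real.log ‖w‖ - Real.log ‖w'‖ := sub_nonneg.2 (Real.log_le_log h0 h)
  rw [← mul_sub, Real.norm_eq_abs, abs_mul, abs_of_nonneg h3] at h1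
  calc _ ≤ ‖w'‖ * (|c| * (Real.log ‖w‖ - Real.log ‖w'‖)) := by
        rw [← mul_sub]; gcongr
    _ ≤ ‖w'‖ * (|c| * ((‖w‖ - ‖w'‖) / ‖w'‖)) := by gcongr
    _ = |c| * (‖w‖ - ‖w'‖) := by field_simp
    _ ≤ |c| * ‖w - w'‖ := by gcongr; exact norm_sub_norm_le w w'

/-- The logarithmic shear of the parking lot. -/
def shear (c : ℝ) (p : ParkingLot) : ParkingLot :=
  ⟨p.angle + c * Real.log p.radius, p.radius, p.one_le_radius⟩

theorem shear_shear_neg (c : ℝ) (p : ParkingLot) : shear c (shear (-c) p) = p := by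
  ext <;> simp [shear]

/-- The logarithmic shear in coordinates. -/
def coordShear (c : ℝ) (q : Coord) : Coord := (q.1 + c * Real.log q.2, q.2)

theorem continuous_coordShear (c : ℝ) : Continuous (coordShear c) := by
  refine Continuous.prodMk (continuous_fst.add (continuous_const.mul ?_)) continuous_snd
  refine Continuous.log (by fun_prop) fun q => ?_
  have : (1 : ℝ) ≤ q.2 := q.2.2
  positivity

theorem cover_coordShear (c : ℝ) (q : Coord) :
    cover (coordShear c q) = planeShear c (cover q) := by
  have h : ‖cover q‖ = q.2 := norm_polar q.2.2 q.1
  rw [planeShear, h, cover, cover, coordShear, mul_assoc, ← Complex.exp_add]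
  congr 2; push_cast; ring

theorem dist_shear_le (c : ℝ) (p q : ParkingLot) :
    dist (shear c p) (shear c q) ≤ (1 + |c|) * dist p q := by
  have hK : 0 ≤ 1 + |c| := by positivity
  have hlip : LipschitzOnWith (Real.toNNReal (1 + |c|)) (planeShear c) {w | 1 ≤ ‖w‖} := by
    refine LipschitzOnWith.of_dist_le_mul fun w hw w' hw' => ?_
    rw [Real.coe_toNNReal _ hK, dist_eq_norm, dist_eq_norm]
    exact norm_planeShear_sub_le c hw hw'
  have h : lengthDist (shear c p).coord (shear c q).coord ≤
      (Real.toNNReal (1 + |c|) : ENNReal) * lengthDist p.coord q.coord := by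
    rw [lengthDist, lengthDist, ENNReal.mul_iInf_of_ne (by
      simp only [ne_eq, ENNReal.coe_eq_zero, Real.toNNReal_eq_zero, not_le]; positivity)
      ENNReal.coe_ne_top]
    refine le_iInf fun γ => (iInf_le _ (γ.map (continuous_coordShear c))).trans ?_
    have h1 := hlip.comp_eVariationOn_le (g := fun t => cover (γ t)) (s := univ)
      (fun t _ => (γ t).2.2.trans (norm_polar (γ t).2.2 (γ t).1).ge)
    refine le_trans (le_of_eq ?_) h1
    unfold pathLength
    congr 1
    funext t
    exact cover_coordShear c (γ t)
  have h2 := ENNReal.toReal_mono (ENNReal.mul_ne_top ENNReal.coe_ne_top (lengthDist_ne_top _ _)) h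
  rwa [ENNReal.toReal_mul, ENNReal.coe_toReal, Real.coe_toNNReal _ hK] at h2

end ParkingLot

/-! ### The quasi-isometry between W and Z -/

open ParkingLot in
theorem shear_pointW (i : ℕ) : shear (-(Real.log 2)⁻¹) (pointW i) = pointZ i := by
  have : Real.log 2 ≠ 0 := (Real.log_pos one_lt_two).ne'
  ext
  · simp [shear, pointW, pointZ]
    field_simp; ring
  · simp [shear, pointW, pointZ]

open ParkingLot in
theorem quasiIsometric_spaceW_spaceZ : QuasiIsometric SpaceW SpaceZ := by
  set c : ℝ := (Real.log 2)⁻¹ with hc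
  set K : ℝ := 1 + |c| with hK
  have hK1 : 1 ≤ K := by linarith [abs_nonneg c]
  set φ : ParkingLot → ParkingLot := shear (-c) with hφ
  have hup : ∀ x y, dist (φ x) (φ y) ≤ K * dist x y := fun x y => by
    have := dist_shear_le (-c) x y
    rwa [abs_neg] at this
  have hlow : ∀ x y, K⁻¹ * dist x y ≤ dist (φ x) (φ y) := fun x y => by
    rw [inv_mul_le_iff₀ (by linarith)]
    have := dist_shear_le c (φ x) (φ y)
    rwa [hφ, shear_shear_neg, shear_shear_neg] at this
  have hp : ∀ i, φ (pointW i) = pointZ i := shear_pointW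
  have hK' : K⁻¹ ≤ 1 := inv_le_one_of_one_le₀ hK1
  have hKs : ∀ s : ℝ, 0 ≤ s → K⁻¹ * s ≤ s := fun s hs => mul_le_of_le_one_left hs hK'
  have hsK : ∀ s : ℝ, 0 ≤ s → s ≤ K * s := fun s hs => le_mul_of_one_le_left hs hK1
  let f : SpaceW → SpaceZ := fun x => match x with
    | RayGluing.base x => RayGluing.base (φ x)
    | RayGluing.ray i s hs => RayGluing.ray i s hs
  -- No additive constant is needed: the shear and its inverse are K-Lipschitz, and the map is the
  -- identity on the ray parameters.
  refine ⟨f, K, 0, hK1, le_rfl, ?_, ?_⟩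
  · intro x y
    rw [sub_zero, add_zero]
    rcases x with x | ⟨i, s, hs⟩ <;> rcases y with y | ⟨j, t, ht⟩
    · exact ⟨hlow x y, hup x y⟩
    · change K⁻¹ * (dist x (pointW j) + t) ≤ dist (φ x) (pointZ j) + t ∧
        dist (φ x) (pointZ j) + t ≤ K * (dist x (pointW j) + t)
      have h1 := hlow x (pointW j)
      have h2 := hup x (pointW j)
      rw [hp] at h1 h2
      constructor <;> rw [mul_add] <;> linarith [hKs t ht.le, hsK t ht.le]
    · change K⁻¹ * (s + dist (pointW i) y) ≤ s + dist (pointZ i) (φ y) ∧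
        s + dist (pointZ i) (φ y) ≤ K * (s + dist (pointW i) y)
      have h1 := hlow (pointW i) y
      have h2 := hup (pointW i) y
      rw [hp] at h1 h2
      constructor <;> rw [mul_add] <;> linarith [hKs s hs.le, hsK s hs.le]
    · change K⁻¹ * (if i = j then |s - t| else s + dist (pointW i) (pointW j) + t) ≤
          (if i = j then |s - t| else s + dist (pointZ i) (pointZ j) + t) ∧
        (if i = j then |s - t| else s + dist (pointZ i) (pointZ j) + t) ≤
          K * (if i = j then |s - t| else s + dist (pointW i) (pointW j) + t)
      split_ifs
      · exact ⟨hKs _ (abs_nonneg _), hsK _ (abs_nonneg _)⟩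
      · have h1 := hlow (pointW i) (pointW j)
        have h2 := hup (pointW i) (pointW j)
        rw [hp, hp] at h1 h2
        constructor <;> rw [mul_add, mul_add] <;>
          linarith [hKs s hs.le, hsK s hs.le, hKs t ht.le, hsK t ht.le]
  · intro y
    rcases y with y | ⟨j, t, ht⟩
    · refine ⟨RayGluing.base (shear c y), ?_⟩
      change dist (shear (-c) (shear c y)) y ≤ 0
      have := shear_shear_neg (-c) y
      rw [neg_neg] at this
      rw [this, dist_self]
    · exact ⟨RayGluing.ray j t ht, (dist_self _).le⟩

/-! ### Projection to a geodesic -/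

section Projection

variable {X : Type*} [MetricSpace X]

/-- The parameter of the closest point projection of `x` to the geodesic `α : I → X`. -/
def projParam (α : ℝ → X) (I : Set ℝ) (x : X) : ℝ :=
  Classical.epsilon fun s => s ∈ I ∧ ∀ t ∈ I, dist x (α s) ≤ dist x (α t)

theorem IsGeodesicOn.continuousOn {α : ℝ → X} {I : Set ℝ} (hα : IsGeodesicOn α I) :
    ContinuousOn α I := by
  refine LipschitzOnWith.continuousOn (K := 1) (LipschitzOnWith.of_dist_le_mul fun s hs t ht => ?_)
  rw [hα s hs t ht, NNReal.coe_one, one_mul, Real.dist_eq]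

theorem IsGeodesicOn.liesBetween {α : ℝ → X} {I : Set ℝ} (hα : IsGeodesicOn α I) {s u t : ℝ}
    (hs : s ∈ I) (hu : u ∈ I) (ht : t ∈ I) (hsu : s ≤ u) (hut : u ≤ t) :
    LiesBetween (α s) (α u) (α t) := by
  unfold LiesBetween
  rw [hα s hs u hu, hα u hu t ht, hα s hs t ht, abs_sub_comm s u, abs_sub_comm u t,
    abs_sub_comm s t, abs_of_nonneg (by linarith), abs_of_nonneg (by linarith),
    abs_of_nonneg (by linarith)]
  ring

theorem IsGeodesicOn.exists_isMin {α : ℝ → X} {I : Set ℝ} (hα : IsGeodesicOn α I)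
    (hI : IsClosed I) (hne : I.Nonempty) (x : X) :
    ∃ s ∈ I, ∀ t ∈ I, dist x (α s) ≤ dist x (α t) := by
  obtain ⟨t₀, ht₀⟩ := hne
  set d := dist x (α t₀)
  have hd : 0 ≤ d := dist_nonneg
  -- Points of the geodesic with parameter farther than 2d from t₀ are farther than d from x, so a
  -- minimum over this compact piece is a minimum over I.
  have hc : IsCompact (I ∩ Icc (t₀ - 2 * d) (t₀ + 2 * d)) := isCompact_Icc.inter_left hI
  obtain ⟨s, hs, hmin⟩ := hc.exists_isMinOn ⟨t₀, ht₀, by linarith, by linarith⟩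
    (f := fun t => dist x (α t))
    ((continuous_const.dist continuous_id).comp_continuousOn (hα.continuousOn.mono inter_subset_left))
  refine ⟨s, hs.1, fun t ht => ?_⟩
  by_cases h : t ∈ Icc (t₀ - 2 * d) (t₀ + 2 * d)
  · exact hmin ⟨ht, h⟩
  · have h1 : dist x (α s) ≤ d := hmin ⟨ht₀, by linarith, by linarith⟩
    have h2 : 2 * d < |t - t₀| := by
      rw [lt_abs]
      by_contra hcon
      push Not at hcon
      exact h ⟨by linarith, by linarith⟩
    have h3 := dist_triangle_left (α t) (α t₀) x
    rw [hα t ht t₀ ht₀] at h3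
    linarith

theorem isMin_of_liesBetween {α : ℝ → X} {I : Set ℝ} {x z : X} {s : ℝ}
    (h : ∀ t ∈ I, dist x (α s) ≤ dist x (α t)) (hz : LiesBetween x z (α s)) :
    ∀ t ∈ I, dist z (α s) ≤ dist z (α t) := by
  intro t ht
  unfold LiesBetween at hz
  linarith [h t ht, dist_triangle x z (α t)]

namespace HasCNPoints

variable (hX : HasCNPoints X)
include hX

theorem isPreconnected_segment (x y : X) : IsPreconnected {z | LiesBetween x z y} := by
  obtain ⟨γ, h0, h1, hγ⟩ := hX.isGeodesicSpace x y
  have hm0 : (0 : ℝ) ∈ Icc 0 (dist x y) := ⟨le_rfl, dist_nonneg⟩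
  have hm1 : dist x y ∈ Icc 0 (dist x y) := ⟨dist_nonneg, le_rfl⟩
  have hb : ∀ t ∈ Icc 0 (dist x y), LiesBetween x (γ t) y := fun t ht => by
    have := hγ.liesBetween hm0 ht hm1 ht.1 ht.2
    rwa [h0, h1] at this
  have e : {z | LiesBetween x z y} = γ '' Icc 0 (dist x y) := by
    apply Subset.antisymm
    · intro z hz
      have hz' : dist x z + dist z y = dist x y := hz
      have hmem : dist x z ∈ Icc 0 (dist x y) :=
        ⟨dist_nonneg, by linarith [dist_nonneg (x := z) (y := y)]⟩
      refine ⟨dist x z, hmem, hX.eq_of_liesBetween (hb _ hmem) hz ?_⟩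
      have h := hγ _ hm0 _ hmem
      rw [h0, zero_sub, abs_neg, abs_of_nonneg dist_nonneg] at h
      exact h
    · rintro _ ⟨t, ht, rfl⟩
      exact hb t ht
  rw [e]
  exact isPreconnected_Icc.image _ hγ.continuousOn

section

variable {α : ℝ → X} {I : Set ℝ} (hα : IsGeodesicOn α I)
include hα

/-- Pythagoras as an inequality: the angle at a closest point is at least π/2. It follows from
Stewart's inequality at a nearby point u of the geodesic, which is not closer to x than α s, by
letting u approach α s. -/
theorem sq_dist_add_sq_le (hI : I.OrdConnected) {x : X} {s t : ℝ} (hs : s ∈ I) (ht : t ∈ I)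
    (hmin : ∀ t ∈ I, dist x (α s) ≤ dist x (α t)) :
    dist x (α s) ^ 2 + (s - t) ^ 2 ≤ dist x (α t) ^ 2 := by
  rcases eq_or_ne s t with rfl | hst
  · simp
  have hℓ : 0 < |s - t| := abs_pos.2 (sub_ne_zero.2 hst)
  have key : ∀ ε ∈ Ioo (0 : ℝ) 1,
      dist x (α s) ^ 2 + (1 - ε) * (s - t) ^ 2 ≤ dist x (α t) ^ 2 := by
    intro ε hε
    set u := s + ε * (t - s) with hu
    have hmem : u ∈ I := by
      rcases le_total s t with h | h
      · exact hI.out hs ht ⟨by nlinarith [hε.1], by nlinarith [hε.2]⟩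
      · exact hI.out ht hs ⟨by nlinarith [hε.2], by nlinarith [hε.1]⟩
    have e1 : dist (α s) (α u) = ε * |s - t| := by
      rw [hα s hs u hmem, hu, show s - (s + ε * (t - s)) = ε * (s - t) by ring, abs_mul,
        abs_of_pos hε.1]
    have e2 : dist (α u) (α t) = (1 - ε) * |s - t| := by
      rw [hα u hmem t ht, hu, show s + ε * (t - s) - t = (1 - ε) * (s - t) by ring, abs_mul,
        abs_of_pos (by linarith [hε.2])]
    have e3 := hα s hs t ht
    have h1 := hX.stewart (x := α s) (m := α u) (y := α t)
      (by unfold LiesBetween; rw [e1, e2, e3]; ring) x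
    rw [e1, e2, e3] at h1
    have h2 : dist x (α s) ^ 2 ≤ dist x (α u) ^ 2 :=
      pow_le_pow_left₀ dist_nonneg (hmin u hmem) 2
    have h3 : |s - t| * ε * (dist x (α s) ^ 2 + (1 - ε) * |s - t| ^ 2) ≤
        |s - t| * ε * dist x (α t) ^ 2 := by
      have := mul_le_mul_of_nonneg_left h2 hℓ.le
      nlinarith
    have := le_of_mul_le_mul_left h3 (mul_pos hℓ hε.1)
    rwa [sq_abs] at this
  by_contra hcon
  push Not at hcon
  have hB : 0 < (s - t) ^ 2 := by rw [← sq_abs]; positivity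
  have hle : dist x (α s) ^ 2 ≤ dist x (α t) ^ 2 := pow_le_pow_left₀ dist_nonneg (hmin t ht) 2
  set g := dist x (α s) ^ 2 + (s - t) ^ 2 - dist x (α t) ^ 2 with hg
  -- If the inequality fails by g, then for this ε the loss ε (s - t)² is only g / 2, and the
  -- approximate inequality is already violated.
  have hε : g / (2 * (s - t) ^ 2) ∈ Ioo (0 : ℝ) 1 := by
    constructor
    · apply div_pos <;> linarith
    · rw [div_lt_one (by positivity)]; linarith
  have h := key _ hε
  have e : (1 - g / (2 * (s - t) ^ 2)) * (s - t) ^ 2 = (s - t) ^ 2 - g / 2 := by field_simp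
  rw [e] at h
  linarith

/-- The inequality of Pythagoras at both feet is combined with the quadrilateral inequality for x, y
and the feet. The latter comes from testing the midpoint m of x and α t at α s and at y. -/
theorem abs_sub_le_of_isMin (hI : I.OrdConnected) {x y : X} {s t : ℝ} (hs : s ∈ I) (ht : t ∈ I)
    (hx : ∀ t ∈ I, dist x (α s) ≤ dist x (α t)) (hy : ∀ s ∈ I, dist y (α t) ≤ dist y (α s)) :
    |s - t| ≤ dist x y := by
  have h1 := hX.sq_dist_add_sq_le hα hI hs ht hx
  have h2 := hX.sq_dist_add_sq_le hα hI ht hs hy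
  obtain ⟨m, hm⟩ := hX x (α t) (1 / 2) ⟨by norm_num, by norm_num⟩
  have h3 := hm (α s)
  have h4 := hm y
  have h5 := dist_triangle_right (α s) y m
  have e := hα s hs t ht
  rw [e, dist_comm (α s) x] at h3
  rw [dist_comm y x] at h4
  have h6 : dist (α s) y ^ 2 ≤ (dist (α s) m + dist y m) ^ 2 :=
    pow_le_pow_left₀ dist_nonneg h5 2
  rw [dist_comm (α s) y] at h6
  apply (sq_le_sq₀ (abs_nonneg _) dist_nonneg).1
  rw [sq_abs] at *
  nlinarith [sq_nonneg (dist (α s) m - dist y m)]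

variable (hI : IsClosed I) (hI' : I.OrdConnected) (hne : I.Nonempty)
include hI hI' hne

omit hX hI' in
theorem projParam_spec (x : X) : projParam α I x ∈ I ∧
    ∀ t ∈ I, dist x (α (projParam α I x)) ≤ dist x (α t) := by
  obtain ⟨s, hs, h⟩ := hα.exists_isMin hI hne x
  exact Classical.epsilon_spec (p := fun s => s ∈ I ∧ ∀ t ∈ I, dist x (α s) ≤ dist x (α t))
    ⟨s, hs, h⟩

theorem abs_projParam_sub_le (x y : X) : |projParam α I x - projParam α I y| ≤ dist x y := by
  obtain ⟨h1, h2⟩ := projParam_spec hα hI hne x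
  obtain ⟨h3, h4⟩ := projParam_spec hα hI hne y
  exact hX.abs_sub_le_of_isMin hα hI' h1 h3 h2 h4

theorem projParam_eq {x : X} {s : ℝ} (hs : s ∈ I)
    (h : ∀ t ∈ I, dist x (α s) ≤ dist x (α t)) : projParam α I x = s := by
  obtain ⟨h1, h2⟩ := projParam_spec hα hI hne x
  have := hX.abs_sub_le_of_isMin hα hI' h1 hs h2 h
  rw [dist_self] at this
  exact sub_eq_zero.1 (abs_nonpos_iff.1 this)

theorem mem_projPreimage {J : Set ℝ} {x : X} :
    x ∈ projPreimage α I J ↔ projParam α I x ∈ J := by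
  constructor
  · rintro ⟨s, hs, h⟩
    rw [hX.projParam_eq hα hI hI' hne hs.1 h]; exact hs.2
  · intro h
    obtain ⟨h1, h2⟩ := projParam_spec hα hI hne x
    exact ⟨_, ⟨h1, h⟩, h2⟩

theorem continuous_projParam : Continuous (projParam α I) := by
  refine LipschitzWith.continuous (K := 1) (LipschitzWith.of_dist_le_mul fun x y => ?_)
  rw [NNReal.coe_one, one_mul, Real.dist_eq]
  exact hX.abs_projParam_sub_le hα hI hI' hne x y

theorem projParam_geodesic {t : ℝ} (ht : t ∈ I) : projParam α I (α t) = t := by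
  refine hX.projParam_eq hα hI hI' hne ht fun s _ => ?_
  rw [dist_self]; exact dist_nonneg

/-- This makes curtains star-shaped: each contains the segments from its points to their feet on the
pole. -/
theorem projParam_of_liesBetween {x z : X} (h : LiesBetween x z (α (projParam α I x))) :
    projParam α I z = projParam α I x := by
  obtain ⟨h1, h2⟩ := projParam_spec hα hI hne x
  exact hX.projParam_eq hα hI hI' hne h1 (isMin_of_liesBetween h2 h)

/-- Two points are joined by going to the foot of the first, along the geodesic to the foot of the
second, and from there to the second point. -/
theorem isPreconnected_preimage_projParam {J : Set ℝ} (hJ : J.OrdConnected) :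
    IsPreconnected {x | projParam α I x ∈ J} := by
  refine isPreconnected_of_forall_pair fun x hx y hy => ?_
  set s := projParam α I x with hs
  set t := projParam α I y with ht
  obtain ⟨hsI, -⟩ := projParam_spec hα hI hne x
  obtain ⟨htI, -⟩ := projParam_spec hα hI hne y
  refine ⟨({z | LiesBetween x z (α s)} ∪ α '' uIcc s t) ∪ {z | LiesBetween y z (α t)}, ?_, ?_, ?_, ?_⟩
  · rintro z ((hz | ⟨u, hu, rfl⟩) | hz)
    · change projParam α I z ∈ J
      rw [hX.projParam_of_liesBetween hα hI hI' hne hz]; exact hx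
    · change projParam α I (α u) ∈ J
      rw [hX.projParam_geodesic hα hI hI' hne (hI'.uIcc_subset hsI htI hu)]
      exact hJ.uIcc_subset hx hy hu
    · change projParam α I z ∈ J
      rw [hX.projParam_of_liesBetween hα hI hI' hne hz]; exact hy
  · exact Or.inl (Or.inl (LiesBetween.left _ _))
  · exact Or.inr (LiesBetween.left _ _)
  · refine IsPreconnected.union (α t) (Or.inr ⟨t, right_mem_uIcc, rfl⟩) (LiesBetween.right _ _)
      (IsPreconnected.union (α s) (LiesBetween.right _ _) ⟨s, left_mem_uIcc, rfl⟩
        (hX.isPreconnected_segment _ _) ?_) (hX.isPreconnected_segment _ _)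
    exact isPreconnected_uIcc.image _ (hα.continuousOn.mono (hI'.uIcc_subset hsI htI))

end

end HasCNPoints

end Projection

namespace Curtain

/-! ### Curtains and their halfspaces -/

variable {X : Type*} [MetricSpace X]

/-- The parameter of the projection to the geodesic to which the curtain is dual. -/
def proj (h : Curtain X) : X → ℝ := projParam h.α h.I

theorem r_mem (h : Curtain X) : h.r ∈ h.I :=
  interior_subset (h.pole_subset ⟨by linarith, by linarith⟩)

theorem nonempty (h : Curtain X) : h.I.Nonempty := ⟨h.r, h.r_mem⟩

/-- The curtain dual to the reversed geodesic. -/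
def flip (h : Curtain X) : Curtain X where
  α t := h.α (-t)
  I := -h.I
  isClosed := h.isClosed.neg
  ordConnected := h.ordConnected.preimage_anti fun _ _ hab => neg_le_neg hab
  isGeodesic s hs t ht := by
    rw [h.isGeodesic _ hs _ ht, neg_sub_neg, abs_sub_comm]
  r := -h.r
  pole_subset := by
    have e : interior (-h.I) = -interior h.I := by
      have := (Homeomorph.neg ℝ).preimage_interior h.I
      exact this.symm
    rw [e]
    intro t ht
    exact h.pole_subset ⟨by linarith [ht.2], by linarith [ht.1]⟩

theorem projPreimage_neg (α : ℝ → X) (I J : Set ℝ) :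
    projPreimage (fun t => α (-t)) (-I) (-J) = projPreimage α I J := by
  ext x
  constructor
  · rintro ⟨s, ⟨hs, hs'⟩, h⟩
    exact ⟨-s, ⟨hs, hs'⟩, fun t ht => by simpa using h (-t) (by simpa using ht)⟩
  · rintro ⟨s, ⟨hs, hs'⟩, h⟩
    exact ⟨-s, ⟨by simpa using hs, by simpa using hs'⟩, fun t ht => by simpa using h (-t) ht⟩

@[simp] theorem flip_carrier (h : Curtain X) : h.flip.carrier = h.carrier := by
  rw [carrier, carrier, ← projPreimage_neg h.α h.I]
  have : Icc (h.flip.r - 1 / 2) (h.flip.r + 1 / 2) = -Icc (h.r - 1 / 2) (h.r + 1 / 2) := by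
    ext t; simp only [flip, Set.mem_neg, mem_Icc]; constructor <;> rintro ⟨_, _⟩ <;> constructor <;> linarith
  rw [this]; rfl

@[simp] theorem flip_neg (h : Curtain X) : h.flip.neg = h.pos := by
  rw [neg, pos, ← projPreimage_neg h.α h.I]
  have : Iio (h.flip.r - 1 / 2) = -Ioi (h.r + 1 / 2) := by
    ext t; simp only [flip, Set.mem_neg, mem_Iio, mem_Ioi]; constructor <;> intro <;> linarith
  rw [this]; rfl

@[simp] theorem flip_pos (h : Curtain X) : h.flip.pos = h.neg := by
  rw [neg, pos, ← projPreimage_neg h.α h.I]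
  have : Ioi (h.flip.r + 1 / 2) = -Iio (h.r - 1 / 2) := by
    ext t; simp only [flip, Set.mem_neg, mem_Iio, mem_Ioi]; constructor <;> intro <;> linarith
  rw [this]; rfl

/-- The curtain `h` precedes the disjoint curtain `k`. -/
def Below (h k : Curtain X) : Prop := h.carrier ⊆ k.neg ∧ k.carrier ⊆ h.pos

theorem Below.flip {h k : Curtain X} (hk : Below h k) : Below k.flip h.flip := by
  simpa [Below, and_comm] using hk

theorem LSeparated.flip {L : ℕ} {h k : Curtain X} (hk : LSeparated L h k) :
    LSeparated L h.flip k.flip := by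
  simpa [LSeparated] using hk

theorem LSeparated.symm {L : ℕ} {h k : Curtain X} (hk : LSeparated L h k) :
    LSeparated L k h :=
  ⟨hk.1.symm, fun n c hc h' => hk.2 n c hc fun i => ⟨(h' i).2, (h' i).1⟩⟩

section CN

variable (hX : HasCNPoints X)
include hX

theorem mem_carrier {h : Curtain X} {x : X} :
    x ∈ h.carrier ↔ h.r - 1 / 2 ≤ h.proj x ∧ h.proj x ≤ h.r + 1 / 2 :=
  hX.mem_projPreimage h.isGeodesic h.isClosed h.ordConnected h.nonempty

theorem mem_neg {h : Curtain X} {x : X} : x ∈ h.neg ↔ h.proj x < h.r - 1 / 2 :=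
  hX.mem_projPreimage h.isGeodesic h.isClosed h.ordConnected h.nonempty

theorem mem_pos {h : Curtain X} {x : X} : x ∈ h.pos ↔ h.r + 1 / 2 < h.proj x :=
  hX.mem_projPreimage h.isGeodesic h.isClosed h.ordConnected h.nonempty

theorem continuous_proj (h : Curtain X) : Continuous h.proj :=
  hX.continuous_projParam h.isGeodesic h.isClosed h.ordConnected h.nonempty

theorem abs_proj_sub_le (h : Curtain X) (x y : X) : |h.proj x - h.proj y| ≤ dist x y :=
  hX.abs_projParam_sub_le h.isGeodesic h.isClosed h.ordConnected h.nonempty x y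

theorem isPreconnected_carrier (h : Curtain X) : IsPreconnected h.carrier := by
  have := hX.isPreconnected_preimage_projParam h.isGeodesic h.isClosed h.ordConnected h.nonempty
    (ordConnected_Icc (a := h.r - 1 / 2) (b := h.r + 1 / 2))
  convert this using 1
  ext x; exact mem_carrier hX

theorem isPreconnected_compl_neg (h : Curtain X) : IsPreconnected (h.neg)ᶜ := by
  have := hX.isPreconnected_preimage_projParam h.isGeodesic h.isClosed h.ordConnected h.nonempty
    (ordConnected_Ici (a := h.r - 1 / 2))
  convert this using 1
  ext x; rw [mem_compl_iff, mem_neg hX, not_lt]; rfl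

theorem isPreconnected_compl_pos (h : Curtain X) : IsPreconnected (h.pos)ᶜ := by
  have := hX.isPreconnected_preimage_projParam h.isGeodesic h.isClosed h.ordConnected h.nonempty
    (ordConnected_Iic (a := h.r + 1 / 2))
  convert this using 1
  ext x; rw [mem_compl_iff, mem_pos hX, not_lt]; rfl

theorem carrier_nonempty (h : Curtain X) : h.carrier.Nonempty := by
  refine ⟨h.α h.r, (mem_carrier hX).2 ?_⟩
  have : h.proj (h.α h.r) = h.r :=
    hX.projParam_geodesic h.isGeodesic h.isClosed h.ordConnected h.nonempty h.r_mem
  rw [this]; constructor <;> linarith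

theorem not_mem_neg_of_mem_pos {h : Curtain X} {x : X} (hx : x ∈ h.pos) : x ∉ h.neg := by
  rw [mem_pos hX] at hx
  rw [mem_neg hX]; linarith

theorem not_mem_carrier_of_mem_pos {h : Curtain X} {x : X} (hx : x ∈ h.pos) : x ∉ h.carrier := by
  rw [mem_pos hX] at hx
  rw [mem_carrier hX]; rintro ⟨_, _⟩; linarith

theorem not_mem_carrier_of_mem_neg {h : Curtain X} {x : X} (hx : x ∈ h.neg) : x ∉ h.carrier := by
  rw [mem_neg hX] at hx
  rw [mem_carrier hX]; rintro ⟨_, _⟩; linarith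

theorem exists_proj_eq (h : Curtain X) {S : Set X} (hS : IsPreconnected S) {a b : X} (ha : a ∈ S)
    (hb : b ∈ S) {v : ℝ} (hav : h.proj a ≤ v) (hvb : v ≤ h.proj b) : ∃ c ∈ S, h.proj c = v :=
  hS.intermediate_value ha hb (continuous_proj hX h).continuousOn ⟨hav, hvb⟩

/-- A connected set that contains points on both sides of a curtain meets it. -/
theorem exists_mem_carrier (h : Curtain X) {S : Set X} (hS : IsPreconnected S) {a b : X}
    (ha : a ∈ S) (hb : b ∈ S) (han : a ∉ h.pos) (hbn : b ∉ h.neg) : ∃ c ∈ S, c ∈ h.carrier := by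
  rw [mem_pos hX, not_lt] at han
  rw [mem_neg hX, not_lt] at hbn
  rcases le_or_gt (h.r - 1 / 2) (h.proj a) with h1 | h1
  · exact ⟨a, ha, (mem_carrier hX).2 ⟨h1, han⟩⟩
  · obtain ⟨c, hc, e⟩ := exists_proj_eq hX h hS ha hb h1.le hbn
    exact ⟨c, hc, (mem_carrier hX).2 ⟨e.ge, by linarith⟩⟩

theorem subset_pos_of_disjoint {h : Curtain X} {S : Set X} (hS : IsPreconnected S)
    (hd : ∀ c ∈ S, c ∉ h.carrier) {b : X} (hb : b ∈ S) (hbn : b ∉ h.neg) : S ⊆ h.pos := by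
  intro a ha
  by_contra hcon
  obtain ⟨c, hc, hc'⟩ := exists_mem_carrier hX h hS ha hb hcon hbn
  exact hd c hc hc'

theorem subset_neg_of_disjoint {h : Curtain X} {S : Set X} (hS : IsPreconnected S)
    (hd : ∀ c ∈ S, c ∉ h.carrier) {a : X} (ha : a ∈ S) (han : a ∉ h.pos) : S ⊆ h.neg := by
  intro b hb
  by_contra hcon
  obtain ⟨c, hc, hc'⟩ := exists_mem_carrier hX h hS ha hb han hcon
  exact hd c hc hc'

theorem Below.disjoint {h k : Curtain X} (hk : Below h k) : Disjoint h.carrier k.carrier :=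
  Set.disjoint_left.2 fun _ hx => not_mem_carrier_of_mem_neg hX (hk.1 hx)

/-- The complement of `k.neg` is connected, avoids h, and contains points of k, which lie on the
positive side of h. -/
theorem Below.compl_neg_subset {h k : Curtain X} (hk : Below h k) : (k.neg)ᶜ ⊆ h.pos := by
  obtain ⟨x, hx⟩ := carrier_nonempty hX k
  refine subset_pos_of_disjoint hX (isPreconnected_compl_neg hX k) ?_ (b := x) ?_ ?_
  · intro c hc hc'
    exact hc (hk.1 hc')
  · intro hx'
    exact not_mem_carrier_of_mem_neg hX hx' hx
  · exact not_mem_neg_of_mem_pos hX (hk.2 hx)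

theorem Below.compl_pos_subset {h k : Curtain X} (hk : Below h k) : (h.pos)ᶜ ⊆ k.neg := by
  have := hk.flip.compl_neg_subset hX
  simpa using this

theorem Below.trans {h k l : Curtain X} (hk : Below h k) (kl : Below k l) : Below h l := by
  constructor
  · intro x hx
    exact kl.compl_pos_subset hX fun h' => not_mem_neg_of_mem_pos hX h' (hk.1 hx)
  · intro x hx
    exact hk.compl_neg_subset hX (not_mem_neg_of_mem_pos hX (kl.2 hx))

theorem not_below_self (h : Curtain X) : ¬ Below h h := fun hh => by
  obtain ⟨x, hx⟩ := carrier_nonempty hX h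
  exact not_mem_carrier_of_mem_neg hX (hh.1 hx) hx

/-- Each of two disjoint curtains lies in one halfspace of the other. If each were on the negative
side of the other, the complement of `h.neg` would be a connected set that joins a point of h to y
across k while avoiding k; the positive case is symmetric, with x. -/
theorem below_or_below {h k : Curtain X} (hd : Disjoint h.carrier k.carrier) {x y : X}
    (hxh : x ∈ h.neg) (hxk : x ∈ k.neg) (hyh : y ∈ h.pos) (hyk : y ∈ k.pos) :
    Below h k ∨ Below k h := by
  have hdis : ∀ {h k : Curtain X}, Disjoint h.carrier k.carrier →
      h.carrier ⊆ k.neg ∨ h.carrier ⊆ k.pos := by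
    intro h k hd
    obtain ⟨z, hz⟩ := carrier_nonempty hX h
    by_cases hz' : z ∈ k.neg
    · exact Or.inl (subset_neg_of_disjoint hX (isPreconnected_carrier hX h)
        (fun _ hc => Set.disjoint_left.1 hd hc) hz fun h' => not_mem_neg_of_mem_pos hX h' hz')
    · exact Or.inr (subset_pos_of_disjoint hX (isPreconnected_carrier hX h)
        (fun _ hc => Set.disjoint_left.1 hd hc) hz hz')
  obtain ⟨z, hz⟩ := carrier_nonempty hX h
  have hzn : z ∉ h.neg := fun h' => not_mem_carrier_of_mem_neg hX h' hz
  have hzp : z ∉ h.pos := fun h' => not_mem_carrier_of_mem_pos hX h' hz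
  rcases hdis hd with h1 | h1 <;> rcases hdis hd.symm with h2 | h2
  · exfalso
    obtain ⟨c, hc, hc'⟩ := exists_mem_carrier hX k (isPreconnected_compl_neg hX h)
      (a := z) (b := y) hzn (not_mem_neg_of_mem_pos hX hyh)
      (fun h' => not_mem_neg_of_mem_pos hX h' (h1 hz)) (not_mem_neg_of_mem_pos hX hyk)
    exact hc (h2 hc')
  · exact Or.inl ⟨h1, h2⟩
  · exact Or.inr ⟨h2, h1⟩
  · exfalso
    obtain ⟨c, hc, hc'⟩ := exists_mem_carrier hX k (isPreconnected_compl_pos hX h)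
      (a := x) (b := z) (fun h' => not_mem_neg_of_mem_pos hX h' hxh) hzp
      (fun h' => not_mem_neg_of_mem_pos hX h' hxk) (not_mem_neg_of_mem_pos hX (h1 hz))
    exact hc (h2 hc')

/-! ### Chains -/

theorem isChain_of_below {n : ℕ} {c : Fin n → Curtain X}
    (hc : ∀ i j, i < j → Below (c i) (c j)) : IsChain c := by
  constructor
  · intro i j hij
    rcases lt_or_gt_of_ne hij with h | h
    · exact (hc i j h).disjoint hX
    · exact ((hc j i h).disjoint hX).symm
  · intro i j k hij hjk
    exact Or.inl ⟨(hc i j (by rw [Fin.lt_def]; omega)).1, (hc j k (by rw [Fin.lt_def]; omega)).2⟩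

theorem LSeparated.length_le {L : ℕ} {h k : Curtain X} (hk : LSeparated L h k)
    {l : List (Curtain X)} (hl : l.Pairwise Below)
    (hm : ∀ c ∈ l, (∃ x, x ∈ c.carrier ∧ x ∈ h.carrier) ∧ ∃ x, x ∈ c.carrier ∧ x ∈ k.carrier) :
    l.length ≤ L := by
  refine hk.2 l.length l.get (isChain_of_below hX fun i j hij => ?_) fun i => hm _ (l.get_mem i)
  exact List.pairwise_iff_get.1 hl i j hij

/-- A curtain is connected, so one that meets h and l also meets k, which lies between them. Thus
separation has to be checked for neighbours only. -/
theorem LSeparated.of_below_below {L : ℕ} {h k l : Curtain X} (hs : LSeparated L h k)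
    (hk : Below h k) (kl : Below k l) : LSeparated L h l := by
  refine ⟨(hk.trans hX kl).disjoint hX, fun n c hc hm => hs.2 n c hc fun i => ⟨(hm i).1, ?_⟩⟩
  obtain ⟨x, hx, hx'⟩ := (hm i).1
  obtain ⟨y, hy, hy'⟩ := (hm i).2
  exact exists_mem_carrier hX k (isPreconnected_carrier hX (c i)) hx hy
    (fun h' => not_mem_neg_of_mem_pos hX h' (hk.1 hx')) (not_mem_neg_of_mem_pos hX (kl.2 hy'))

/-- A chain of curtains that separates two points is not longer than their distance. -/
theorem length_le_dist {y : X} {l : List (Curtain X)} (hl : l.Pairwise Below) :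
    ∀ {x : X}, (∀ h ∈ l, x ∈ h.neg ∧ y ∈ h.pos) → (l.length : ℝ) ≤ dist x y := by
  induction l with
  | nil => intro x _; simp
  | cons h l ih =>
    intro x hx
    rw [List.pairwise_cons] at hl
    have h1 := hx h List.mem_cons_self
    rw [mem_neg hX, mem_pos hX] at h1
    -- The point w is where the geodesic reaches the far wall of h. Up to there the projection has
    -- increased by more than the width 1 of h, and the later curtains still separate w from y.
    obtain ⟨w, hw, e⟩ := exists_proj_eq hX h (hX.isPreconnected_segment x y)
      (LiesBetween.left x y) (LiesBetween.right x y) (v := h.r + 1 / 2) (by linarith) h1.2.le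
    have hwh : w ∈ h.carrier := (mem_carrier hX).2 ⟨by linarith, e.le⟩
    have h2 := ih hl.2 (x := w) fun k hk => ⟨(hl.1 k hk).1 hwh, (hx k (List.mem_cons_of_mem _ hk)).2⟩
    have h3 := abs_proj_sub_le hX h w x
    rw [dist_comm w x] at h3
    have h4 := le_abs_self (h.proj w - h.proj x)
    have h5 : dist x w + dist w y = dist x y := hw
    rw [List.length_cons]; push_cast
    linarith

end CN

/-- An `L`-chain that separates `x` from `y`, listed in the order from `x` to `y`. -/
structure IsOrderedLChain (L : ℕ) (x y : X) (l : List (Curtain X)) : Prop where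
  pairwise : l.Pairwise fun h k => Below h k ∧ LSeparated L h k
  separates : ∀ h ∈ l, x ∈ h.neg ∧ y ∈ h.pos

namespace IsOrderedLChain

variable {L : ℕ} {x y : X} {l : List (Curtain X)}

theorem below (h : IsOrderedLChain L x y l) : l.Pairwise Below :=
  h.pairwise.imp fun h => h.1

theorem sublist (h : IsOrderedLChain L x y l) {l' : List (Curtain X)} (hl : l'.Sublist l) :
    IsOrderedLChain L x y l' :=
  ⟨h.pairwise.sublist hl, fun k hk => h.separates k (hl.subset hk)⟩

theorem flip (h : IsOrderedLChain L x y l) :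
    IsOrderedLChain L y x (l.reverse.map Curtain.flip) := by
  constructor
  · rw [List.pairwise_map, List.pairwise_reverse]
    exact h.pairwise.imp fun hk => ⟨hk.1.flip, hk.2.symm.flip⟩
  · intro k hk
    rw [List.mem_map] at hk
    obtain ⟨k', hk', rfl⟩ := hk
    have := h.separates k' (List.mem_reverse.1 hk')
    simpa [and_comm] using this

theorem isLChain (hX : HasCNPoints X) (h : IsOrderedLChain L x y l) :
    IsLChain L l.get ∧ ∀ i, (l.get i).Separates {x} {y} := by
  have hp := List.pairwise_iff_get.1 h.pairwise
  refine ⟨⟨isChain_of_below hX fun i j hij => (hp i j hij).1, fun i j hij => ?_⟩, fun i => ?_⟩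
  · rcases lt_or_gt_of_ne hij with h' | h'
    · exact (hp i j h').2
    · exact (hp j i h').2.symm
  · have := h.separates _ (l.get_mem i)
    exact Or.inl ⟨by simpa using this.1, by simpa using this.2⟩

end IsOrderedLChain

/-- After orienting every curtain so that x is on its negative side, disjoint members are
comparable, and sorting puts them in order. Of the chain condition only disjointness is needed. -/
theorem exists_isOrderedLChain (hX : HasCNPoints X) {L n : ℕ} {x y : X} {c : Fin n → Curtain X}
    (hc : IsLChain L c) (hs : ∀ i, (c i).Separates {x} {y}) :
    ∃ l, IsOrderedLChain L x y l ∧ l.length = n := by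
  classical
  have hor : ∀ i, ∃ k : Curtain X, k.carrier = (c i).carrier ∧ x ∈ k.neg ∧ y ∈ k.pos := by
    intro i
    rcases hs i with ⟨h1, h2⟩ | ⟨h1, h2⟩
    · exact ⟨c i, rfl, by simpa using h1, by simpa using h2⟩
    · exact ⟨(c i).flip, by simp, by simpa using h1, by simpa using h2⟩
  choose k hk hx hy using hor
  have htot : ∀ i j, i ≠ j → Below (k i) (k j) ∨ Below (k j) (k i) := fun i j hij =>
    below_or_below hX (by rw [hk, hk]; exact hc.1.1 i j hij) (hx i) (hx j) (hy i) (hy j)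
  -- The number of predecessors is strictly monotone for the strict order `Below`, so sorting by it
  -- gives an increasing list.
  let rank : Fin n → ℕ := fun i => (Finset.univ.filter fun j => Below (k j) (k i)).card
  have hrank : ∀ i j, Below (k i) (k j) → rank i < rank j := by
    intro i j hij
    refine Finset.card_lt_card ⟨fun m hm => ?_, fun hsub => ?_⟩
    · simp only [Finset.mem_filter_univ] at hm ⊢
      exact hm.trans hX hij
    · have : i ∈ Finset.univ.filter fun m => Below (k m) (k i) := hsub (by simpa using hij)
      simp only [Finset.mem_filter_univ] at this
      exact not_below_self hX _ this
  let σ := Tuple.sort rank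
  have hσ : Monotone (rank ∘ σ) := Tuple.monotone_sort rank
  refine ⟨List.ofFn fun i => k (σ i), ⟨?_, ?_⟩, by simp⟩
  · rw [List.pairwise_ofFn]
    intro i j hij
    have hne : σ i ≠ σ j := fun h => hij.ne (σ.injective h)
    refine ⟨(htot _ _ hne).resolve_right fun h => ?_, ?_⟩
    · exact absurd (hrank _ _ h) (not_lt.2 (hσ hij.le))
    · have := hc.2 _ _ hne
      rwa [LSeparated, ← hk, ← hk] at this
  · intro h hh
    obtain ⟨i, rfl⟩ := List.mem_ofFn.1 hh
    exact ⟨hx _, hy _⟩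

end Curtain

/-! ### The metrics `d_L` -/

section DistL

open Curtain

variable {X : Type*} [MetricSpace X]

theorem curtainDistL_self (L : ℕ) (x : X) : curtainDistL L x x = 0 := by simp [curtainDistL]

theorem curtainDistL_nonneg (L : ℕ) (x y : X) : 0 ≤ curtainDistL L x y := by
  unfold curtainDistL; split_ifs <;> positivity

theorem one_le_curtainDistL (L : ℕ) {x y : X} (hxy : x ≠ y) : 1 ≤ curtainDistL L x y := by
  rw [curtainDistL, if_neg hxy]
  have := Nat.cast_nonneg (α := ℝ) (sSup {n : ℕ | ∃ c : Fin n → Curtain X, Curtain.IsLChain L c ∧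
      ∀ i, (c i).Separates {x} {y}})
  linarith

theorem curtainDistL_comm (L : ℕ) (x y : X) : curtainDistL L x y = curtainDistL L y x := by
  have h : ∀ c : Curtain X, c.Separates {x} {y} ↔ c.Separates {y} {x} := fun c => by
    unfold Separates; tauto
  by_cases hxy : x = y
  · rw [hxy]
  · simp only [curtainDistL, if_neg hxy, if_neg (Ne.symm hxy), h]

variable (hX : HasCNPoints X)
include hX

theorem bddAbove_lChain (L : ℕ) (x y : X) : BddAbove {n : ℕ | ∃ c : Fin n → Curtain X,
    IsLChain L c ∧ ∀ i, (c i).Separates {x} {y}} := by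
  refine ⟨⌊dist x y⌋₊, ?_⟩
  rintro n ⟨c, hc, hs⟩
  obtain ⟨l, hl, rfl⟩ := exists_isOrderedLChain hX hc hs
  exact Nat.le_floor (length_le_dist hX hl.below hl.separates)

theorem Curtain.IsOrderedLChain.length_add_one_le {L : ℕ} {x y : X} {l : List (Curtain X)}
    (hl : IsOrderedLChain L x y l) (hxy : x ≠ y) : (l.length : ℝ) + 1 ≤ curtainDistL L x y := by
  rw [curtainDistL, if_neg hxy, add_comm]
  gcongr
  exact le_csSup (bddAbove_lChain hX L x y) ⟨l.get, hl.isLChain hX⟩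

theorem exists_length_add_one_eq (L : ℕ) {x y : X} (hxy : x ≠ y) :
    ∃ l : List (Curtain X), IsOrderedLChain L x y l ∧ curtainDistL L x y = l.length + 1 := by
  obtain ⟨c, hc, hs⟩ := Nat.sSup_mem (s := {n : ℕ | ∃ c : Fin n → Curtain X,
    IsLChain L c ∧ ∀ i, (c i).Separates {x} {y}})
    ⟨0, Fin.elim0, ⟨⟨fun i => i.elim0, fun i => i.elim0⟩, fun i => i.elim0⟩, fun i => i.elim0⟩
    (bddAbove_lChain hX L x y)
  obtain ⟨l, hl, hn⟩ := exists_isOrderedLChain hX hc hs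
  refine ⟨l, hl, ?_⟩
  rw [hn, curtainDistL, if_neg hxy, add_comm]

theorem curtainDistL_le (L : ℕ) (x y : X) : curtainDistL L x y ≤ dist x y + 1 := by
  by_cases hxy : x = y
  · rw [hxy, curtainDistL_self]; positivity
  · obtain ⟨l, hl, e⟩ := exists_length_add_one_eq hX L hxy
    rw [e]
    linarith [length_le_dist hX hl.below hl.separates]

/-- The members of a chain from x to z have y on their positive side, on their negative side, or in
them; the first two kinds form chains from x to y and from y to z. At most one member contains y,
and it is paid for by the extra 1 on the right-hand side. -/
theorem curtainDistL_triangle (L : ℕ) (x y z : X) :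
    curtainDistL L x z ≤ curtainDistL L x y + curtainDistL L y z := by
  classical
  by_cases hxz : x = z
  · rw [hxz, curtainDistL_self]
    exact add_nonneg (curtainDistL_nonneg _ _ _) (curtainDistL_nonneg _ _ _)
  by_cases hxy : x = y
  · rw [hxy, curtainDistL_self, zero_add]
  by_cases hyz : y = z
  · rw [hyz, curtainDistL_self, add_zero]
  obtain ⟨l, hl, e⟩ := exists_length_add_one_eq hX L hxz
  have h1 : IsOrderedLChain L x y (l.filter fun h => y ∈ h.pos) :=
    ⟨hl.pairwise.sublist List.filter_sublist, fun h hh => by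
      rw [List.mem_filter] at hh
      exact ⟨(hl.separates h hh.1).1, by simpa using hh.2⟩⟩
  have h2 : IsOrderedLChain L y z (l.filter fun h => y ∈ h.neg) :=
    ⟨hl.pairwise.sublist List.filter_sublist, fun h hh => by
      rw [List.mem_filter] at hh
      exact ⟨by simpa using hh.2, (hl.separates h hh.1).2⟩⟩
  have h3 := h1.length_add_one_le hX hxy
  have h4 := h2.length_add_one_le hX hyz
  have h5 : (l.filter fun h => y ∈ h.carrier).length ≤ 1 := by
    have hp := hl.below.sublist (List.filter_sublist (p := fun h => decide (y ∈ h.carrier)))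
    have hm : ∀ h ∈ l.filter fun h => y ∈ h.carrier, y ∈ h.carrier := fun h hh => by
      simpa using (List.mem_filter.1 hh).2
    rcases hl' : l.filter (fun h => decide (y ∈ h.carrier)) with _ | ⟨a, _ | ⟨b, l'⟩⟩
    · rw [hl']; simp
    · rw [hl']; simp
    · rw [hl'] at hp hm
      have hab := (List.pairwise_cons.1 hp).1 b (by simp)
      exact absurd (hm b (by simp)) (not_mem_carrier_of_mem_neg hX (hab.1 (hm a (by simp))))
  have h6 : l.length ≤ (l.filter fun h => y ∈ h.pos).length +
      (l.filter fun h => y ∈ h.neg).length + (l.filter fun h => y ∈ h.carrier).length := by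
    clear h1 h2 h3 h4 h5 e hl
    induction l with
    | nil => simp
    | cons h l ih =>
      have : y ∈ h.pos ∨ y ∈ h.neg ∨ y ∈ h.carrier := by
        rw [mem_pos hX, mem_neg hX, mem_carrier hX]
        rcases lt_or_ge (h.r + 1 / 2) (h.proj y) with h1 | h1
        · exact Or.inl h1
        · rcases lt_or_ge (h.proj y) (h.r - 1 / 2) with h2 | h2
          · exact Or.inr (Or.inl h2)
          · exact Or.inr (Or.inr ⟨h2, h1⟩)
      simp only [List.filter_cons]
      split_ifs <;> simp_all <;> omega
  have h7 : (l.length : ℝ) ≤ (l.filter fun h => y ∈ h.pos).length +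
      (l.filter fun h => y ∈ h.neg).length + 1 := by
    exact_mod_cast h6.trans (by omega)
  rw [e]
  linarith

end DistL

namespace Curtain

variable {X : Type*} [MetricSpace X] (hX : HasCNPoints X)
include hX

/-! ### Curtains dual to one geodesic -/

theorem exists_dual_chain {α : ℝ → X} {I : Set ℝ} (hα : IsGeodesicOn α I) (hI : IsClosed I)
    (hI' : I.OrdConnected) {a b : ℝ} (ha : a ∈ I) (hb : b ∈ I) {n : ℕ} (hab : a + 2 * n ≤ b) :
    ∃ l : List (Curtain X), l.length = n ∧ l.Pairwise Below ∧
      ∀ k ∈ l, ∀ S : Set X, IsPreconnected S → ∀ p ∈ S, ∀ q ∈ S, projParam α I p ≤ a →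
        b ≤ projParam α I q → ∃ z, z ∈ k.carrier ∧ z ∈ S := by
  have hpos : ∀ j : Fin n, (j : ℝ) + 1 ≤ n := fun j => by exact_mod_cast j.2
  have hj0 : ∀ j : Fin n, (0 : ℝ) ≤ (j : ℝ) := fun j => Nat.cast_nonneg _
  have hIoo : Ioo a b ⊆ interior I :=
    interior_maximal (Ioo_subset_Icc_self.trans (hI'.out ha hb)) isOpen_Ioo
  let c : Fin n → Curtain X := fun j =>
    { α := α
      I := I
      isClosed := hI
      ordConnected := hI'
      isGeodesic := hα
      -- Spacing 2 exceeds the width 1 of the curtains, so they are disjoint, and the offset 1 keeps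
      -- all poles inside the interval from a to b.
      r := a + 1 + 2 * (j : ℝ)
      pole_subset := fun t ht => hIoo
        ⟨by linarith [ht.1, hj0 j], by linarith [ht.2, hpos j]⟩ }
  have hproj : ∀ j x, (c j).proj x = projParam α I x := fun _ _ => rfl
  have hr : ∀ j, (c j).r = a + 1 + 2 * (j : ℝ) := fun _ => rfl
  refine ⟨List.ofFn c, by simp, ?_, ?_⟩
  · rw [List.pairwise_ofFn]
    intro i j hij
    have hij' : (i : ℝ) + 1 ≤ j := by exact_mod_cast hij
    constructor
    · intro x hx
      rw [mem_carrier hX, hproj, hr] at hx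
      rw [mem_neg hX, hproj, hr]; linarith [hx.2]
    · intro x hx
      rw [mem_carrier hX, hproj, hr] at hx
      rw [mem_pos hX, hproj, hr]; linarith [hx.1]
  · intro k hk S hS p hp q hq hpa hqb
    obtain ⟨j, rfl⟩ := List.mem_ofFn.1 hk
    obtain ⟨z, hz, hz'⟩ := exists_mem_carrier hX (c j) hS hp hq
      (by rw [mem_pos hX, hproj, hr]; linarith [hj0 j])
      (by rw [mem_neg hX, hproj, hr]; linarith [hpos j])
    exact ⟨z, hz', hz⟩

/-- Two `L`-separated curtains do not travel together for long along a geodesic. -/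
theorem LSeparated.not_span {L : ℕ} {h k : Curtain X} (hk : LSeparated L h k) {α : ℝ → X}
    {I : Set ℝ} (hα : IsGeodesicOn α I) (hI : IsClosed I) (hI' : I.OrdConnected) {a b : ℝ}
    (ha : a ∈ I) (hb : b ∈ I) (hab : a + 2 * (L + 1) ≤ b) {p p' q q' : X} (hp : p ∈ h.carrier)
    (hp' : p' ∈ h.carrier) (hq : q ∈ k.carrier) (hq' : q' ∈ k.carrier)
    (hpa : projParam α I p ≤ a) (hpb : b ≤ projParam α I p') (hqa : projParam α I q ≤ a)
    (hqb : b ≤ projParam α I q') : False := by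
  -- The geodesic carries L + 1 dual curtains between a and b, and all of them would meet both h and
  -- k.
  obtain ⟨l, hn, hl, hm⟩ := exists_dual_chain hX hα hI hI' ha hb (n := L + 1) (by push_cast; linarith)
  have := hk.length_le hX hl fun c hc =>
    ⟨hm c hc _ (isPreconnected_carrier hX h) p hp p' hp' hpa hpb,
      hm c hc _ (isPreconnected_carrier hX k) q hq q' hq' hqa hqb⟩
  omega

/-! ### Additivity along geodesics -/

/-- If y were not beyond h, the geodesic would cross h and the next member k on the way to z and
cross both again on the way to y. The many members after k keep these crossings far from z on either
side, so h and k would span a long piece of the geodesic, against their L-separation. -/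
theorem mem_pos_of_long {L : ℕ} {x z y : X} (hz : LiesBetween x z y) {h : Curtain X}
    {l : List (Curtain X)} (hl : IsOrderedLChain L x z (h :: l)) (hn : L + 2 ≤ l.length) :
    y ∈ h.pos := by
  rcases l with _ | ⟨k, l⟩
  · simp at hn
  rw [List.length_cons] at hn
  by_contra hy
  have hp := hl.pairwise
  rw [List.pairwise_cons, List.pairwise_cons] at hp
  obtain ⟨hhk, hks⟩ := hp.1 k (by simp)
  have hkl := hp.2.1
  have hlb : l.Pairwise Below := hp.2.2.imp fun h => h.1
  obtain ⟨hxh, hzh⟩ := hl.separates h (by simp)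
  obtain ⟨hxk, hzk⟩ := hl.separates k (by simp)
  have hnn : ∀ {k : Curtain X} {w : X}, w ∈ k.neg → w ∉ k.pos :=
    fun h h' => not_mem_neg_of_mem_pos hX h' h
  -- The crossings found here are met along the geodesic from x to y in the order qh, qk, z, pk, ph.
  obtain ⟨ph, hph, hph'⟩ := exists_mem_carrier hX h (hX.isPreconnected_segment z y)
    (LiesBetween.right z y) (LiesBetween.left z y) hy (not_mem_neg_of_mem_pos hX hzh)
  obtain ⟨pk, hpk, hpk'⟩ := exists_mem_carrier hX k (hX.isPreconnected_segment z ph)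
    (LiesBetween.right z ph) (LiesBetween.left z ph) (hnn (hhk.1 hph'))
    (not_mem_neg_of_mem_pos hX hzk)
  obtain ⟨qk, hqk, hqk'⟩ := exists_mem_carrier hX k (hX.isPreconnected_segment x z)
    (LiesBetween.left x z) (LiesBetween.right x z) (hnn hxk) (not_mem_neg_of_mem_pos hX hzk)
  obtain ⟨qh, hqh, hqh'⟩ := exists_mem_carrier hX h (hX.isPreconnected_segment x qk)
    (LiesBetween.left x qk) (LiesBetween.right x qk) (hnn hxh)
    (not_mem_neg_of_mem_pos hX (hhk.2 hqk'))
  have hlz : ∀ c ∈ l, z ∈ c.pos := fun c hc => (hl.separates c (by simp [hc])).2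
  have h1 := length_le_dist hX hlb (x := qk) (y := z) fun c hc =>
    ⟨(hkl c hc).1.1 hqk', hlz c hc⟩
  have h2 := length_le_dist hX hlb (x := pk) (y := z) fun c hc =>
    ⟨(hkl c hc).1.1 hpk', hlz c hc⟩
  obtain ⟨γ, h0, h1', hγ⟩ := hX.isGeodesicSpace x y
  have hm0 : (0 : ℝ) ∈ Icc 0 (dist x y) := ⟨le_rfl, dist_nonneg⟩
  have hm1 : dist x y ∈ Icc 0 (dist x y) := ⟨dist_nonneg, le_rfl⟩
  have hmem : ∀ w, LiesBetween x w y → dist x w ∈ Icc 0 (dist x y) := fun w hw =>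
    ⟨dist_nonneg, by
      have : dist x w + dist w y = dist x y := hw
      linarith [dist_nonneg (x := w) (y := y)]⟩
  have hproj : ∀ w, LiesBetween x w y → projParam γ (Icc 0 (dist x y)) w = dist x w := by
    intro w hw
    have hb := hγ.liesBetween hm0 (hmem w hw) hm1 (hmem w hw).1 (hmem w hw).2
    rw [h0, h1'] at hb
    have hd := hγ _ hm0 _ (hmem w hw)
    rw [h0, zero_sub, abs_neg, abs_of_nonneg dist_nonneg] at hd
    have := hX.eq_of_liesBetween hb hw hd
    nth_rewrite 1 [← this]
    exact hX.projParam_geodesic hγ isClosed_Icc ordConnected_Icc ⟨0, hm0⟩ (hmem w hw)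
  unfold LiesBetween at *
  simp only [mem_ofPred_eq] at *
  have t1 := dist_triangle x z ph
  have t2 := dist_triangle x ph y
  have t3 := dist_triangle x z pk
  have t4 := dist_triangle pk ph y
  have t5 := dist_triangle x pk y
  have t6 := dist_triangle x qk y
  have t7 := dist_triangle qk z y
  have t8 := dist_triangle x qh y
  have t9 := dist_triangle qh qk y
  have bph : dist x ph + dist ph y = dist x y := by linarith
  have bpk : dist x pk + dist pk y = dist x y := by linarith
  have bqk : dist x qk + dist qk y = dist x y := by linarith
  have bqh : dist x qh + dist qh y = dist x y := by linarith
  have t10 := dist_nonneg (x := qh) (y := qk)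
  have t11 := dist_nonneg (x := pk) (y := ph)
  -- Each of the at least L + 1 members after k separates both qk and pk from z, so these are at
  -- least 2(L + 1) apart, as `not_span` requires.
  have hn' : ((L : ℝ) + 1) ≤ l.length := by
    have : L + 1 ≤ l.length := by omega
    exact_mod_cast this
  rw [dist_comm pk z] at h2
  refine hks.not_span hX hγ isClosed_Icc ordConnected_Icc (hmem qk bqk) (hmem pk bpk) ?_
    hqh' hph' hqk' hpk' ?_ ?_ ?_ ?_
  · linarith
  · rw [hproj qh bqh]; linarith
  · rw [hproj ph bph]; linarith
  · rw [hproj qk bqk]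
  · rw [hproj pk bpk]

omit hX in
theorem exists_sublist_of_mem_take {β : Type*} {l : List β} {K : ℕ} {h : β}
    (hh : h ∈ l.take (l.length - K)) : ∃ l' : List β, (h :: l').Sublist l ∧ K ≤ l'.length := by
  obtain ⟨s, t, e⟩ := List.append_of_mem hh
  have hlen := congrArg List.length e
  simp at hlen
  refine ⟨t ++ l.drop (l.length - K), ?_, ?_⟩
  · have e' : s ++ h :: t ++ l.drop (l.length - K) = l := by
      rw [← e]; exact List.take_append_drop _ _
    have hsub : (h :: (t ++ l.drop (l.length - K))).Sublist
        (s ++ h :: t ++ l.drop (l.length - K)) := by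
      rw [List.append_assoc, List.cons_append]; exact List.sublist_append_right _ _
    rwa [e'] at hsub
  · simp; omega

/-- Every point of the geodesic from `z` to `y` is on the positive side of curtains that are
followed by sufficiently many members of an `L`-chain from `x` to `z`. -/
theorem mem_pos_of_append {L : ℕ} {x z y : X} (hz : LiesBetween x z y) {l l' : List (Curtain X)}
    (hl : IsOrderedLChain L x z (l ++ l')) (hn : L + 2 ≤ l'.length) {h : Curtain X} (hh : h ∈ l)
    {q : X} (hq : LiesBetween z q y) : q ∈ h.pos := by
  obtain ⟨s, t, rfl⟩ := List.append_of_mem hh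
  have hzq : LiesBetween x z q := by
    unfold LiesBetween at *
    linarith [dist_triangle x z q, dist_triangle x q y]
  refine mem_pos_of_long hX hzq (h := h) (l := t ++ l') (hl.sublist ?_)
    (by rw [List.length_append]; omega)
  rw [List.append_assoc, List.cons_append]
  exact List.sublist_append_right _ _

/-- If h met h', it would also cross k', as it contains a point between x and z. Then h' and k'
would each run from a point of h to a point between z and y, and would cross every member of `h ::
l`: these are L + 1 curtains, too many for L-separated h' and k'. -/
theorem disjoint_of_junction {L : ℕ} {x z y : X} {h h' k' : Curtain X} {l : List (Curtain X)}
    (hl : (h :: l).Pairwise Below) (hn : L ≤ l.length)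
    (hgood : ∀ c ∈ h :: l, ∀ q, LiesBetween z q y → q ∈ c.pos)
    (hk' : ∀ q, LiesBetween x q z → q ∈ k'.neg) (hxh : x ∈ h.neg) (hzh : z ∈ h.pos)
    (hzk' : z ∈ k'.neg) (hyk' : y ∈ k'.pos) (hzh' : z ∈ h'.neg) (hyh' : y ∈ h'.pos)
    (hb : Below k' h') (hs : LSeparated L k' h') : Disjoint h.carrier h'.carrier := by
  have hnn : ∀ {k : Curtain X} {w : X}, w ∈ k.neg → w ∉ k.pos :=
    fun h h' => not_mem_neg_of_mem_pos hX h' h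
  rw [Set.disjoint_left]
  intro u hu hu'
  have meet : ∀ e : Curtain X, z ∈ e.neg → y ∈ e.pos → ∀ v, v ∈ e.carrier → v ∈ h.carrier →
      ∀ c ∈ h :: l, ∃ w, w ∈ c.carrier ∧ w ∈ e.carrier := by
    intro e hze hye v hve hvh c hc
    rcases List.mem_cons.1 hc with rfl | hc'
    · exact ⟨v, hvh, hve⟩
    · obtain ⟨q, hq, hqe⟩ := exists_mem_carrier hX e (hX.isPreconnected_segment z y)
        (LiesBetween.left z y) (LiesBetween.right z y) (hnn hze) (not_mem_neg_of_mem_pos hX hye)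
      have hvc : v ∈ c.neg := ((List.pairwise_cons.1 hl).1 c hc').1 hvh
      obtain ⟨w, hw, hw'⟩ := exists_mem_carrier hX c (isPreconnected_carrier hX e) hve hqe
        (hnn hvc) (not_mem_neg_of_mem_pos hX (hgood c hc q hq))
      exact ⟨w, hw', hw⟩
  obtain ⟨q, hq, hqh⟩ := exists_mem_carrier hX h (hX.isPreconnected_segment x z)
    (LiesBetween.left x z) (LiesBetween.right x z) (hnn hxh) (not_mem_neg_of_mem_pos hX hzh)
  obtain ⟨v, hv, hv'⟩ := exists_mem_carrier hX k' (isPreconnected_carrier hX h) hqh hu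
    (hnn (hk' q hq)) (not_mem_neg_of_mem_pos hX (hb.2 hu'))
  have := hs.length_le hX hl fun c hc =>
    ⟨meet k' hzk' hyk' v hv' hv c hc, meet h' hzh' hyh' u hu' hu c hc⟩
  rw [List.length_cons] at this
  omega

theorem below_of_junction {x z y : X} {h h' : Curtain X}
    (hd : Disjoint h.carrier h'.carrier) (hh : ∀ q, LiesBetween z q y → q ∈ h.pos)
    (hh' : ∀ q, LiesBetween x q z → q ∈ h'.neg) (hxh : x ∈ h.neg) (hzh : z ∈ h.pos)
    (hzh' : z ∈ h'.neg) (hyh' : y ∈ h'.pos) : Below h h' := by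
  have hnn : ∀ {k : Curtain X} {w : X}, w ∈ k.neg → w ∉ k.pos :=
    fun h h' => not_mem_neg_of_mem_pos hX h' h
  obtain ⟨q, hq, hqh⟩ := exists_mem_carrier hX h (hX.isPreconnected_segment x z)
    (LiesBetween.left x z) (LiesBetween.right x z) (hnn hxh) (not_mem_neg_of_mem_pos hX hzh)
  obtain ⟨q', hq', hqh'⟩ := exists_mem_carrier hX h' (hX.isPreconnected_segment z y)
    (LiesBetween.left z y) (LiesBetween.right z y) (hnn hzh') (not_mem_neg_of_mem_pos hX hyh')
  exact ⟨subset_neg_of_disjoint hX (isPreconnected_carrier hX h)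
      (fun _ hc => Set.disjoint_left.1 hd hc) hqh (hnn (hh' q hq)),
    subset_pos_of_disjoint hX (isPreconnected_carrier hX h')
      (fun _ hc => Set.disjoint_right.1 hd hc) hqh' (not_mem_neg_of_mem_pos hX (hh q' hq'))⟩

/-- After trimming at the junction, the geodesic from z to y is beyond every remaining member of the
first chain, and the geodesic from x to z is before every remaining member of the second. Members of
the two chains are then disjoint and correctly ordered, and h is L-separated from h' because it is
L-separated from its successor c, which lies between them. -/
theorem exists_isOrderedLChain_of_liesBetween {L : ℕ} {x z y : X} (hz : LiesBetween x z y)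
    {l l' : List (Curtain X)} (hl : IsOrderedLChain L x z l) (hl' : IsOrderedLChain L z y l') :
    ∃ m, IsOrderedLChain L x y m ∧ l.length + l'.length ≤ m.length + (3 * L + 6) := by
  -- A retained member h needs one successor c, another L members to make a chain of length L + 1
  -- starting with c, and L + 2 further members for `mem_pos_of_append`. In the second chain, the
  -- predecessor k' and L + 2 members before it suffice, hence L + 3.
  set A := l.take (l.length - (2 * L + 3)) with hA
  set A' := ((l'.reverse).take (l'.reverse.length - (L + 3))).reverse with hA'
  have hAl : A.Sublist l := List.take_sublist _ _
  have hAl' : A'.Sublist l' := by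
    have := (List.take_sublist (l'.reverse.length - (L + 3)) l'.reverse).reverse
    rwa [List.reverse_reverse] at this
  have hAgood : ∀ h ∈ A, ∃ c t, (h :: c :: t).Pairwise Below ∧ LSeparated L h c ∧
      L ≤ t.length ∧ (∀ e ∈ h :: c :: t, x ∈ e.neg ∧ z ∈ e.pos) ∧
      ∀ e ∈ h :: c :: t, ∀ q, LiesBetween z q y → q ∈ e.pos := by
    intro h hh
    obtain ⟨s, hs, hlen⟩ := exists_sublist_of_mem_take hh
    rcases s with _ | ⟨c, s⟩
    · simp at hlen
    rw [List.length_cons] at hlen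
    have hsub : (h :: c :: s.take L).Sublist (h :: c :: s) :=
      ((List.take_sublist L s).cons_cons c).cons_cons h
    have hchain := hl.sublist hs
    have hchain' := hchain.sublist hsub
    refine ⟨c, s.take L, hchain'.below, ?_, by simp; omega, hchain'.separates, ?_⟩
    · exact ((List.pairwise_cons.1 hchain.pairwise).1 c (by simp)).2
    · intro e he q hq
      refine mem_pos_of_append (L := L) hX hz (l := h :: c :: s.take L) (l' := s.drop L) ?_
        (by simp; omega) he hq
      simpa using hchain
  have hAgood' : ∀ h' ∈ A', ∃ k', Below k' h' ∧ LSeparated L k' h' ∧ z ∈ k'.neg ∧ y ∈ k'.pos ∧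
      (∀ q, LiesBetween x q z → q ∈ k'.neg) ∧ ∀ q, LiesBetween x q z → q ∈ h'.neg := by
    intro h' hh'
    rw [hA', List.mem_reverse] at hh'
    obtain ⟨s, hs, hlen⟩ := exists_sublist_of_mem_take hh'
    rcases s with _ | ⟨k', s⟩
    · simp at hlen
    rw [List.length_cons] at hlen
    have hs' : (h' :: k' :: s).reverse.Sublist l' := by
      have := hs.reverse
      rwa [List.reverse_reverse] at this
    have hchain := hl'.sublist hs'
    have hflip := hchain.flip
    rw [List.reverse_reverse] at hflip
    have hpk : Below k' h' ∧ LSeparated L k' h' := by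
      have := hchain.pairwise
      rw [List.pairwise_reverse] at this
      exact (List.pairwise_cons.1 this).1 k' (by simp)
    obtain ⟨h1, h2⟩ := hchain.separates k' (by simp)
    have hg : ∀ e ∈ [h'.flip, k'.flip], ∀ q, LiesBetween x q z → q ∈ e.pos := by
      intro e he q hq
      refine mem_pos_of_append (L := L) hX hz.symm (l := [h'.flip, k'.flip]) (l' := s.map Curtain.flip) ?_
        (by simp; omega) he hq.symm
      simpa using hflip
    exact ⟨k', hpk.1, hpk.2, h1, h2, fun q hq => by simpa using hg k'.flip (by simp) q hq,
      fun q hq => by simpa using hg h'.flip (by simp) q hq⟩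
  refine ⟨A ++ A', ⟨?_, ?_⟩, ?_⟩
  · rw [List.pairwise_append]
    refine ⟨hl.pairwise.sublist hAl, hl'.pairwise.sublist hAl', ?_⟩
    intro h hh h' hh'
    obtain ⟨c, t, hp, hs, ht, hsep, hgood⟩ := hAgood h hh
    obtain ⟨k', hb, hs', hzk, hyk, hgk, hgh⟩ := hAgood' h' hh'
    obtain ⟨hzh', hyh'⟩ := hl'.separates h' (hAl'.subset hh')
    obtain ⟨hxh, hzh⟩ := hsep h (by simp)
    obtain ⟨hxc, hzc⟩ := hsep c (by simp)
    have hd := disjoint_of_junction hX hp (by rw [List.length_cons]; omega) hgood hgk hxh hzh hzk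
      hyk hzh' hyh' hb hs'
    have hd' := disjoint_of_junction hX (List.pairwise_cons.1 hp).2 ht
      (fun e he => hgood e (List.mem_cons_of_mem _ he)) hgk hxc hzc hzk hyk hzh' hyh' hb hs'
    have hch' := below_of_junction hX hd' (hgood c (by simp)) hgh hxc hzc hzh' hyh'
    exact ⟨below_of_junction hX hd (hgood h (by simp)) hgh hxh hzh hzh' hyh',
      hs.of_below_below hX ((List.pairwise_cons.1 hp).1 c (by simp)) hch'⟩
  · intro h hh
    rcases List.mem_append.1 hh with hh | hh
    · obtain ⟨c, t, hp, hs, ht, hsep, hgood⟩ := hAgood h hh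
      exact ⟨(hsep h (by simp)).1, hgood h (by simp) y (LiesBetween.right _ _)⟩
    · obtain ⟨k', hb, hs', hzk, hyk, hgk, hgh⟩ := hAgood' h hh
      exact ⟨hgh x (LiesBetween.left _ _), (hl'.separates h (hAl'.subset hh)).2⟩
  · simp [hA, hA']; omega

/-! ### Chains along the side of a flat strip -/

/-- In a longer chain, two consecutive members in the middle have the fibre of the projection over γ
0 on their negative side and the fibre over γ D on their positive side. Every rung joins the two
fibres, so all L + 1 rungs cross both members, which are L-separated. -/
theorem length_le_of_ladder {L : ℕ} {γ : ℝ → X} {D : ℝ} (hD : 0 ≤ D)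
    (hγ : IsGeodesicOn γ (Icc 0 D)) {v : List (Curtain X)} (hv : v.Pairwise Below)
    (hvn : v.length = L + 1)
    (hrung : ∀ c ∈ v, ∃ u ∈ c.carrier, ∃ u' ∈ c.carrier,
      projParam γ (Icc 0 D) u = 0 ∧ projParam γ (Icc 0 D) u' = D)
    {l : List (Curtain X)} (hl : IsOrderedLChain L (γ 0) (γ D) l) : l.length ≤ 4 * L + 7 := by
  have hnn : ∀ {k : Curtain X} {w : X}, w ∈ k.neg → w ∉ k.pos :=
    fun h h' => not_mem_neg_of_mem_pos hX h' h
  have hm0 : (0 : ℝ) ∈ Icc 0 D := ⟨le_rfl, hD⟩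
  have hm1 : D ∈ Icc 0 D := ⟨hD, le_rfl⟩
  have hgeo : ∀ t ∈ Icc 0 D, projParam γ (Icc 0 D) (γ t) = t := fun t ht =>
    hX.projParam_geodesic hγ isClosed_Icc ordConnected_Icc ⟨0, hm0⟩ ht
  have hfib : ∀ t, IsPreconnected {w | projParam γ (Icc 0 D) w ∈ ({t} : Set ℝ)} := fun t =>
    hX.isPreconnected_preimage_projParam hγ isClosed_Icc ordConnected_Icc ⟨0, hm0⟩
      ordConnected_singleton
  have hpath : ∀ s ∈ Icc 0 D, ∀ t ∈ Icc 0 D, IsPreconnected (γ '' Icc s t) := fun s hs t ht =>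
    isPreconnected_Icc.image _ (hγ.continuousOn.mono (Icc_subset_Icc hs.1 ht.2))
  have hdist : ∀ s ∈ Icc 0 D, ∀ t ∈ Icc 0 D, s ≤ t → dist (γ s) (γ t) = t - s :=
    fun s hs t ht hst => by rw [hγ s hs t ht, abs_sub_comm, abs_of_nonneg (by linarith)]
  -- If h reached the fibre over 0 away from γ 0, so would its predecessor k. Both also cross γ at
  -- parameters at least 2L + 2, as the members of m separate γ 0 from these crossings, and
  -- `not_span` applies.
  have hstart : ∀ (m : List (Curtain X)) (k h : Curtain X),
      IsOrderedLChain L (γ 0) (γ D) (m ++ [k, h]) → 2 * L + 2 ≤ m.length →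
      ∀ u, projParam γ (Icc 0 D) u = 0 → u ∈ h.neg := by
    intro m k h hm hn u hu
    by_contra hcon
    obtain ⟨hp1, hp2, hp3⟩ := List.pairwise_append.1 hm.pairwise
    obtain ⟨hkh, hs⟩ := (List.pairwise_cons.1 hp2).1 h (by simp)
    obtain ⟨hxk, hyk⟩ := hm.separates k (by simp)
    obtain ⟨hxh, hyh⟩ := hm.separates h (by simp)
    obtain ⟨u1, hu1, hu1'⟩ := exists_mem_carrier hX h (hfib 0) (hgeo 0 hm0) hu (hnn hxh) hcon
    obtain ⟨u2, hu2, hu2'⟩ := exists_mem_carrier hX k (hfib 0) (hgeo 0 hm0) hu1 (hnn hxk)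
      (not_mem_neg_of_mem_pos hX (hkh.2 hu1'))
    obtain ⟨_, ⟨b, hb, rfl⟩, hbk⟩ := exists_mem_carrier hX k (hpath 0 hm0 D hm1)
      ⟨0, hm0, rfl⟩ ⟨D, hm1, rfl⟩ (hnn hxk) (not_mem_neg_of_mem_pos hX hyk)
    obtain ⟨_, ⟨b', hb', rfl⟩, hbh⟩ := exists_mem_carrier hX h (hpath b hb D hm1)
      ⟨b, ⟨le_rfl, hb.2⟩, rfl⟩ ⟨D, ⟨hb.2, le_rfl⟩, rfl⟩ (hnn (hkh.1 hbk))
      (not_mem_neg_of_mem_pos hX hyh)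
    have h1 := length_le_dist hX (hp1.imp fun h => h.1) (x := γ 0) (y := γ b) fun c hc =>
      ⟨(hm.separates c (by simp [hc])).1, (hp3 c hc k (by simp)).1.2 hbk⟩
    rw [hdist 0 hm0 b hb hb.1] at h1
    have h2 : (2 * L + 2 : ℝ) ≤ m.length := by exact_mod_cast hn
    refine hs.not_span hX hγ isClosed_Icc ordConnected_Icc hm0 hb (by linarith) hu2' hbk hu1' hbh
      (le_of_eq hu2) (hgeo b hb).ge (le_of_eq hu1) ?_
    rw [hgeo b' ⟨hb.1.trans hb'.1, hb'.2⟩]; exact hb'.1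
  have hend : ∀ (m : List (Curtain X)) (h k : Curtain X),
      IsOrderedLChain L (γ 0) (γ D) (h :: k :: m) → 2 * L + 2 ≤ m.length →
      ∀ u, projParam γ (Icc 0 D) u = D → u ∈ h.pos := by
    intro m h k hm hn u hu
    by_contra hcon
    obtain ⟨hp1, hp2⟩ := List.pairwise_cons.1 hm.pairwise
    obtain ⟨hp2, hp3⟩ := List.pairwise_cons.1 hp2
    obtain ⟨hhk, hs⟩ := hp1 k (by simp)
    obtain ⟨hxk, hyk⟩ := hm.separates k (by simp)
    obtain ⟨hxh, hyh⟩ := hm.separates h (by simp)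
    obtain ⟨u1, hu1, hu1'⟩ := exists_mem_carrier hX h (hfib D) hu (hgeo D hm1) hcon
      (not_mem_neg_of_mem_pos hX hyh)
    obtain ⟨u2, hu2, hu2'⟩ := exists_mem_carrier hX k (hfib D) hu1 (hgeo D hm1)
      (hnn (hhk.1 hu1')) (not_mem_neg_of_mem_pos hX hyk)
    obtain ⟨_, ⟨b, hb, rfl⟩, hbk⟩ := exists_mem_carrier hX k (hpath 0 hm0 D hm1)
      ⟨0, hm0, rfl⟩ ⟨D, hm1, rfl⟩ (hnn hxk) (not_mem_neg_of_mem_pos hX hyk)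
    obtain ⟨_, ⟨b', hb', rfl⟩, hbh⟩ := exists_mem_carrier hX h (hpath 0 hm0 b hb)
      ⟨0, ⟨le_rfl, hb.1⟩, rfl⟩ ⟨b, ⟨hb.1, le_rfl⟩, rfl⟩ (hnn hxh)
      (not_mem_neg_of_mem_pos hX (hhk.2 hbk))
    have h1 := length_le_dist hX (hp3.imp fun h => h.1) (x := γ b) (y := γ D) fun c hc =>
      ⟨(hp2 c hc).1.1 hbk, (hm.separates c (by simp [hc])).2⟩
    rw [hdist b hb D hm1 hb.2] at h1
    have h2 : (2 * L + 2 : ℝ) ≤ m.length := by exact_mod_cast hn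
    refine hs.not_span hX hγ isClosed_Icc ordConnected_Icc hb hm1 (by linarith) hbh hu1' hbk hu2'
      ?_ (le_of_eq hu1.symm) (hgeo b hb).le (le_of_eq hu2.symm)
    rw [hgeo b' ⟨hb'.1, hb'.2.trans hb.2⟩]; exact hb'.2
  by_contra hcon
  push Not at hcon
  -- A chain of length at least 4L + 8 has two consecutive members with 2L + 3 others on either
  -- side: 2L + 2 as needed above and one neighbour.
  obtain ⟨p, h₁, h₂, s, e, hp, hs⟩ : ∃ (p : List (Curtain X)) (h₁ h₂ : Curtain X)
      (s : List (Curtain X)), l = p ++ h₁ :: h₂ :: s ∧ 2 * L + 3 ≤ p.length ∧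
        2 * L + 3 ≤ s.length := by
    have h1 := List.take_append_drop (2 * L + 3) l
    have hlen : (l.drop (2 * L + 3)).length = l.length - (2 * L + 3) := List.length_drop
    rcases hd : l.drop (2 * L + 3) with _ | ⟨h₁, _ | ⟨h₂, s⟩⟩
    · rw [hd] at hlen; simp at hlen; omega
    · rw [hd] at hlen; simp at hlen; omega
    · rw [hd] at hlen h1
      refine ⟨l.take (2 * L + 3), h₁, h₂, s, h1.symm, by simp; omega, ?_⟩
      simp at hlen; omega
  have hneg : ∀ (m : List (Curtain X)) (h : Curtain X) (t : List (Curtain X)),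
      l = m ++ h :: t → 2 * L + 3 ≤ m.length →
      ∀ u, projParam γ (Icc 0 D) u = 0 → u ∈ h.neg := by
    intro m h t e hn
    rcases List.eq_nil_or_concat m with rfl | ⟨m', k, rfl⟩
    · simp at hn
    · refine hstart m' k h (hl.sublist ?_) (by simp at hn; omega)
      rw [e]; simp
  have hpos : ∀ (m : List (Curtain X)) (h : Curtain X) (t : List (Curtain X)),
      l = m ++ h :: t → 2 * L + 3 ≤ t.length →
      ∀ u, projParam γ (Icc 0 D) u = D → u ∈ h.pos := by
    intro m h t e hn
    rcases t with _ | ⟨k, t⟩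
    · simp at hn
    · refine hend t h k (hl.sublist ?_) (by simp at hn; omega)
      rw [e]; exact List.sublist_append_right _ _
  have e' : l = (p ++ [h₁]) ++ h₂ :: s := by rw [e]; simp
  have hsep : LSeparated L h₁ h₂ := by
    have := hl.pairwise
    rw [e] at this
    exact ((List.pairwise_cons.1 (List.pairwise_append.1 this).2.1).1 h₂ (by simp)).2
  have := hsep.length_le hX hv fun c hc => by
    obtain ⟨u, hu, u', hu', h0, h1⟩ := hrung c hc
    have meet : ∀ h : Curtain X, u ∈ h.neg → u' ∈ h.pos → ∃ x, x ∈ c.carrier ∧ x ∈ h.carrier :=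
      fun h h1 h2 => exists_mem_carrier hX h (isPreconnected_carrier hX c) hu hu' (hnn h1)
        (not_mem_neg_of_mem_pos hX h2)
    exact ⟨meet h₁ (hneg _ _ _ e hp u h0) (hpos _ _ _ e (by simp; omega) u' h1),
      meet h₂ (hneg _ _ _ e' (by simp; omega) u h0) (hpos _ _ _ e' hs u' h1)⟩
  omega

end Curtain

namespace Curtain

variable {X : Type*} [MetricSpace X] (hX : HasCNPoints X)
include hX

/-! ### Length of chains, and L-chains dual to a geodesic -/

/-- The inner members, oriented along the chain, separate x from y, so there are at most `dist x y`
of them; the two extreme members, which contain x and y, account for the 2. -/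
theorem IsChain.card_le {n : ℕ} {c : Fin n → Curtain X} (hc : IsChain c) (hn : 0 < n) {x y : X}
    (hx : x ∈ (c ⟨0, hn⟩).carrier) (hy : y ∈ (c ⟨n - 1, by omega⟩).carrier) :
    (n : ℝ) ≤ dist x y + 2 := by
  rcases lt_or_ge n 3 with h3 | h3
  · have : (n : ℝ) ≤ 2 := by exact_mod_cast (by omega : n ≤ 2)
    linarith [dist_nonneg (x := x) (y := y)]
  have hor : ∀ j : ℕ, ∃ k : Curtain X, ∀ hj : 0 < j ∧ j + 1 < n,
      k.carrier = (c ⟨j, by omega⟩).carrier ∧ (c ⟨j - 1, by omega⟩).carrier ⊆ k.neg ∧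
        (c ⟨j + 1, hj.2⟩).carrier ⊆ k.pos := by
    intro j
    by_cases hj : 0 < j ∧ j + 1 < n
    · rcases hc.2 ⟨j - 1, by omega⟩ ⟨j, by omega⟩ ⟨j + 1, hj.2⟩ (by simp; omega) (by simp)
        with h | h
      · exact ⟨c ⟨j, by omega⟩, fun _ => ⟨rfl, h⟩⟩
      · exact ⟨(c ⟨j, by omega⟩).flip, fun _ => by simpa using h⟩
    · exact ⟨c ⟨0, hn⟩, fun h => absurd h hj⟩
  choose k hk using hor
  have hstep : ∀ j, 0 < j → j + 2 < n → Below (k j) (k (j + 1)) := by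
    intro j h0 h1
    obtain ⟨e1, -, h4⟩ := hk j ⟨h0, by omega⟩
    obtain ⟨e2, h5, -⟩ := hk (j + 1) ⟨by omega, by omega⟩
    exact ⟨by rw [e1]; simpa using h5, by rw [e2]; exact h4⟩
  have hbelow : ∀ i, 0 < i → ∀ j, i + 1 ≤ j → j + 1 < n → Below (k i) (k j) := by
    intro i hi j hij
    induction j, hij using Nat.le_induction with
    | base => intro h; exact hstep i hi (by omega)
    | succ j hij ih =>
      intro h
      exact (ih (by omega)).trans hX (hstep j (by omega) (by omega))
  have hxn : ∀ j, 0 < j → j + 1 < n → x ∈ (k j).neg := by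
    intro j h0 h1
    have hx1 : x ∈ (k 1).neg := (hk 1 ⟨by omega, by omega⟩).2.1 (by simpa using hx)
    rcases eq_or_ne j 1 with rfl | hne
    · exact hx1
    · exact (hbelow 1 (by omega) j (by omega) h1).compl_pos_subset hX
        fun h => not_mem_neg_of_mem_pos hX h hx1
  have hyp : ∀ j, 0 < j → j + 1 < n → y ∈ (k j).pos := by
    intro j h0 h1
    have hy1 : y ∈ (k (n - 2)).pos := (hk (n - 2) ⟨by omega, by omega⟩).2.2 (by
      have e : n - 2 + 1 = n - 1 := by omega
      simpa [e] using hy)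
    rcases eq_or_ne j (n - 2) with rfl | hne
    · exact hy1
    · exact (hbelow j h0 (n - 2) (by omega) (by omega)).compl_neg_subset hX
        (not_mem_neg_of_mem_pos hX hy1)
  have hl := length_le_dist hX (x := x) (y := y)
    (l := List.ofFn fun j : Fin (n - 2) => k (j + 1)) (by
      rw [List.pairwise_ofFn]
      intro i j hij
      have : (i : ℕ) < j := hij
      exact hbelow _ (by omega) _ (by omega) (by omega)) (by
      intro h hh
      obtain ⟨j, rfl⟩ := List.mem_ofFn.1 hh
      exact ⟨hxn _ (by omega) (by omega), hyp _ (by omega) (by omega)⟩)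
  rw [List.length_ofFn, Nat.cast_sub (by omega)] at hl
  push_cast at hl
  linarith

/-- Along dual curtains at spacing N it is enough to know that neighbours are L-separated, by
`LSeparated.of_below_below`. -/
theorem exists_isOrderedLChain_dual {α : ℝ → X} {I : Set ℝ} (hα : IsGeodesicOn α I)
    (hI : IsClosed I) (hI' : I.OrdConnected) {L n : ℕ} {N s t : ℝ} (hN : 2 ≤ N) (hs : s ∈ I)
    (ht : t ∈ I) (hst : s + N * n + 1 ≤ t)
    (hsep : ∀ h k : Curtain X, h.α = α → h.I = I → k.α = α → k.I = I → s + N ≤ h.r →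
      k.r = h.r + N → LSeparated L h k) :
    ∃ l, IsOrderedLChain L (α s) (α t) l ∧ l.length = n := by
  have hpos : ∀ j : ℕ, j < n → (j : ℝ) + 1 ≤ n := fun j hj => by exact_mod_cast hj
  have hj0 : ∀ j : ℕ, 0 ≤ N * (j : ℝ) := fun j => mul_nonneg (by linarith) (Nat.cast_nonneg j)
  have hjn : ∀ j : ℕ, j < n → N * (j + 1 : ℝ) ≤ N * n := fun j hj => by
    have := hpos j hj
    gcongr
  have hIoo : Ioo s t ⊆ interior I :=
    interior_maximal (Ioo_subset_Icc_self.trans (hI'.out hs ht)) isOpen_Ioo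
  let c : Fin n → Curtain X := fun j =>
    { α := α
      I := I
      isClosed := hI
      ordConnected := hI'
      isGeodesic := hα
      r := s + N * (j + 1)
      pole_subset := fun u hu => hIoo
        ⟨by linarith [hu.1, hj0 j], by linarith [hu.2, hjn j j.2]⟩ }
  have hproj : ∀ j x, (c j).proj x = projParam α I x := fun _ _ => rfl
  have hr : ∀ j, (c j).r = s + N * (j + 1) := fun _ => rfl
  have hgeo : ∀ u ∈ I, projParam α I (α u) = u := fun u hu =>
    hX.projParam_geodesic hα hI hI' ⟨s, hs⟩ hu
  have hbelow : ∀ i j : Fin n, i < j → Below (c i) (c j) := by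
    intro i j hij
    have h1 : (i : ℝ) + 1 ≤ j := by exact_mod_cast hij
    have h2 : N * (i + 1 : ℝ) ≤ N * j := by gcongr
    constructor
    · intro x hx
      rw [mem_carrier hX, hproj, hr] at hx
      rw [mem_neg hX, hproj, hr]; linarith [hx.2]
    · intro x hx
      rw [mem_carrier hX, hproj, hr] at hx
      rw [mem_pos hX, hproj, hr]; linarith [hx.1]
  refine ⟨List.ofFn c, ⟨?_, ?_⟩, by simp⟩
  · rw [List.pairwise_ofFn]
    intro i j hij
    refine ⟨hbelow i j hij, ?_⟩
    have hi : (i : ℕ) + 1 < n := lt_of_le_of_lt (Nat.succ_le_of_lt hij) j.2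
    have h1 : LSeparated L (c i) (c ⟨i + 1, hi⟩) := by
      refine hsep _ _ rfl rfl rfl rfl ?_ ?_
      · rw [hr]; linarith [hj0 i]
      · rw [hr, hr]; push_cast; ring
    rcases eq_or_lt_of_le (Nat.succ_le_of_lt hij : (i : ℕ) + 1 ≤ j) with h | h
    · have : j = ⟨i + 1, hi⟩ := Fin.ext h.symm
      rw [this]; exact h1
    · exact h1.of_below_below hX (hbelow _ _ (Fin.lt_def.2 (by simp)))
        (hbelow _ _ (Fin.lt_def.2 h))
  · intro h hh
    obtain ⟨j, rfl⟩ := List.mem_ofFn.1 hh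
    rw [mem_neg hX, mem_pos hX, hproj, hproj, hr, hgeo s hs, hgeo t ht]
    constructor
    · linarith [hj0 j]
    · linarith [hjn j j.2]

end Curtain

/-! ### The curtain model -/

section Model

open Curtain

variable {X : Type*} [MetricSpace X]

/-- For L ≥ 1 a linear function of L is dominated by a multiple of L². This is where the summability
of the weights enters, and it turns errors linear in L into finite errors in the curtain model. -/
theorem IsCurtainWeight.summable_linear {lam : ℕ → ℝ} (hlam : IsCurtainWeight lam) (a b : ℝ) :
    Summable fun L : ℕ => lam (L + 1) * (a * (L + 1 : ℕ) + b) := by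
  have h := (summable_nat_add_iff 1).2 hlam.2
  have hpos : ∀ L : ℕ, 0 < lam (L + 1) := fun L => (hlam.1 (L + 1) (by omega)).1
  refine Summable.of_norm_bounded (h.mul_left (|a| + |b|)) fun L => ?_
  have h1 : (1 : ℝ) ≤ (L + 1 : ℕ) := by push_cast; linarith [Nat.cast_nonneg (α := ℝ) L]
  rw [norm_mul, Real.norm_of_nonneg (hpos L).le, Real.norm_eq_abs]
  set m : ℝ := ((L + 1 : ℕ) : ℝ)
  have h2 : |a * m + b| ≤ (|a| + |b|) * m ^ 2 := by
    refine (abs_add_le _ _).trans ?_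
    rw [abs_mul, abs_of_nonneg (by linarith : 0 ≤ m)]
    have h3 : m ≤ m ^ 2 := by nlinarith
    have h4 : 1 ≤ m ^ 2 := by nlinarith
    nlinarith [mul_le_mul_of_nonneg_left h3 (abs_nonneg a),
      mul_le_mul_of_nonneg_left h4 (abs_nonneg b)]
  calc lam (L + 1) * |a * m + b| ≤ lam (L + 1) * ((|a| + |b|) * m ^ 2) :=
        mul_le_mul_of_nonneg_left h2 (hpos L).le
    _ = _ := by ring

/-- The sum `∑ λ_L (a L + b)`. -/
def weightSum (lam : ℕ → ℝ) (a b : ℝ) : ℝ := ∑' L : ℕ, lam (L + 1) * (a * (L + 1 : ℕ) + b)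

variable (hX : HasCNPoints X) {lam : ℕ → ℝ} (hlam : IsCurtainWeight lam)
include hX hlam

theorem summable_curtainDist (x y : X) :
    Summable fun L : ℕ => lam (L + 1) * curtainDistL (L + 1) x y := by
  have hpos : ∀ L : ℕ, 0 < lam (L + 1) := fun L => (hlam.1 (L + 1) (by omega)).1
  refine Summable.of_nonneg_of_le (fun L => mul_nonneg (hpos L).le (curtainDistL_nonneg _ _ _))
    (fun L => ?_) (hlam.summable_linear 0 (dist x y + 1))
  rw [zero_mul, zero_add]
  exact mul_le_mul_of_nonneg_left (curtainDistL_le hX _ x y) (hpos L).le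

theorem curtainDist_le_of_forall_le {x y : X} {a b : ℝ}
    (h : ∀ L : ℕ, curtainDistL L x y ≤ a * L + b) : curtainDist X lam x y ≤ weightSum lam a b := by
  have hpos : ∀ L : ℕ, 0 < lam (L + 1) := fun L => (hlam.1 (L + 1) (by omega)).1
  exact (summable_curtainDist hX hlam x y).tsum_le_tsum
    (fun L => mul_le_mul_of_nonneg_left (h (L + 1)) (hpos L).le) (hlam.summable_linear a b)

theorem mul_curtainDistL_le {L : ℕ} (hL : 1 ≤ L) (x y : X) :
    lam L * curtainDistL L x y ≤ curtainDist X lam x y := by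
  have hpos : ∀ L : ℕ, 0 < lam (L + 1) := fun L => (hlam.1 (L + 1) (by omega)).1
  obtain ⟨L, rfl⟩ := Nat.exists_eq_add_of_le' hL
  exact (summable_curtainDist hX hlam x y).le_tsum L
    fun j _ => mul_nonneg (hpos j).le (curtainDistL_nonneg _ _ _)

theorem isMetric_curtainDist : IsMetric (curtainDist X lam) := by
  have hpos : ∀ L : ℕ, 0 < lam (L + 1) := fun L => (hlam.1 (L + 1) (by omega)).1
  refine ⟨fun x y => ⟨fun h => ?_, ?_⟩, fun x y => ?_, fun x y z => ?_⟩
  · by_contra hxy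
    have h1 := mul_curtainDistL_le hX hlam le_rfl x y
    have h2 := one_le_curtainDistL 1 hxy
    have h3 := (hlam.1 1 le_rfl).1
    nlinarith
  · rintro rfl
    simp [curtainDist, curtainDistL_self]
  · simp only [curtainDist, curtainDistL_comm _ x y]
  · have h1 := summable_curtainDist hX hlam x y
    have h2 := summable_curtainDist hX hlam y z
    rw [curtainDist, curtainDist, curtainDist, ← h1.tsum_add h2]
    refine (summable_curtainDist hX hlam x z).tsum_le_tsum (fun L => ?_) (h1.add h2)
    rw [← mul_add]
    exact mul_le_mul_of_nonneg_left (curtainDistL_triangle hX _ x y z) (hpos L).le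

omit hlam in
-- Joining the chains loses at most 3L + 6 curtains. The remaining 1 is due to the summand 1 of d_L,
-- which occurs twice on the left-hand side and once on the right.
theorem curtainDistL_add_le {L : ℕ} {x z y : X} (hz : LiesBetween x z y) :
    curtainDistL L x z + curtainDistL L z y ≤ curtainDistL L x y + (3 * L + 7) := by
  by_cases hxz : x = z
  · subst hxz; rw [curtainDistL_self]; linarith [Nat.cast_nonneg (α := ℝ) L]
  by_cases hzy : z = y
  · subst hzy; rw [curtainDistL_self]; linarith [Nat.cast_nonneg (α := ℝ) L]
  have hxy : x ≠ y := by
    rintro rfl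
    have h1 : dist x z + dist z x = dist x x := hz
    rw [dist_self] at h1
    have h2 := dist_nonneg (x := x) (y := z)
    have h3 := dist_nonneg (x := z) (y := x)
    exact hxz (dist_eq_zero.1 (by linarith))
  obtain ⟨l, hl, e⟩ := exists_length_add_one_eq hX L hxz
  obtain ⟨l', hl', e'⟩ := exists_length_add_one_eq hX L hzy
  obtain ⟨m, hm, hlen⟩ := exists_isOrderedLChain_of_liesBetween hX hz hl hl'
  have h1 := hm.length_add_one_le hX hxy
  have h2 : (l.length : ℝ) + l'.length ≤ m.length + (3 * L + 6) := by exact_mod_cast hlen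
  rw [e, e']
  linarith

theorem curtainDist_add_le {x z y : X} (hz : LiesBetween x z y) :
    curtainDist X lam x z + curtainDist X lam z y ≤
      curtainDist X lam x y + weightSum lam 3 7 := by
  have hpos : ∀ L : ℕ, 0 < lam (L + 1) := fun L => (hlam.1 (L + 1) (by omega)).1
  have h1 := summable_curtainDist hX hlam x z
  have h2 := summable_curtainDist hX hlam z y
  have h3 := summable_curtainDist hX hlam x y
  have h4 := hlam.summable_linear 3 7
  rw [curtainDist, curtainDist, curtainDist, weightSum, ← h1.tsum_add h2, ← h3.tsum_add h4]
  refine (h1.add h2).tsum_le_tsum (fun L => ?_) (h3.add h4)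
  rw [← mul_add, ← mul_add]
  exact mul_le_mul_of_nonneg_left (curtainDistL_add_le hX hz) (hpos L).le

end Model

/-! ### Parking lots with glued rays -/

namespace ParkingLot

theorem dist_spiral_angle (q : ParkingLot) : dist q (spiral q.angle) = q.radius - 1 := by
  have hr := q.one_le_radius
  rw [dist_of_visible (by
    change |q.angle - q.angle| ≤ _
    rw [sub_self, abs_zero]
    exact add_nonneg (tanAng_nonneg _) (tanAng_nonneg _))]
  have h := norm_polar_sub_sq q.angle 1 q.angle q.radius
  rw [sub_self, Real.cos_zero, sub_self, mul_zero, add_zero] at h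
  change ‖polar q.angle 1 - polar q.angle q.radius‖ = _
  rw [← abs_of_nonneg (norm_nonneg (polar q.angle 1 - polar q.angle q.radius)),
    (sq_eq_sq_iff_abs_eq_abs _ _).1 h, abs_sub_comm, abs_of_nonneg (by linarith)]

theorem flat_one (θ : ℝ) (h : 1 ≤ (1 : ℂ).re) : flat θ 1 h = spiral θ := by
  ext <;> simp [flat, spiral]

theorem flat_radius (q : ParkingLot) (h : 1 ≤ ((q.radius : ℝ) : ℂ).re) :
    flat q.angle (q.radius : ℝ) h = q := by
  have hr := q.one_le_radius
  ext
  · simp [flat, Complex.arg_ofReal_of_nonneg (by linarith : 0 ≤ q.radius)]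
  · simp [flat, abs_of_nonneg (by linarith : 0 ≤ q.radius)]

end ParkingLot

namespace RayGluing

open ParkingLot

variable {p : ℕ → ParkingLot}

/-! ### The axis and the glued rays in the curtain model -/

/-- The angular coordinate, constant on the glued rays. -/
def ang : RayGluing p → ℝ
  | base q => q.angle
  | ray i _ _ => (p i).angle

/-- The spiral in the glued space. -/
def axis (p : ℕ → ParkingLot) (t : ℝ) : RayGluing p := base (spiral t)

theorem hasCNPoints_parkingLot : HasCNPoints (RayGluing p) :=
  RayGluing.hasCNPoints ParkingLot.hasCNPoints

theorem isGeodesicOn_axis : IsGeodesicOn (axis p) univ := isGeodesicOn_spiral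

/-- Distances to the axis are at least the difference r - 1 of the radii, and this is attained at
the point's own angle. A glued ray projects like its origin. -/
theorem projParam_axis (x : RayGluing p) : projParam (axis p) univ x = ang x := by
  refine hasCNPoints_parkingLot.projParam_eq isGeodesicOn_axis isClosed_univ ordConnected_univ
    univ_nonempty (mem_univ _) fun t _ => ?_
  have key : ∀ q : ParkingLot, dist q (spiral q.angle) ≤ dist q (spiral t) := fun q => by
    rw [dist_spiral_angle]
    exact (le_abs_self _).trans (abs_radius_sub_le_dist q (spiral t))
  rcases x with q | ⟨i, s, hs⟩
  · exact key q
  · rw [axis, axis, (offRay_base i _).dist_ray, (offRay_base i _).dist_ray]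
    exact add_le_add_right (key (p i)) s

theorem abs_ang_sub_le (x y : RayGluing p) : |ang x - ang y| ≤ dist x y := by
  rw [← projParam_axis, ← projParam_axis]
  exact hasCNPoints_parkingLot.abs_projParam_sub_le isGeodesicOn_axis isClosed_univ
    ordConnected_univ univ_nonempty x y

theorem liesBetween_axis {x y : RayGluing p} {t : ℝ} (hx : ang x + Real.pi / 2 ≤ t)
    (hy : t + Real.pi / 2 ≤ ang y) : LiesBetween x (axis p t) y := by
  have hpi := Real.pi_pos
  have key : ∀ {q q' : ParkingLot}, q.angle = ang x → q'.angle = ang y →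
      dist q (spiral t) + dist (spiral t) q' = dist q q' := fun hq hq' =>
    liesBetween_spiral (by rw [hq]; exact hx) (by rw [hq']; exact hy)
  unfold LiesBetween axis
  rcases x with q | ⟨i, s, hs⟩ <;> rcases y with q' | ⟨j, s', hs'⟩
  · exact key rfl rfl
  · rw [dist_base_ray, dist_base_ray, dist_base_base]
    linarith [key (q := q) (q' := p j) rfl rfl]
  · rw [(offRay_base i _).dist_ray, (offRay_base i _).dist_ray, dist_base_base, dist_base_base,
      dist_base_base]
    linarith [key (q := p i) (q' := q') rfl rfl]
  · have hij : i ≠ j := by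
      rintro rfl
      simp only [ang] at hx hy
      linarith
    rw [(offRay_base i _).dist_ray, (offRay_ray hij _ _).dist_ray, dist_base_ray, dist_base_ray,
      dist_base_base]
    linarith [key (q := p i) (q' := p j) rfl rfl]

-- A curtain e that meets h and k contains points of very different angles, while its pole has
-- length 1. Since e is star-shaped about the pole, one of these points is joined inside e to its
-- foot by a geodesic that runs along the axis. So every member of such a chain meets the axis in
-- one interval of length 7, which bounds the length of the chain.
open Curtain in
theorem lSeparated_axis {h k : Curtain (RayGluing p)} (hα : h.α = axis p) (hI : h.I = univ)
    (kα : k.α = axis p) (kI : k.I = univ) (hr : k.r = h.r + 10) : LSeparated 9 h k := by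
  have hX : HasCNPoints (RayGluing p) := hasCNPoints_parkingLot
  have hp : ∀ x, h.proj x = ang x := fun x => by rw [Curtain.proj, hα, hI, projParam_axis]
  have kp : ∀ x, k.proj x = ang x := fun x => by rw [Curtain.proj, kα, kI, projParam_axis]
  have hpi := Real.pi_lt_four
  constructor
  · rw [Set.disjoint_left]
    intro x hx hx'
    rw [mem_carrier hX, hp] at hx
    rw [mem_carrier hX, kp] at hx'
    linarith [hx.2, hx'.1]
  · intro n c hc hm
    have key : ∀ i, ∃ t ∈ Icc (h.r + 3 / 2) (h.r + 17 / 2), axis p t ∈ (c i).carrier := by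
      intro i
      set e := c i
      obtain ⟨⟨a, ha, ha'⟩, ⟨b, hb, hb'⟩⟩ := hm i
      rw [mem_carrier hX, hp] at ha'
      rw [mem_carrier hX, kp, hr] at hb'
      have hspec : ∀ x, e.proj x ∈ e.I := fun x =>
        (HasCNPoints.projParam_spec e.isGeodesic e.isClosed e.nonempty x).1
      have h1 : |ang (e.α (e.proj a)) - ang (e.α (e.proj b))| ≤ 1 := by
        refine (abs_ang_sub_le _ _).trans ?_
        rw [e.isGeodesic _ (hspec a) _ (hspec b), abs_le]
        have h2 := (mem_carrier hX).1 ha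
        have h3 := (mem_carrier hX).1 hb
        constructor <;> linarith [h2.1, h2.2, h3.1, h3.2]
      have hstar : ∀ {x z}, x ∈ e.carrier → LiesBetween x z (e.α (e.proj x)) → z ∈ e.carrier := by
        intro x z hx hz
        rw [mem_carrier hX] at hx ⊢
        have : e.proj z = e.proj x := hX.projParam_of_liesBetween e.isGeodesic e.isClosed
          e.ordConnected e.nonempty hz
        rwa [this]
      rw [abs_le] at h1
      -- The angles of a and b differ by at least 9 and those of the feet by at most 1, so one point
      -- is at least 4 away in angle from its foot. The margin 2 on either side exceeds π/2, as
      -- `liesBetween_axis` requires.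
      rcases le_or_gt (ang a + 4) (ang (e.α (e.proj a))) with h2 | h2
      · refine ⟨ang a + 2, ⟨by linarith [ha'.1], by linarith [ha'.2]⟩, hstar ha ?_⟩
        exact liesBetween_axis (by linarith) (by linarith)
      · refine ⟨ang b - 2, ⟨by linarith [hb'.1], by linarith [hb'.2]⟩, hstar hb ?_⟩
        exact (liesBetween_axis (by linarith [h1.1, ha'.2, hb'.1]) (by linarith)).symm
    rcases Nat.eq_zero_or_pos n with rfl | hn
    · omega
    obtain ⟨s, hs, hs'⟩ := key ⟨0, hn⟩
    obtain ⟨t, ht, ht'⟩ := key ⟨n - 1, by omega⟩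
    -- The first and last members meet the axis at points at most 7 apart, and 7 + 2 = 9.
    have h1 := hc.card_le hX hn hs' ht'
    have h2 : dist (axis p s) (axis p t) ≤ 7 := by
      rw [isGeodesicOn_axis s (mem_univ _) t (mem_univ _), abs_le]
      constructor <;> linarith [hs.1, hs.2, ht.1, ht.2]
    have h3 : (n : ℝ) ≤ (9 : ℕ) := by push_cast; linarith
    exact_mod_cast h3

theorem le_curtainDistL_axis {s t : ℝ} {n : ℕ} (h : s + 10 * n + 1 ≤ t) :
    (n : ℝ) ≤ curtainDistL 9 (axis p s) (axis p t) := by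
  have hX : HasCNPoints (RayGluing p) := hasCNPoints_parkingLot
  obtain ⟨l, hl, rfl⟩ := Curtain.exists_isOrderedLChain_dual hX isGeodesicOn_axis isClosed_univ
    ordConnected_univ (by norm_num : (2 : ℝ) ≤ 10) (mem_univ s) (mem_univ t) h
    (fun h k hα hI kα kI _ hr => lSeparated_axis hα hI kα kI hr)
  have hne : axis p s ≠ axis p t := by
    intro he
    have h1 := isGeodesicOn_axis (p := p) s (mem_univ _) t (mem_univ _)
    rw [he, dist_self] at h1
    have : s = t := sub_eq_zero.1 (abs_eq_zero.1 h1.symm)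
    linarith [Nat.cast_nonneg (α := ℝ) l.length]
  linarith [hl.length_add_one_le hX hne]

theorem isGeodesicOn_gluedRay (i : ℕ) : IsGeodesicOn (gluedRay p i) (Ici 0) :=
  fun _ hs _ ht => dist_gluedRay_gluedRay i hs ht

theorem projParam_gluedRay_of_offRay {i : ℕ} {x : RayGluing p} (hx : OffRay i x) :
    projParam (gluedRay p i) (Ici 0) x = 0 := by
  refine hasCNPoints_parkingLot.projParam_eq (isGeodesicOn_gluedRay i) isClosed_Ici
    ordConnected_Ici nonempty_Ici (mem_Ici.2 le_rfl) fun t ht => ?_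
  rw [dist_comm x, dist_comm x, hx.dist_gluedRay le_rfl, hx.dist_gluedRay ht]
  linarith [mem_Ici.1 ht]

theorem eq_gluedRay_of_projParam_pos {i : ℕ} {x : RayGluing p}
    (hx : 0 < projParam (gluedRay p i) (Ici 0) x) :
    x = gluedRay p i (projParam (gluedRay p i) (Ici 0) x) := by
  rcases offRay_or_eq_ray i x with h | ⟨s, hs, rfl⟩
  · rw [projParam_gluedRay_of_offRay h] at hx
    exact absurd hx (lt_irrefl _)
  · rw [← gluedRay_of_pos i hs, hasCNPoints_parkingLot.projParam_geodesic (isGeodesicOn_gluedRay i)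
      isClosed_Ici ordConnected_Ici nonempty_Ici (mem_Ici.2 hs.le)]

-- A connected set that meets both h and k must contain the point of the ray halfway between them,
-- and disjoint curtains cannot share it.
open Curtain in
theorem lSeparated_gluedRay {i : ℕ} {h k : Curtain (RayGluing p)} (hα : h.α = gluedRay p i)
    (hI : h.I = Ici 0) (kα : k.α = gluedRay p i) (kI : k.I = Ici 0) (h0 : 0 ≤ h.r)
    (hr : k.r = h.r + 2) : LSeparated 1 h k := by
  have hX : HasCNPoints (RayGluing p) := hasCNPoints_parkingLot
  set π := projParam (gluedRay p i) (Ici 0) with hπ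
  have hp : ∀ x, h.proj x = π x := fun x => by rw [Curtain.proj, hα, hI]
  have kp : ∀ x, k.proj x = π x := fun x => by rw [Curtain.proj, kα, kI]
  constructor
  · rw [Set.disjoint_left]
    intro x hx hx'
    rw [mem_carrier hX, hp] at hx
    rw [mem_carrier hX, kp] at hx'
    linarith [hx.2, hx'.1]
  · intro n c hc hm
    have key : ∀ j, gluedRay p i (h.r + 1) ∈ (c j).carrier := by
      intro j
      obtain ⟨⟨a, ha, ha'⟩, ⟨b, hb, hb'⟩⟩ := hm j
      rw [mem_carrier hX, hp] at ha'
      rw [mem_carrier hX, kp, hr] at hb'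
      obtain ⟨z, hz, e⟩ := exists_proj_eq hX h (isPreconnected_carrier hX (c j)) ha hb
        (v := h.r + 1) (by rw [hp]; linarith [ha'.2]) (by rw [hp]; linarith [hb'.1])
      rw [hp] at e
      have := eq_gluedRay_of_projParam_pos (p := p) (i := i) (x := z) (by rw [← hπ, e]; linarith)
      rw [← hπ, e] at this
      rwa [← this]
    by_contra hn
    push Not at hn
    exact Set.disjoint_left.1 (hc.1 ⟨0, by omega⟩ ⟨1, hn⟩ (by simp)) (key _) (key _)

theorem le_curtainDistL_gluedRay {i : ℕ} {t : ℝ} {n : ℕ} (h : 2 * n + 1 ≤ t) :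
    (n : ℝ) ≤ curtainDistL 1 (base (p i)) (gluedRay p i t) := by
  have hX : HasCNPoints (RayGluing p) := hasCNPoints_parkingLot
  have hn := Nat.cast_nonneg (α := ℝ) n
  have ht : t ∈ Ici (0 : ℝ) := mem_Ici.2 (by linarith)
  obtain ⟨l, hl, rfl⟩ := Curtain.exists_isOrderedLChain_dual hX (isGeodesicOn_gluedRay (p := p) i)
    isClosed_Ici ordConnected_Ici le_rfl (mem_Ici.2 le_rfl) ht (n := n) (L := 1) (by linarith)
    (fun h k hα hI kα kI h0 hr => lSeparated_gluedRay hα hI kα kI (by linarith) hr)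
  rw [← gluedRay_zero i]
  have hne : gluedRay p i 0 ≠ gluedRay p i t := by
    intro he
    have h1 := isGeodesicOn_gluedRay (p := p) i 0 (mem_Ici.2 le_rfl) t ht
    rw [he, dist_self] at h1
    rw [zero_sub, abs_neg, abs_of_nonneg (mem_Ici.1 ht)] at h1
    linarith
  linarith [hl.length_add_one_le hX hne]

/-! ### Radial segments are short in the curtain model -/

theorem dist_base_flat (ψ : ℝ) {w w' : ℂ} (hw : 1 ≤ w.re) (hw' : 1 ≤ w'.re) :
    dist (base (flat ψ w hw) : RayGluing p) (base (flat ψ w' hw')) = ‖w - w'‖ :=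
  dist_flat_flat ψ hw hw'

/-- In the flat half-plane tangent at the angle of q, the radial segment is a side of the strip 1 ≤
s ≤ `q.radius` in Cartesian coordinates (s, t). Curtains dual to the line s = 1 cross the strip and
serve as rungs for `length_le_of_ladder`. -/
theorem curtainDistL_radial_le (L : ℕ) (q : ParkingLot) :
    curtainDistL L (axis p q.angle) (base q) ≤ 4 * L + 8 := by
  have hX : HasCNPoints (RayGluing p) := hasCNPoints_parkingLot
  by_cases hq : axis p q.angle = base q
  · rw [hq, curtainDistL_self]; positivity
  have hr := q.one_le_radius
  set D := q.radius - 1 with hD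
  have hD0 : 0 ≤ D := by linarith
  have hre : ∀ {s : ℝ} (t : ℝ), 1 ≤ s → 1 ≤ (⟨s, t⟩ : ℂ).re := fun _ h => h
  set P : ∀ s : ℝ, 1 ≤ s → ℝ → RayGluing p := fun s hs t => base (flat q.angle ⟨s, t⟩ (hre t hs))
    with hP
  have hdist : ∀ s hs t s' hs' t', dist (P s hs t) (P s' hs' t') =
      ‖(⟨s - s', t - t'⟩ : ℂ)‖ := by
    intro s hs t s' hs' t'
    rw [hP, dist_base_flat]; rfl
  have hm : ∀ t : ℝ, 1 ≤ 1 + max t 0 := fun t => by linarith [le_max_right t 0]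
  -- The maximum only serves to define γ for negative parameters, where the coordinate would leave
  -- the half-plane.
  set γ : ℝ → RayGluing p := fun t => P (1 + max t 0) (hm t) 0 with hγ
  have hvert : ∀ s hs, IsGeodesicOn (P s hs) univ := by
    intro s hs t _ t' _
    rw [hdist s hs t s hs t', sub_self, Complex.norm_def, Complex.normSq_mk, mul_zero, zero_add,
      Real.sqrt_mul_self_eq_abs]
  have hγgeo : IsGeodesicOn γ (Icc 0 D) := by
    intro t ht t' ht'
    rw [hγ]
    simp only
    rw [hdist _ (hm t) _ _ (hm t') _, max_eq_left ht.1, max_eq_left ht'.1, Complex.norm_def, Complex.normSq_mk, sub_self,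
      mul_zero, add_zero, Real.sqrt_mul_self_eq_abs]
    congr 1; ring
  have hprojγ : ∀ s hs t, s - 1 ≤ D → projParam γ (Icc 0 D) (P s hs t) = s - 1 := by
    intro s hs t hsD
    have hmem : s - 1 ∈ Icc 0 D := ⟨by linarith, hsD⟩
    refine hX.projParam_eq hγgeo isClosed_Icc ordConnected_Icc ⟨0, le_rfl, hD0⟩ hmem
      fun t' ht' => ?_
    rw [hγ]
    simp only
    rw [hdist _ hs _ _ (hm (s - 1)) _, hdist _ hs _ _ (hm t') _, max_eq_left hmem.1]
    refine le_trans (le_of_eq ?_) (Complex.abs_im_le_norm _)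
    rw [Complex.norm_def, Complex.normSq_mk, show s - (1 + (s - 1)) = 0 by ring, mul_zero, zero_add,
      Real.sqrt_mul_self_eq_abs]
  have hprojv : ∀ s hs t, projParam (P 1 le_rfl) univ (P s hs t) = t := by
    intro s hs t
    refine hX.projParam_eq (hvert 1 le_rfl) isClosed_univ ordConnected_univ univ_nonempty
      (mem_univ _) fun t' _ => ?_
    rw [hdist _ hs _ _ le_rfl t, hdist _ hs _ _ le_rfl t']
    refine le_trans (le_of_eq ?_) (Complex.abs_re_le_norm _)
    rw [Complex.norm_def, Complex.normSq_mk, sub_self, mul_zero, add_zero,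
      Real.sqrt_mul_self_eq_abs]
  obtain ⟨v, hvn, hv, hmeet⟩ := Curtain.exists_dual_chain hX (hvert 1 le_rfl) isClosed_univ
    ordConnected_univ (mem_univ (0 : ℝ)) (mem_univ (2 * ((L + 1 : ℕ) : ℝ))) (n := L + 1)
    (by linarith)
  -- Projecting the vertical line with first coordinate s to the line s = 1 keeps t, so each such
  -- line meets all the chosen dual curtains. The values s = 1 and s = `q.radius` give the two ends
  -- of the rungs.
  have hside : ∀ c ∈ v, ∀ s hs, ∃ t, P s hs t ∈ c.carrier := by
    intro c hc s hs
    obtain ⟨z, hz, t, -, rfl⟩ := hmeet c hc (P s hs '' univ)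
      (isPreconnected_univ.image _ (hvert s hs).continuousOn) _ ⟨0, mem_univ _, rfl⟩ _
      ⟨2 * ((L + 1 : ℕ) : ℝ), mem_univ _, rfl⟩ (hprojv s hs 0).le (hprojv s hs _).ge
    exact ⟨t, hz⟩
  obtain ⟨l, hl, e⟩ := exists_length_add_one_eq hX L hq
  have e0 : γ 0 = axis p q.angle := by
    rw [hγ, axis, ← flat_one q.angle (by simp)]
    simp only [hP, max_self]
    congr 2
    apply Complex.ext <;> simp
  have e1 : γ D = base q := by
    conv_rhs => rw [← flat_radius q (by simpa using hr)]
    rw [hγ]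
    simp only [hP, max_eq_left hD0]
    congr 2
    apply Complex.ext <;> simp [hD]
  have := Curtain.length_le_of_ladder hX hD0 hγgeo hv hvn (l := l) (fun c hc => by
    obtain ⟨t, ht⟩ := hside c hc 1 le_rfl
    obtain ⟨t', ht'⟩ := hside c hc q.radius hr
    exact ⟨_, ht, _, ht', by rw [hprojγ 1 le_rfl t (by linarith)]; ring,
      hprojγ q.radius hr t' le_rfl⟩)
    (by rw [e0, e1]; exact hl)
  rw [e]
  have h2 : (l.length : ℝ) ≤ 4 * L + 7 := by exact_mod_cast this
  linarith

end RayGluing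

/-! ### Metrics that are close to the metric of a line with rays attached -/

namespace IsMetric

variable {X : Type*} {d : X → X → ℝ} (hd : IsMetric d)
include hd

theorem nonneg (x y : X) : 0 ≤ d x y := by
  have h1 := hd.2.2 x y x
  rw [(hd.1 x x).2 rfl, hd.2.1 y x] at h1
  linarith

theorem gromovProduct_le_add (o o' x y : X) :
    gromovProduct d o x y ≤ gromovProduct d o' x y + d o o' := by
  unfold gromovProduct
  linarith [hd.2.2 o o' x, hd.2.2 o o' y]

/-- The four point condition at one base point implies it at all base points. -/
theorem isGromovHyperbolic_of_base {o : X} {δ : ℝ} (h : ∀ x y z,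
    min (gromovProduct d o x y) (gromovProduct d o y z) - δ ≤ gromovProduct d o x z) :
    IsGromovHyperbolic d := by
  have hc : ∀ x y, gromovProduct d o x y = gromovProduct d o y x := fun x y => by
    unfold gromovProduct; rw [hd.2.1 x y]; ring
  refine ⟨2 * δ, fun w x y z => ?_⟩
  have h1 := h x y z
  have h2 := h x w z
  have h3 := h y x w
  have h4 := h y z w
  rw [hc y x] at h3
  rw [hc w z] at h2
  -- Written with sums of two products, the four point inequality no longer depends on the base
  -- point; this symmetric form is what carries over to w. Two applications of the hypothesis
  -- account for 2δ.
  have key : min (gromovProduct d o x y + gromovProduct d o z w)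
      (gromovProduct d o y z + gromovProduct d o x w) - 2 * δ ≤
      gromovProduct d o x z + gromovProduct d o y w := by
    generalize gromovProduct d o x y = p at *
    generalize gromovProduct d o y z = q at *
    generalize gromovProduct d o x w = r at *
    generalize gromovProduct d o z w = s at *
    have m1 := min_le_left (p + s) (q + r)
    have m2 := min_le_right (p + s) (q + r)
    rcases le_total p q with a | a <;> rcases le_total r s with b | b <;>
      rcases le_total p r with c | c <;> rcases le_total q s with e | e <;>
      simp only [min_eq_left, min_eq_right, a, b, c, e] at h1 h2 h3 h4 <;> linarith
  rw [sub_le_iff_le_add] at key ⊢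
  rw [min_le_iff] at key ⊢
  unfold gromovProduct at key ⊢
  rw [hd.2.1 w x, hd.2.1 w y, hd.2.1 w z]
  rcases key with k | k
  · left; linarith
  · right; linarith

end IsMetric

/-- The Gromov product on the real line with base point `0`. -/
def lineProduct (a b : ℝ) : ℝ := (|a| + |b| - |a - b|) / 2

theorem lineProduct_comm (a b : ℝ) : lineProduct a b = lineProduct b a := by
  unfold lineProduct; rw [abs_sub_comm]; ring

theorem lineProduct_le_left (a b : ℝ) : lineProduct a b ≤ |a| := by
  unfold lineProduct
  have := abs_sub_abs_le_abs_sub b a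
  rw [abs_sub_comm] at this
  linarith

theorem lineProduct_self (a : ℝ) : lineProduct a a = |a| := by
  simp [lineProduct]

theorem half_add_sub_abs_sub (a b : ℝ) : (a + b - |a - b|) / 2 = min a b := by
  rcases le_total a b with h | h
  · rw [abs_of_nonpos (by linarith), min_eq_left h]; ring
  · rw [abs_of_nonneg (by linarith), min_eq_right h]; ring

theorem lineProduct_of_nonneg {a b : ℝ} (ha : 0 ≤ a) (hb : 0 ≤ b) :
    lineProduct a b = min a b := by
  unfold lineProduct
  rw [abs_of_nonneg ha, abs_of_nonneg hb, half_add_sub_abs_sub]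

theorem lineProduct_neg_neg (a b : ℝ) : lineProduct (-a) (-b) = lineProduct a b := by
  unfold lineProduct
  rw [abs_neg, abs_neg, show -a - -b = -(a - b) by ring, abs_neg]

theorem lineProduct_of_nonpos_of_nonneg {a b : ℝ} (ha : a ≤ 0) (hb : 0 ≤ b) :
    lineProduct a b = 0 := by
  unfold lineProduct
  rw [abs_of_nonpos ha, abs_of_nonneg hb, abs_of_nonpos (by linarith)]
  ring

theorem lineProduct_zero (a : ℝ) : lineProduct 0 a = 0 := by
  simp [lineProduct]

theorem lineProduct_eq_min_of_pos {a b : ℝ} (h : 0 < lineProduct a b) :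
    lineProduct a b = min |a| |b| := by
  rcases le_total 0 a with ha | ha <;> rcases le_total 0 b with hb | hb
  · rw [lineProduct_of_nonneg ha hb, abs_of_nonneg ha, abs_of_nonneg hb]
  · rw [lineProduct_comm, lineProduct_of_nonpos_of_nonneg hb ha] at h
    exact absurd h (lt_irrefl _)
  · rw [lineProduct_of_nonpos_of_nonneg ha hb] at h
    exact absurd h (lt_irrefl _)
  · rw [← lineProduct_neg_neg, lineProduct_of_nonneg (by linarith) (by linarith), abs_of_nonpos ha,
      abs_of_nonpos hb]

theorem min_lineProduct_le (a b c : ℝ) :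
    min (lineProduct a b) (lineProduct b c) ≤ lineProduct a c := by
  rw [min_le_iff]
  unfold lineProduct
  rcases abs_cases a with ⟨h1, _⟩ | ⟨h1, _⟩ <;> rcases abs_cases c with ⟨h2, _⟩ | ⟨h2, _⟩ <;>
  rcases abs_cases b with ⟨h3, _⟩ | ⟨h3, _⟩ <;> rw [h1, h2, h3] <;>
  rcases abs_cases (a - c) with ⟨h4, _⟩ | ⟨h4, _⟩ <;>
  rcases abs_cases (a - b) with ⟨h5, _⟩ | ⟨h5, _⟩ <;>
  rcases abs_cases (b - c) with ⟨h6, _⟩ | ⟨h6, _⟩ <;> rw [h4, h5, h6] <;>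
  first | (left; linarith) | (right; linarith)

/-! ### The approximating tree and its boundary -/

/-- `x` and `y` lie on the same attached ray, where `br` gives the number of the ray on which a
point lies (`none` for the points of the line). -/
def OnCommonRay {X : Type*} (br : X → Option ℕ) (x y : X) : Prop := br x = br y ∧ br x ≠ none

/-- The metric `d` is, up to the error `K`, that of a line with rays attached: `φ x` is the
position on the line of the foot point of `x` and `E x` the distance of `x` to the line. -/
structure TreeLike {X : Type*} (d : X → X → ℝ) (o : X) (br : X → Option ℕ) (E φ : X → ℝ)
    (K : ℝ) : Prop where
  metric : IsMetric d
  E_nonneg : ∀ x, 0 ≤ E x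
  br_base : br o = none
  E_base : E o = 0
  φ_base : φ o = 0
  φ_eq : ∀ {x y}, OnCommonRay br x y → φ x = φ y
  dist_same : ∀ {x y}, OnCommonRay br x y → |d x y - (|E x - E y|)| ≤ K
  dist_other : ∀ {x y}, ¬ OnCommonRay br x y → |d x y - (E x + |φ x - φ y| + E y)| ≤ K

open Classical in
/-- The Gromov product of the approximating tree. -/
def treeProduct {X : Type*} (br : X → Option ℕ) (E φ : X → ℝ) (x y : X) : ℝ :=
  if OnCommonRay br x y then |φ x| + min (E x) (E y) else lineProduct (φ x) (φ y)

namespace OnCommonRay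

variable {X : Type*} {br : X → Option ℕ} {x y z : X}

theorem symm (h : OnCommonRay br x y) : OnCommonRay br y x := ⟨h.1.symm, h.1 ▸ h.2⟩

theorem trans (h : OnCommonRay br x y) (h' : OnCommonRay br y z) : OnCommonRay br x z :=
  ⟨h.1.trans h'.1, h.2⟩

end OnCommonRay

namespace TreeLike

variable {X : Type*} {d : X → X → ℝ} {o : X} {br : X → Option ℕ} {E φ : X → ℝ} {K : ℝ}
  (h : TreeLike d o br E φ K)
include h

theorem treeProduct_comm (x y : X) : treeProduct br E φ x y = treeProduct br E φ y x := by
  unfold treeProduct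
  by_cases hs : OnCommonRay br x y
  · rw [if_pos hs, if_pos hs.symm, h.φ_eq hs, min_comm]
  · rw [if_neg hs, if_neg fun h' => hs h'.symm, lineProduct_comm]

/-- Three distances enter the Gromov product, each known up to K, and their combination is halved.
-/
theorem abs_gromovProduct_sub_le (x y : X) :
    |gromovProduct d o x y - treeProduct br E φ x y| ≤ 3 / 2 * K := by
  have h0 : ∀ x, |d o x - (|φ x| + E x)| ≤ K := fun x => by
    have := h.dist_other (x := o) (y := x) fun h' => h'.2 h.br_base
    rwa [h.E_base, h.φ_base, zero_add, zero_sub, abs_neg] at this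
  have hx := h0 x
  have hy := h0 y
  unfold gromovProduct treeProduct
  split_ifs with hs
  · have hxy := h.dist_same hs
    rw [h.φ_eq hs] at hx ⊢
    rw [← half_add_sub_abs_sub]
    rw [abs_le] at *
    constructor <;> linarith [hx.1, hx.2, hy.1, hy.2, hxy.1, hxy.2]
  · have hxy := h.dist_other hs
    unfold lineProduct
    rw [abs_le] at *
    constructor <;> linarith [hx.1, hx.2, hy.1, hy.2, hxy.1, hxy.2]

/-- The tree is 0-hyperbolic. On a common ray this is a property of minima; a point on another
branch sees two points of the same ray under the same product; everything else takes place on the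
line. -/
theorem min_treeProduct_le (x y z : X) :
    min (treeProduct br E φ x y) (treeProduct br E φ y z) ≤ treeProduct br E φ x z := by
  unfold treeProduct
  by_cases h1 : OnCommonRay br x y <;> by_cases h2 : OnCommonRay br y z
  · rw [if_pos h1, if_pos h2, if_pos (h1.trans h2), h.φ_eq h1, min_add_add_left]
    exact add_le_add_right (le_min ((min_le_left _ _).trans (min_le_left _ _))
      ((min_le_right _ _).trans (min_le_right _ _))) _
  · rw [if_neg h2, if_neg fun h3 : OnCommonRay br x z => h2 (h1.symm.trans h3), h.φ_eq h1]
    exact min_le_right _ _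
  · rw [if_neg h1, if_neg fun h3 : OnCommonRay br x z => h1 (h3.trans h2.symm), ← h.φ_eq h2]
    exact min_le_left _ _
  · rw [if_neg h1, if_neg h2]
    split_ifs with h3
    · refine (min_le_left _ _).trans ((lineProduct_le_left _ _).trans ?_)
      linarith [le_min (h.E_nonneg x) (h.E_nonneg z)]
    · exact min_lineProduct_le _ _ _

theorem isGromovHyperbolic : IsGromovHyperbolic d := by
  refine h.metric.isGromovHyperbolic_of_base (o := o) (δ := 3 * K) fun x y z => ?_
  have hxy := abs_le.1 (h.abs_gromovProduct_sub_le x y)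
  have hyz := abs_le.1 (h.abs_gromovProduct_sub_le y z)
  have hxz := abs_le.1 (h.abs_gromovProduct_sub_le x z)
  rw [sub_le_iff_le_add, min_le_iff]
  rcases min_le_iff.1 (h.min_treeProduct_le x y z) with h1 | h1
  · left; linarith
  · right; linarith

theorem gromovProduct_le (o' x y : X) :
    gromovProduct d o' x y ≤ treeProduct br E φ x y + (3 / 2 * K + d o' o) := by
  linarith [h.metric.gromovProduct_le_add o' o x y, (abs_le.1 (h.abs_gromovProduct_sub_le x y)).2]

theorem le_gromovProduct (o' x y : X) :
    treeProduct br E φ x y - (3 / 2 * K + d o o') ≤ gromovProduct d o' x y := by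
  linarith [h.metric.gromovProduct_le_add o o' x y, (abs_le.1 (h.abs_gromovProduct_sub_le x y)).1]

theorem gromovEquiv_iff {u v : ℕ → X} : GromovEquiv d u v ↔
    Tendsto (fun p : ℕ × ℕ => treeProduct br E φ (u p.1) (v p.2)) atTop atTop := by
  constructor
  · intro he
    refine tendsto_atTop_mono (fun p => ?_)
      (tendsto_atTop_add_const_right _ (-(3 / 2 * K + d o o)) (he o))
    linarith [h.gromovProduct_le o (u p.1) (v p.2)]
  · intro he o'
    refine tendsto_atTop_mono (fun p => ?_)
      (tendsto_atTop_add_const_right _ (-(3 / 2 * K + d o o')) he)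
    linarith [h.le_gromovProduct o' (u p.1) (v p.2)]

theorem equivalence_gromovEquiv :
    Equivalence fun u v : GromovSeq d => GromovEquiv d u.1 v.1 where
  refl u := u.2
  symm {u v} he := by
    rw [h.gromovEquiv_iff] at he ⊢
    have hsw : Tendsto (Prod.swap : ℕ × ℕ → ℕ × ℕ) atTop atTop := by
      rw [← prod_atTop_atTop_eq]; exact tendsto_snd.prodMk tendsto_fst
    refine (he.comp hsw).congr fun p => ?_
    exact h.treeProduct_comm _ _
  trans {u v w} he hf := by
    rw [h.gromovEquiv_iff] at he hf ⊢
    rw [tendsto_atTop] at he hf ⊢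
    intro b
    obtain ⟨⟨m, n⟩, hm⟩ := eventually_atTop.1 (he b)
    obtain ⟨⟨m', n'⟩, hm'⟩ := eventually_atTop.1 (hf b)
    -- The two products are compared through one term of the middle sequence, with index large
    -- enough for both.
    refine eventually_atTop.2 ⟨(m, n'), fun q hq => ?_⟩
    refine le_trans (le_min (hm (q.1, max n m') ⟨hq.1, le_max_left _ _⟩)
      (hm' (max n m', q.2) ⟨le_max_right _ _, hq.2⟩)) (h.min_treeProduct_le _ _ _)

theorem mk_eq_mk_iff {u v : GromovSeq d} : (Quot.mk _ u : GromovBoundary d) = Quot.mk _ v ↔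
    Tendsto (fun p : ℕ × ℕ => treeProduct br E φ (u.1 p.1) (v.1 p.2)) atTop atTop := by
  rw [← h.gromovEquiv_iff]
  exact ⟨fun e => h.equivalence_gromovEquiv.eqvGen_iff.1 (Quot.eqvGen_exact e),
    fun e => Quot.sound e⟩

/-- A path along which the tree products tend to infinity converges at infinity. -/
theorem exists_isEndpoint {γ : ℝ → X}
    (hγ : Tendsto (fun q : ℝ × ℝ => treeProduct br E φ (γ q.1) (γ q.2)) atTop atTop) :
    ∃ he : GromovEquiv d (fun n : ℕ => γ n) (fun n : ℕ => γ n),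
      GromovBoundary.IsEndpoint γ (Quot.mk _ (⟨fun n => γ n, he⟩ : GromovSeq d)) := by
  have key : ∀ s t : ℕ → ℝ, Tendsto s atTop atTop → Tendsto t atTop atTop →
      GromovEquiv d (fun n => γ (s n)) (fun n => γ (t n)) := by
    intro s t hs ht
    rw [h.gromovEquiv_iff]
    have : Tendsto (fun q : ℕ × ℕ => (s q.1, t q.2)) atTop atTop := by
      rw [← prod_atTop_atTop_eq, ← prod_atTop_atTop_eq]; exact hs.prodMap ht
    exact hγ.comp this
  have hc : Tendsto (fun n : ℕ => (n : ℝ)) atTop atTop := tendsto_natCast_atTop_atTop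
  exact ⟨key _ _ hc hc, fun t ht => ⟨key _ _ ht ht, Quot.sound (key _ _ ht hc)⟩⟩

/-- If the products `(u_m|v_n)` are eventually bounded below, then so is the product of the
classes of `u` and `v`. -/
theorem le_product {u v : GromovSeq d} {R : ℝ}
    (hR : ∀ᶠ p : ℕ × ℕ in atTop, R ≤ treeProduct br E φ (u.1 p.1) (v.1 p.2)) (o' : X) :
    ((R - (3 / 2 * K + d o o') : ℝ) : EReal) ≤ GromovBoundary.product o'
      (Quot.mk _ u : GromovBoundary d) (Quot.mk _ v) := by
  refine le_trans ?_ (le_sSup ⟨u, v, rfl, rfl, rfl⟩)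
  refine le_liminf_of_le (by isBoundedDefault) (hR.mono fun p hp => ?_)
  rw [EReal.coe_le_coe_iff]
  linarith [h.le_gromovProduct o' (u.1 p.1) (v.1 p.2)]

/-- If all rays are attached at the base point, then the boundary is discrete. -/
theorem isOpen_singleton (hφ : ∀ x, br x ≠ none → φ x = 0) (a : GromovBoundary d) :
    IsOpen ({a} : Set (GromovBoundary d)) := by
  -- In a star, two points with positive product are on the same branch, so their product is the
  -- smaller of the products of each point with itself.
  have hmin : ∀ x y, 0 < treeProduct br E φ x y →
      treeProduct br E φ x y = min (treeProduct br E φ x x) (treeProduct br E φ y y) := by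
    intro x y hxy
    have hself : ∀ z, treeProduct br E φ z z = if br z = none then |φ z| else E z := by
      intro z
      unfold treeProduct OnCommonRay
      by_cases hz : br z = none
      · rw [if_neg fun h' => h'.2 hz, if_pos hz, lineProduct_self]
      · rw [if_pos ⟨rfl, hz⟩, if_neg hz, hφ z hz, abs_zero, zero_add, min_self]
    rw [hself, hself]
    unfold treeProduct at hxy ⊢
    by_cases hs : OnCommonRay br x y
    · rw [if_pos hs, if_neg hs.2, if_neg hs.symm.2, hφ x hs.2, abs_zero, zero_add]
    · rw [if_neg hs] at hxy ⊢
      have hne : ∀ z w, 0 < lineProduct (φ z) (φ w) → br z = none := by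
        intro z w hzw
        by_contra hz
        rw [hφ z hz, lineProduct_zero] at hzw
        exact lt_irrefl _ hzw
      rw [if_pos (hne x y hxy), if_pos (hne y x (by rwa [lineProduct_comm])),
        lineProduct_eq_min_of_pos hxy]
  rintro ξ rfl o'
  -- Beyond this threshold the tree products of suitable representatives are eventually positive,
  -- hence tend to infinity by `hmin`, and the classes agree. The summand 1 gives the strict
  -- inequality needed to choose representatives from the supremum.
  refine ⟨3 / 2 * K + d o' o + 1, fun η hη => ?_⟩
  have hlt : ((3 / 2 * K + d o' o : ℝ) : EReal) < GromovBoundary.product o' ξ η :=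
    lt_of_lt_of_le (EReal.coe_lt_coe_iff.2 (lt_add_one _)) hη
  obtain ⟨c, ⟨u, v, rfl, rfl, rfl⟩, hc⟩ := lt_sSup_iff.1 hlt
  have hev := eventually_lt_of_lt_liminf hc (by isBoundedDefault)
  refine (h.mk_eq_mk_iff.2 ?_).symm
  have hdiag : ∀ w : GromovSeq d,
      Tendsto (fun n => treeProduct br E φ (w.1 n) (w.1 n)) atTop atTop := fun w =>
    (h.gromovEquiv_iff.1 w.2).comp tendsto_atTop_diagonal
  have hfst : Tendsto (Prod.fst : ℕ × ℕ → ℕ) atTop atTop := by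
    rw [← prod_atTop_atTop_eq]; exact tendsto_fst
  have hsnd : Tendsto (Prod.snd : ℕ × ℕ → ℕ) atTop atTop := by
    rw [← prod_atTop_atTop_eq]; exact tendsto_snd
  have hu := tendsto_atTop.1 ((hdiag u).comp hfst)
  have hv := tendsto_atTop.1 ((hdiag v).comp hsnd)
  refine tendsto_atTop.2 fun b => ?_
  filter_upwards [hev, hu b, hv b] with q hq hqu hqv
  rw [EReal.coe_lt_coe_iff] at hq
  rw [hmin _ _ (by linarith [h.gromovProduct_le o' (u.1 q.1) (v.1 q.2)])]
  exact le_min hqu hqv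

end TreeLike

/-! ### The curtain models of parking lots with glued rays -/

namespace RayGluing

open ParkingLot

variable {p : ℕ → ParkingLot}

/-- The number of the glued ray containing a point. -/
def rayIndex : RayGluing p → Option ℕ
  | base _ => none
  | ray i _ _ => some i

/-- The closest point of the parking lot. -/
def foot : RayGluing p → RayGluing p
  | base q => base q
  | ray i _ _ => base (p i)

/-- The position on the axis, measured by the metric of the curtain model. -/
def axisCoord (p : ℕ → ParkingLot) (lam : ℕ → ℝ) (t : ℝ) : ℝ :=
  if 0 ≤ t then curtainDist (RayGluing p) lam (axis p 0) (axis p t)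
  else -curtainDist (RayGluing p) lam (axis p 0) (axis p t)

/-- The distance to the axis in the curtain model. -/
def axisDist (lam : ℕ → ℝ) (x : RayGluing p) : ℝ :=
  curtainDist (RayGluing p) lam x (axis p (ang x))

variable {lam : ℕ → ℝ} (hlam : IsCurtainWeight lam)
include hlam

/-- Points of the axis lie on one geodesic, so quasi-additivity together with the triangle
inequality makes the signed distance from the origin an almost isometric coordinate. -/
theorem abs_curtainDist_axis_sub_le (s t : ℝ) :
    |curtainDist (RayGluing p) lam (axis p s) (axis p t) -
      (|axisCoord p lam s - axisCoord p lam t|)| ≤ weightSum lam 3 7 := by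
  have hX : HasCNPoints (RayGluing p) := hasCNPoints_parkingLot
  have hd := isMetric_curtainDist hX hlam
  wlog hst : s ≤ t generalizing s t
  · rw [hd.2.1 (axis p s), abs_sub_comm (axisCoord p lam s)]
    exact this t s (le_of_not_ge hst)
  have hb : ∀ {a b c : ℝ}, a ≤ b → b ≤ c → LiesBetween (axis p a) (axis p b) (axis p c) := by
    intro a b c hab hbc
    unfold LiesBetween
    rw [isGeodesicOn_axis a (mem_univ _) b (mem_univ _), isGeodesicOn_axis b (mem_univ _) c
      (mem_univ _), isGeodesicOn_axis a (mem_univ _) c (mem_univ _), abs_of_nonpos (by linarith),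
      abs_of_nonpos (by linarith), abs_of_nonpos (by linarith)]
    ring
  unfold axisCoord
  rcases le_or_gt 0 s with h0 | h0
  · rw [if_pos h0, if_pos (h0.trans hst)]
    have h1 := curtainDist_add_le hX hlam (hb h0 hst)
    have h2 := hd.2.2 (axis p 0) (axis p s) (axis p t)
    have h3 := hd.2.2 (axis p 0) (axis p t) (axis p s)
    rw [hd.2.1 (axis p t) (axis p s)] at h3
    rcases abs_cases (curtainDist (RayGluing p) lam (axis p 0) (axis p s) -
      curtainDist (RayGluing p) lam (axis p 0) (axis p t)) with ⟨e, h4⟩ | ⟨e, h4⟩ <;>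
      rw [e, abs_le] <;>
      constructor <;> linarith [hd.nonneg (axis p s) (axis p t)]
  rw [if_neg (not_le.2 h0)]
  rcases le_or_gt 0 t with h0' | h0'
  · rw [if_pos h0']
    have h1 := curtainDist_add_le hX hlam (hb h0.le h0')
    have h2 := hd.2.2 (axis p s) (axis p 0) (axis p t)
    rw [hd.2.1 (axis p s) (axis p 0)] at h1 h2
    have h3 := hd.nonneg (axis p 0) (axis p s)
    have h4 := hd.nonneg (axis p 0) (axis p t)
    rw [abs_of_nonpos (a := -_ - _) (by linarith), abs_le]
    constructor <;> linarith
  · rw [if_neg (not_le.2 h0')]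
    have h1 := curtainDist_add_le hX hlam (hb hst h0'.le)
    have h2 := hd.2.2 (axis p s) (axis p t) (axis p 0)
    have h3 := hd.2.2 (axis p t) (axis p s) (axis p 0)
    rw [hd.2.1 (axis p t) (axis p s)] at h3
    rw [hd.2.1 (axis p s) (axis p 0), hd.2.1 (axis p t) (axis p 0)] at h1 h2 h3
    rcases abs_cases (-curtainDist (RayGluing p) lam (axis p 0) (axis p s) -
      -curtainDist (RayGluing p) lam (axis p 0) (axis p t)) with ⟨e, h4⟩ | ⟨e, h4⟩ <;>
      rw [e, abs_le] <;>
      constructor <;> linarith [hd.nonneg (axis p s) (axis p t)]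

theorem curtainDist_foot_axis_le (x : RayGluing p) :
    curtainDist (RayGluing p) lam (foot x) (axis p (ang x)) ≤ weightSum lam 4 8 := by
  have hX : HasCNPoints (RayGluing p) := hasCNPoints_parkingLot
  have key : ∀ q : ParkingLot,
      curtainDist (RayGluing p) lam (base q) (axis p q.angle) ≤ weightSum lam 4 8 := fun q => by
    rw [(isMetric_curtainDist hX hlam).2.1]
    exact curtainDist_le_of_forall_le hX hlam fun L => curtainDistL_radial_le L q
  rcases x with q | ⟨i, s, hs⟩
  · exact key q
  · exact key (p i)

theorem abs_curtainDist_foot_sub_le (x : RayGluing p) :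
    |curtainDist (RayGluing p) lam x (foot x) - axisDist lam x| ≤ weightSum lam 4 8 := by
  have hd := isMetric_curtainDist (X := RayGluing p) hasCNPoints_parkingLot hlam
  have h1 := curtainDist_foot_axis_le hlam x
  have h2 := hd.2.2 x (foot x) (axis p (ang x))
  have h3 := hd.2.2 x (axis p (ang x)) (foot x)
  rw [hd.2.1 (axis p (ang x)) (foot x)] at h3
  unfold axisDist
  rw [abs_le]
  constructor <;> linarith

/-- The foot of every point is within a bounded distance of the axis in the model, and geodesics
between different branches pass through the feet, so distances split into two distances to the axis
and one along it. The larger error occurs for distinct branches: quasi-additivity is used twice, the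
coordinate of the axis once, and each foot is exchanged twice for its point on the axis. -/
theorem treeLike : TreeLike (curtainDist (RayGluing p) lam) (axis p 0) rayIndex (axisDist lam)
    (fun x => axisCoord p lam (ang x)) (3 * weightSum lam 3 7 + 4 * weightSum lam 4 8) := by
  have hX : HasCNPoints (RayGluing p) := hasCNPoints_parkingLot
  have hd := isMetric_curtainDist hX hlam
  have hdd := fun x => (hd.1 x x).2 rfl
  have h1 := (hd.nonneg _ _).trans (curtainDist_foot_axis_le hlam (axis p 0))
  have h2 := (abs_nonneg _).trans (abs_curtainDist_axis_sub_le (p := p) hlam 0 0)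
  refine ⟨hd, fun x => hd.nonneg _ _, rfl, hdd _, ?_, ?_, ?_, ?_⟩
  · change axisCoord p lam 0 = 0
    rw [axisCoord, if_pos le_rfl, hdd]
  · rintro (q | ⟨i, s, hs⟩) (q' | ⟨j, t, ht⟩) ⟨he, hne⟩
    · exact absurd rfl hne
    · exact absurd rfl hne
    · exact absurd he (by simp [rayIndex])
    · obtain rfl : i = j := by simpa [rayIndex] using he
      rfl
  · rintro (q | ⟨i, s, hs⟩) (q' | ⟨j, t, ht⟩) ⟨he, hne⟩
    · exact absurd rfl hne
    · exact absurd rfl hne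
    · exact absurd he (by simp [rayIndex])
    · obtain rfl : i = j := by simpa [rayIndex] using he
      clear he hne
      wlog hst : s ≤ t generalizing s t
      · rw [hd.2.1, abs_sub_comm (axisDist lam _)]
        exact this t ht s hs (le_of_not_ge hst)
      have hb : LiesBetween (base (p i) : RayGluing p) (ray i s hs) (ray i t ht) := by
        unfold LiesBetween
        rw [dist_base_ray, dist_base_ray, dist_ray_ray_self, abs_of_nonpos (by linarith)]
        ring
      have h3 := curtainDist_add_le hX hlam hb
      have h4 := abs_le.1 (abs_curtainDist_foot_sub_le hlam (ray i s hs : RayGluing p))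
      have h5 := abs_le.1 (abs_curtainDist_foot_sub_le hlam (ray i t ht : RayGluing p))
      change -_ ≤ curtainDist (RayGluing p) lam _ (base (p i)) - _ ∧
        curtainDist (RayGluing p) lam _ (base (p i)) - _ ≤ _ at h4
      change -_ ≤ curtainDist (RayGluing p) lam _ (base (p i)) - _ ∧
        curtainDist (RayGluing p) lam _ (base (p i)) - _ ≤ _ at h5
      have h6 := hd.2.2 (base (p i)) (ray i s hs) (ray i t ht)
      have h7 := hd.2.2 (base (p i)) (ray i t ht) (ray i s hs)
      rw [hd.2.1 (ray i t ht) (ray i s hs)] at h7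
      rw [hd.2.1 (base (p i)), hd.2.1 (base (p i))] at h3 h6 h7
      have h8 := hd.nonneg (ray i s hs) (ray i t ht)
      rcases abs_cases (axisDist lam (ray i s hs : RayGluing p) - axisDist lam (ray i t ht))
        with ⟨e, h9⟩ | ⟨e, h9⟩ <;> rw [e, abs_le] <;>
        constructor <;> linarith [h4.1, h4.2, h5.1, h5.2]
  · intro x y hxy
    have hx : LiesBetween x (foot x) y := by
      unfold LiesBetween
      rcases x with q | ⟨i, s, hs⟩
      · rw [foot, dist_self, zero_add]
      · have hy : OffRay i y := by
          rintro t ht rfl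
          exact hxy ⟨rfl, by simp [rayIndex]⟩
        rw [hy.dist_ray, foot, (offRay_base i _).dist_ray, dist_self, add_zero]
    have hy : LiesBetween (foot x) (foot y) y := by
      unfold LiesBetween
      obtain ⟨q, hq⟩ : ∃ q, foot x = base q := by
        rcases x with q | ⟨i, s, hs⟩
        exacts [⟨q, rfl⟩, ⟨p i, rfl⟩]
      rw [hq]
      rcases y with q' | ⟨j, t, ht⟩
      · rw [foot, dist_self, add_zero]
      · rw [foot, dist_base_ray, dist_base_ray, dist_base_base, dist_self, zero_add]
    have a1 := curtainDist_add_le hX hlam hx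
    have a2 := curtainDist_add_le hX hlam hy
    have a3 := hd.2.2 x (foot x) y
    have a4 := hd.2.2 (foot x) (foot y) y
    have a5 := abs_le.1 (abs_curtainDist_foot_sub_le hlam x)
    have a6 := abs_le.1 (abs_curtainDist_foot_sub_le hlam y)
    have a7 := curtainDist_foot_axis_le hlam x
    have a8 := curtainDist_foot_axis_le hlam y
    have b1 := hd.2.2 (foot x) (axis p (ang x)) (foot y)
    have b2 := hd.2.2 (axis p (ang x)) (axis p (ang y)) (foot y)
    have b3 := hd.2.2 (axis p (ang x)) (foot x) (axis p (ang y))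
    have b4 := hd.2.2 (foot x) (foot y) (axis p (ang y))
    rw [hd.2.1 (axis p (ang y)) (foot y)] at b2
    rw [hd.2.1 (axis p (ang x)) (foot x)] at b3
    rw [hd.2.1 (foot y) y] at a2 a4
    have b5 := abs_le.1 (abs_curtainDist_axis_sub_le (p := p) hlam (ang x) (ang y))
    rw [abs_le]
    constructor <;> linarith [a5.1, a5.2, a6.1, a6.2, b5.1, b5.2]

theorem axisCoord_nonneg {t : ℝ} (ht : 0 ≤ t) : 0 ≤ axisCoord p lam t := by
  rw [axisCoord, if_pos ht]
  exact (isMetric_curtainDist hasCNPoints_parkingLot hlam).nonneg _ _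

/-- The term L = 9 of the series suffices, as it grows linearly along the axis by
`le_curtainDistL_axis`. -/
theorem tendsto_axisCoord : Tendsto (axisCoord p lam) atTop atTop := by
  have h9 := (hlam.1 9 (by norm_num)).1
  have h1 : Tendsto (fun t : ℝ => lam 9 * ((⌊(t - 1) / 10⌋₊ : ℕ) : ℝ)) atTop atTop := by
    refine Tendsto.const_mul_atTop h9 (tendsto_natCast_atTop_atTop.comp
      (tendsto_nat_floor_atTop.comp ?_))
    exact (tendsto_atTop_add_const_right _ (-1) tendsto_id).atTop_div_const (by norm_num)
  refine tendsto_atTop_mono' _ ?_ h1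
  filter_upwards [eventually_ge_atTop 1] with t ht
  rw [axisCoord, if_pos (by linarith)]
  refine le_trans ?_ (mul_curtainDistL_le hasCNPoints_parkingLot hlam (by norm_num : 1 ≤ 9) _ _)
  refine mul_le_mul_of_nonneg_left (le_curtainDistL_axis ?_) h9.le
  have := Nat.floor_le (a := (t - 1) / 10) (by linarith)
  linarith

/-- The term L = 1 suffices on a glued ray; replacing its origin by a point of the axis costs a
bounded amount. -/
theorem tendsto_axisDist_gluedRay (i : ℕ) :
    Tendsto (fun t => axisDist lam (gluedRay p i t)) atTop atTop := by
  have hd := isMetric_curtainDist (X := RayGluing p) hasCNPoints_parkingLot hlam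
  have h9 := (hlam.1 1 le_rfl).1
  have h1 : Tendsto (fun t : ℝ => lam 1 * ((⌊(t - 1) / 2⌋₊ : ℕ) : ℝ) + -weightSum lam 4 8)
      atTop atTop := by
    refine tendsto_atTop_add_const_right _ _ (Tendsto.const_mul_atTop h9
      (tendsto_natCast_atTop_atTop.comp (tendsto_nat_floor_atTop.comp ?_)))
    exact (tendsto_atTop_add_const_right _ (-1) tendsto_id).atTop_div_const (by norm_num)
  refine tendsto_atTop_mono' _ ?_ h1
  filter_upwards [eventually_ge_atTop 1] with t ht
  have h2 := abs_le.1 (abs_curtainDist_foot_sub_le hlam (gluedRay p i t))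
  have h3 : foot (gluedRay p i t) = base (p i) := by
    rw [gluedRay_of_pos i (by linarith)]; rfl
  rw [h3, hd.2.1] at h2
  have h4 := mul_curtainDistL_le hasCNPoints_parkingLot hlam (le_refl 1) (base (p i))
    (gluedRay p i t)
  have h5 := Nat.floor_le (a := (t - 1) / 2) (by linarith)
  have h6 := mul_le_mul_of_nonneg_left (le_curtainDistL_gluedRay (p := p) (i := i) (t := t)
    (n := ⌊(t - 1) / 2⌋₊) (by linarith)) h9.le
  linarith [h2.1, h2.2]

end RayGluing

/-! ### The boundaries of the curtain models of `W` and `Z` -/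

/-- In the tree, the products of points of γ_i and γ_j with i ≠ j are constant, and those of α⁺ with
γ_i are at most the attaching position of γ_i, so the endpoints are distinct. Far out along α⁺ that
bound is attained, and it tends to infinity with i, which gives the convergence. -/
theorem exists_endpoints_spaceW {lam : ℕ → ℝ} (hlam : IsCurtainWeight lam) :
    ∃ (ξ : ℕ → GromovBoundary (curtainDist SpaceW lam))
      (a : GromovBoundary (curtainDist SpaceW lam)),
      (∀ i, GromovBoundary.IsEndpoint (RayGluing.gluedRay pointW i) (ξ i)) ∧
      GromovBoundary.IsEndpoint alphaPlus a ∧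
      Function.Injective ξ ∧ (∀ i, ξ i ≠ a) ∧ Tendsto ξ atTop (𝓝 a) := by
  have T := RayGluing.treeLike (p := pointW) hlam
  set F := RayGluing.axisCoord pointW lam with hF
  set P := treeProduct RayGluing.rayIndex (RayGluing.axisDist lam)
    (fun x : SpaceW => F (RayGluing.ang x)) with hP
  have hF0 : ∀ {t : ℝ}, 0 ≤ t → 0 ≤ F t := RayGluing.axisCoord_nonneg hlam
  have hFt : Tendsto F atTop atTop := RayGluing.tendsto_axisCoord hlam
  have hfst : Tendsto (Prod.fst : ℝ × ℝ → ℝ) atTop atTop := by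
    rw [← prod_atTop_atTop_eq]; exact tendsto_fst
  have hsnd : Tendsto (Prod.snd : ℝ × ℝ → ℝ) atTop atTop := by
    rw [← prod_atTop_atTop_eq]; exact tendsto_snd
  have hPray : ∀ i {s t : ℝ}, 0 < s → 0 < t →
      P (RayGluing.gluedRay pointW i s) (RayGluing.gluedRay pointW i t) =
        |F i| + min (RayGluing.axisDist lam (RayGluing.gluedRay pointW i s))
          (RayGluing.axisDist lam (RayGluing.gluedRay pointW i t)) := by
    intro i s t hs ht
    rw [RayGluing.gluedRay_of_pos i hs, RayGluing.gluedRay_of_pos i ht, hP, treeProduct,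
      if_pos ⟨rfl, by simp [RayGluing.rayIndex]⟩]
    rfl
  have hPrays : ∀ {i j}, i ≠ j → ∀ {s t : ℝ}, 0 < s → 0 < t →
      P (RayGluing.gluedRay pointW i s) (RayGluing.gluedRay pointW j t) =
        lineProduct (F i) (F j) := by
    intro i j hij s t hs ht
    rw [RayGluing.gluedRay_of_pos i hs, RayGluing.gluedRay_of_pos j ht, hP, treeProduct,
      if_neg fun h => hij (by simpa [RayGluing.rayIndex] using h.1)]
    rfl
  have hPaxis : ∀ (x : SpaceW) (t : ℝ),
      P (alphaPlus t) x = lineProduct (F t) (F (RayGluing.ang x)) := by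
    intro x t
    rw [hP, treeProduct, if_neg fun h => h.2 rfl]
    rfl
  have hPγ : ∀ i {s : ℝ} (t : ℝ), 0 < s →
      P (alphaPlus t) (RayGluing.gluedRay pointW i s) = lineProduct (F t) (F i) := by
    intro i s t hs
    rw [hPaxis, RayGluing.gluedRay_of_pos i hs]
    rfl
  have hγ : ∀ i, Tendsto (fun q : ℝ × ℝ => P (RayGluing.gluedRay pointW i q.1)
      (RayGluing.gluedRay pointW i q.2)) atTop atTop := by
    intro i
    have h1 := RayGluing.tendsto_axisDist_gluedRay (p := pointW) hlam i
    have h2 := tendsto_atTop.1 (h1.comp hfst)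
    have h3 := tendsto_atTop.1 (h1.comp hsnd)
    refine tendsto_atTop.2 fun b => ?_
    filter_upwards [h2 b, h3 b, hfst.eventually_gt_atTop 0, hsnd.eventually_gt_atTop 0]
      with q hb hb' hq hq'
    rw [hPray i hq hq']
    exact le_trans (le_min hb hb') (le_add_of_nonneg_left (abs_nonneg _))
  have hα : Tendsto (fun q : ℝ × ℝ => P (alphaPlus q.1) (alphaPlus q.2)) atTop atTop := by
    have h2 := tendsto_atTop.1 (hFt.comp hfst)
    have h3 := tendsto_atTop.1 (hFt.comp hsnd)
    refine tendsto_atTop.2 fun b => ?_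
    filter_upwards [h2 b, h3 b, hfst.eventually_ge_atTop 0, hsnd.eventually_ge_atTop 0]
      with q hb hb' hq hq'
    rw [hPaxis, show RayGluing.ang (alphaPlus q.2) = q.2 from rfl,
      lineProduct_of_nonneg (hF0 hq) (hF0 hq')]
    exact le_min hb hb'
  choose hγe hγ' using fun i => T.exists_isEndpoint (hγ i)
  obtain ⟨hαe, hα'⟩ := T.exists_isEndpoint hα
  have hpos : ∀ᶠ q : ℕ × ℕ in atTop, 0 < q.1 ∧ 0 < q.2 :=
    eventually_atTop.2 ⟨(1, 1), fun q hq => ⟨hq.1, hq.2⟩⟩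
  refine ⟨_, _, hγ', hα', ?_, ?_, ?_⟩
  · intro i j e
    by_contra hij
    -- Equality of the classes would make the products tend to infinity, whereas between different
    -- rays they never exceed |F i|. The indices are kept positive so that the points lie in the
    -- interiors of the rays.
    obtain ⟨q, hq, hq'⟩ := ((((T.mk_eq_mk_iff.1 e).eventually_gt_atTop |F i|).and hpos)).exists
    change |F i| < P (RayGluing.gluedRay pointW i q.1) (RayGluing.gluedRay pointW j q.2) at hq
    rw [hPrays hij (Nat.cast_pos.2 hq'.1) (Nat.cast_pos.2 hq'.2)] at hq
    exact absurd (lineProduct_le_left (F i) (F j)) (not_le.2 hq)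
  · intro i e
    obtain ⟨q, hq, hq'⟩ := ((((T.mk_eq_mk_iff.1 e.symm).eventually_gt_atTop |F i|).and hpos)).exists
    change |F i| < P (alphaPlus q.1) (RayGluing.gluedRay pointW i q.2) at hq
    rw [hPγ i _ (Nat.cast_pos.2 hq'.2), lineProduct_comm] at hq
    exact absurd (lineProduct_le_left (F i) (F q.1)) (not_le.2 hq)
  · refine tendsto_nhds.2 fun U hU haU => ?_
    obtain ⟨R, hR⟩ := hU _ haU (RayGluing.axis pointW 0)
    have hFn : Tendsto (fun i : ℕ => F i) atTop atTop := hFt.comp tendsto_natCast_atTop_atTop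
    have hfst' : Tendsto (Prod.fst : ℕ × ℕ → ℕ) atTop atTop := by
      rw [← prod_atTop_atTop_eq]; exact tendsto_fst
    filter_upwards [hFn.eventually_ge_atTop (R + (3 / 2 * (3 * weightSum lam 3 7 +
      4 * weightSum lam 4 8) + curtainDist SpaceW lam (RayGluing.axis pointW 0)
        (RayGluing.axis pointW 0)))] with i hi
    refine hR _ (le_trans ?_ (T.le_product (R := F i) ?_ _))
    · rw [EReal.coe_le_coe_iff]
      linarith
    · filter_upwards [hpos, (hFn.comp hfst').eventually_ge_atTop (F i)] with q hq hq'
      change F i ≤ P (alphaPlus q.1) (RayGluing.gluedRay pointW i q.2)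
      rw [hPγ i _ (Nat.cast_pos.2 hq.2), lineProduct_of_nonneg (hF0 (Nat.cast_nonneg _))
        (hF0 (Nat.cast_nonneg _))]
      exact le_min hq' le_rfl

theorem isOpen_singleton_spaceZ {lam : ℕ → ℝ} (hlam : IsCurtainWeight lam)
    (a : GromovBoundary (curtainDist SpaceZ lam)) : IsOpen {a} := by
  have T := RayGluing.treeLike (p := pointZ) hlam
  refine T.isOpen_singleton (fun x hx => ?_) a
  rcases x with q | ⟨i, s, hs⟩
  · exact absurd rfl hx
  -- All rays of Z are glued at angle 0, so their position on the axis is that of the base point.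
  · exact T.φ_base

theorem not_exists_tendsto_spaceZ {lam : ℕ → ℝ} (hlam : IsCurtainWeight lam) :
    ¬ ∃ (ξ : ℕ → GromovBoundary (curtainDist SpaceZ lam))
        (a : GromovBoundary (curtainDist SpaceZ lam)),
      (∀ i, ξ i ≠ a) ∧ Tendsto ξ atTop (𝓝 a) := by
  rintro ⟨ξ, a, hne, ht⟩
  obtain ⟨i, hi⟩ := (ht.eventually_mem
    ((isOpen_singleton_spaceZ hlam a).mem_nhds (mem_singleton a))).exists
  exact hne i hi

/-! ### The theorem -/

theorem mainTheorem2 :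
    IsCAT0 SpaceW ∧ IsCAT0 SpaceZ ∧ QuasiIsometric SpaceW SpaceZ ∧
    ∀ lam : ℕ → ℝ, IsCurtainWeight lam →
      -- the curtain models of `W` and `Z` are Gromov hyperbolic metric spaces
      IsMetric (curtainDist SpaceW lam) ∧
      IsMetric (curtainDist SpaceZ lam) ∧
      IsGromovHyperbolic (curtainDist SpaceW lam) ∧
      IsGromovHyperbolic (curtainDist SpaceZ lam) ∧
      -- their Gromov boundaries are not homeomorphic
      IsEmpty (GromovBoundary (curtainDist SpaceW lam) ≃ₜ
        GromovBoundary (curtainDist SpaceZ lam)) ∧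
      -- the endpoints of the rays `γ_i` are distinct, differ from that of `α⁺`, and converge to it
      (∃ (ξ : ℕ → GromovBoundary (curtainDist SpaceW lam))
          (a : GromovBoundary (curtainDist SpaceW lam)),
        (∀ i, GromovBoundary.IsEndpoint (RayGluing.gluedRay pointW i) (ξ i)) ∧
        GromovBoundary.IsEndpoint alphaPlus a ∧
        Function.Injective ξ ∧ (∀ i, ξ i ≠ a) ∧
        Tendsto ξ atTop (𝓝 a)) ∧
      -- in the boundary of the curtain model of `Z` no sequence converges to a point that is
      -- different from all its members
      ¬ ∃ (ξ : ℕ → GromovBoundary (curtainDist SpaceZ lam))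
          (a : GromovBoundary (curtainDist SpaceZ lam)),
        (∀ i, ξ i ≠ a) ∧ Tendsto ξ atTop (𝓝 a) := by
  refine ⟨RayGluing.hasCNPoints_parkingLot.isCAT0, RayGluing.hasCNPoints_parkingLot.isCAT0,
    quasiIsometric_spaceW_spaceZ, fun lam hlam => ?_⟩
  refine ⟨isMetric_curtainDist RayGluing.hasCNPoints_parkingLot hlam,
    isMetric_curtainDist RayGluing.hasCNPoints_parkingLot hlam,
    (RayGluing.treeLike hlam).isGromovHyperbolic, (RayGluing.treeLike hlam).isGromovHyperbolic,
    ⟨fun e => ?_⟩, exists_endpoints_spaceW hlam, not_exists_tendsto_spaceZ hlam⟩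
  -- A homeomorphism would carry the endpoints of the γ_i to a sequence converging nontrivially in
  -- the boundary of the model of Z.
  obtain ⟨ξ, a, -, -, -, hne, ht⟩ := exists_endpoints_spaceW hlam
  exact not_exists_tendsto_spaceZ hlam ⟨fun i => e (ξ i), e a, fun i h => hne i (e.injective h),
    (e.continuous.tendsto a).comp ht⟩

end
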